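/- Let $\mathbb{D}^2\subset\mathbb{R}^2$ be the unit disk with boundary circle $\mathbb{S}^1$, let $K:\overline{\mathbb{D}^2}\to\mathbb{R}$ and $h:\mathbb{S}^1\to\mathbb{R}$ be continuous functions (of arbitrary sign), and let $$\mathbb{X}=\left\{u\in H^1(\mathbb{D}^2):\ \int_{\mathbb{D}^2}Ke^u>0,\ \int_{\mathbb{S}^1}he^{u/2}>0\right\},$$ where on $\mathbb{S}^1$ the function $u$ is understood in the sense of traces, and the integrals are taken with respect to area on $\mathbb{D}^2$ and arc length on $\mathbb{S}^1$. For $u\in\mathbb{X}$ and $\rho\in[0,2\pi]$ put $$I_\rho(u)=\frac12\int_{\mathbb{D}^2}|\nabla u|^2-2\rho\log\int_{\mathbb{D}^2}Ke^u+2\int_{\mathbb{S}^1}u-4(2\pi-\rho)\log\int_{\mathbb{S}^1}he^{u/2}+4(2\pi-\rho)\log(2\pi-\rho)+2\rho+2\rho\log\rho,$$ with the convention $0\log 0=0$. Then there exists a constant $C\in\mathbb{R}$ (which may depend on $K$ and $h$, but not on $u$ or $\rho$) such that $$I_\rho(u)\ge C\qquad\text{for every }u\in\mathbb{X}\text{ and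 every }\rho\in[0,2\pi].$$ -/

import Mathlib

open MeasureTheory Filter Topology
open scoped ContDiff

/-! The plane `ℝ²` is identified with `ℂ`; differentiation and gradients are over `ℝ`, and
the absolute value of a complex number is the Euclidean norm of the corresponding vector. -/

namespace DiskCurvature

/-- The open unit disk of the plane. -/
def disk : Set ℂ := Metric.ball 0 1

/-- Lebesgue measure (area) on the disk. -/
noncomputable def diskMeasure : Measure ℂ := volume.restrict disk

/-- The arc-length measure of the unit circle, as a measure on the plane: the image of Lebesgue
measure on `(0, 2π]` under `θ ↦ exp (i θ)`. -/
noncomputable def circleMeasure : Measure ℂ :=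
  Measure.map (circleMap 0 1) (volume.restrict (Set.Ioc 0 (2 * Real.pi)))

/-- The classical gradient (over `ℝ`) of a real function on the plane. -/
noncomputable def grad (φ : ℂ → ℝ) (z : ℂ) : ℂ :=
  ((fderiv ℝ φ z 1 : ℝ) : ℂ) + ((fderiv ℝ φ z Complex.I : ℝ) : ℂ) * Complex.I

/-- `G ∈ L²(disk; ℝ²)` is the weak gradient of `u` in the disk:
`∫ u ∇φ = - ∫ φ G` for every test function `φ ∈ C_c^∞(disk)`. -/
structure IsWeakGradient (u : ℂ → ℝ) (G : ℂ → ℂ) : Prop where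
  memLp : MemLp G 2 diskMeasure
  integral_eq : ∀ φ : ℂ → ℝ, ContDiff ℝ ∞ φ → HasCompactSupport φ → tsupport φ ⊆ disk →
    ∫ z, u z • grad φ z ∂diskMeasure = - ∫ z, φ z • G z ∂diskMeasure

/-- The Sobolev space `H¹(disk) = W^{1,2}(disk)`. -/
def H1 : Set (ℂ → ℝ) := {u | MemLp u 2 diskMeasure ∧ ∃ G, IsWeakGradient u G}

/-- The weak gradient of a function of `H¹(disk)`, unique up to null sets. -/
noncomputable def weakGradient (u : ℂ → ℝ) : ℂ → ℂ := Classical.epsilon (IsWeakGradient u)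

/-- `g ∈ L²(circle)` is the boundary trace of `u ∈ H¹(disk)`: there are functions `φ n`, smooth up
to the boundary, with `φ n → u` in `H¹(disk)` and `φ n → g` in `L²(circle)`. That is, `u ↦ g` is the
continuous extension to `H¹(disk)` of the restriction of smooth functions to the circle. -/
def IsTrace (u g : ℂ → ℝ) : Prop :=
  MemLp g 2 circleMeasure ∧
  ∃ φ : ℕ → ℂ → ℝ, (∀ n, ContDiff ℝ ∞ (φ n)) ∧
    Tendsto (fun n => eLpNorm (φ n - u) 2 diskMeasure) atTop (𝓝 0) ∧
    Tendsto (fun n => eLpNorm (grad (φ n) - weakGradient u) 2 diskMeasure) atTop (𝓝 0) ∧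
    Tendsto (fun n => eLpNorm (φ n - g) 2 circleMeasure) atTop (𝓝 0)

/-- The boundary trace of a function of `H¹(disk)`, unique up to null sets of the circle. -/
noncomputable def trace (u : ℂ → ℝ) : ℂ → ℝ := Classical.epsilon (IsTrace u)

/-- The space `𝕏` of those `u ∈ H¹(disk)` with `∫_disk K e^u > 0` and `∫_circle h e^{u/2} > 0`. -/
def spaceX (K h : ℂ → ℝ) : Set (ℂ → ℝ) :=
  {u | u ∈ H1 ∧ 0 < ∫ z, K z * Real.exp (u z) ∂diskMeasure ∧
    0 < ∫ z, h z * Real.exp (trace u z / 2) ∂circleMeasure}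

/-- The energy functional `I_ρ(u) = I(u, ρ)`. At `ρ = 0` and `ρ = 2π` the terms `ρ log ρ` and
`(2π - ρ) log (2π - ρ)` are `0`, which is their continuous extension. -/
noncomputable def energy (K h : ℂ → ℝ) (ρ : ℝ) (u : ℂ → ℝ) : ℝ :=
  (1 / 2) * ∫ z, ‖weakGradient u z‖ ^ 2 ∂diskMeasure
    - 2 * ρ * Real.log (∫ z, K z * Real.exp (u z) ∂diskMeasure)
    + 2 * ∫ z, trace u z ∂circleMeasure
    - 4 * (2 * Real.pi - ρ) * Real.log (∫ z, h z * Real.exp (trace u z / 2) ∂circleMeasure)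
    + 4 * (2 * Real.pi - ρ) * Real.log (2 * Real.pi - ρ)
    + 2 * ρ + 2 * ρ * Real.log ρ

end DiskCurvature

namespace DiskCurvature

open Set Real

open scoped ComplexConjugate Convolution

/-! Write D for the disk and S for the circle. Everything rests on the two sharp inequalities of
`exp_inequalities`: a Moser–Trudinger inequality with boundary mean, log ∫_D e^u ≤ log 2π +
(1/8π)∫|∇u|² + (1/2π)∫_S u, and the Lebedev–Milin inequality for u/2, log ∫_S e^{u/2} ≤ log 2π +
(1/16π)∫|∇u|² + (1/4π)∫_S u. Weighted by 2ρ and 4(2π-ρ), their Dirichlet terms add up to exactly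
½∫|∇u|² and their means to 2∫_S u, whatever ρ is. Hence these terms cancel in the functional;
replacing K and h by a common upper bound costs a bounded term, and x log x ≥ -1 controls the rest
(`energy_ge`).

For smooth u both inequalities come from duality: log ∫e^u is the supremum of ∫q(u - log q) over
probability densities q, and polynomials in z and conj z suffice as densities. Given q, split u = w
+ Re P, where P is a holomorphic polynomial and Re P carries the Fourier modes of u on S up to a
degree N depending on q. The Dirichlet energy splits orthogonally (`dirichlet_split`). On the circle
q does not see w, and Gibbs' inequality against e^{Re P} reduces `entropy_circle` to harmonic
polynomials. In the disk (`entropy_disk`), solve -Δψ = q with ψ = 0 on S; then ∫wq = ∫∇w·∇ψ ≤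
(1/8π)∫|∇w|² + 2π∫ψq, and the pointwise bound `potential_le_entropy` for 2πψ replaces the last term
by the entropy of q relative to e^{Re P} plus log(2∫e^{Re P}). That bound is obtained by moving the
point to the centre with a disk automorphism, writing the value there as an integral against
-log|z|, and applying Gibbs' inequality with weight 1/|z|. The pulled-back density e^{Re P} is the
squared modulus of a holomorphic function, so this weight at most doubles its mass.

There remain harmonic polynomials. Here e^{Re P} is, up to a constant, |e^Q|² with Q = (P - P(0))/2,
and the coefficients of e^Q are majorized by Cauchy–Schwarz in their recursion (`sq_norm_coeff_le`).
Constant weights give Lebedev–Milin on the circle (`lebedev_milin_polynomial`); weights n + 1 give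
the area version with half the exponent (`carleman_polynomial`). Finally, density of smooth
functions, the trace inequality and Fatou's lemma carry both inequalities to H¹. -/

/-! ### Polar coordinates and integration on the disk. -/

theorem circleMap_zero_eq (r θ : ℝ) : circleMap 0 r θ = (r : ℂ) * Complex.exp (θ * Complex.I) := by
  simp [circleMap]

theorem polarCoord_symm_eq_circleMap (p : ℝ × ℝ) :
    Complex.polarCoord.symm p = circleMap 0 p.1 p.2 := by
  rw [Complex.polarCoord_symm_apply, circleMap_zero_eq, Complex.exp_mul_I]
  push_cast
  rfl

theorem polarTarget_eq : polarCoord.target = Ioi (0 : ℝ) ×ˢ Ioo (-π) π := rfl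

/-- Integrals over the disk in polar coordinates. -/
theorem integral_disk_eq_polar {E : Type*} [NormedAddCommGroup E] [NormedSpace ℝ E] (f : ℂ → E) :
    ∫ z, f z ∂diskMeasure =
      ∫ p in Ioo (0 : ℝ) 1 ×ˢ Ioo (-π) π, p.1 • f (circleMap 0 p.1 p.2) := by
  have hd : MeasurableSet disk := Metric.isOpen_ball.measurableSet
  rw [diskMeasure, ← integral_indicator hd, ← Complex.integral_comp_polarCoord_symm, polarTarget_eq]
  have hsub : Ioo (0 : ℝ) 1 ×ˢ Ioo (-π) π ⊆ Ioi (0 : ℝ) ×ˢ Ioo (-π) π :=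
    Set.prod_mono (fun x hx => hx.1) subset_rfl
  rw [setIntegral_eq_of_subset_of_forall_sdiff_eq_zero
    (measurableSet_Ioi.prod measurableSet_Ioo) hsub]
  · refine setIntegral_congr_fun (measurableSet_Ioo.prod measurableSet_Ioo) ?_
    rintro ⟨r, θ⟩ ⟨hr, -⟩
    change 0 < r ∧ r < 1 at hr
    have : circleMap 0 r θ ∈ disk := by
      simp [disk, abs_of_pos hr.1, hr.2]
    simp only [polarCoord_symm_eq_circleMap]
    rw [indicator_of_mem this]
  · rintro ⟨r, θ⟩ ⟨⟨hr, hθ⟩, hn⟩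
    have : circleMap 0 r θ ∉ disk := by
      intro h
      simp only [disk, mem_ball_zero_iff, norm_circleMap_zero, abs_of_pos (mem_Ioi.1 hr)] at h
      exact hn ⟨⟨hr, h⟩, hθ⟩
    simp only [polarCoord_symm_eq_circleMap] at *
    rw [indicator_of_notMem this, smul_zero]

theorem lintegral_disk_eq_polar (f : ℂ → ENNReal) :
    ∫⁻ z, f z ∂diskMeasure =
      ∫⁻ p in Ioo (0 : ℝ) 1 ×ˢ Ioo (-π) π, ENNReal.ofReal p.1 * f (circleMap 0 p.1 p.2) := by
  have hd : MeasurableSet disk := Metric.isOpen_ball.measurableSet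
  rw [diskMeasure, ← lintegral_indicator hd, ← Complex.lintegral_comp_polarCoord_symm,
    polarTarget_eq]
  have hm : MeasurableSet (Ioo (0 : ℝ) 1 ×ˢ Ioo (-π) π) := measurableSet_Ioo.prod measurableSet_Ioo
  have hm' : MeasurableSet (Ioi (0 : ℝ) ×ˢ Ioo (-π) π) := measurableSet_Ioi.prod measurableSet_Ioo
  rw [← lintegral_indicator hm, ← lintegral_indicator hm']
  congr 1
  ext ⟨r, θ⟩
  simp only [polarCoord_symm_eq_circleMap, smul_eq_mul, indicator, mem_prod, mem_Ioo, mem_Ioi,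
    disk, mem_ball_zero_iff, norm_circleMap_zero]
  by_cases hr : 0 < r
  · simp only [hr, abs_of_pos hr, true_and]
    by_cases h1 : r < 1 <;> simp [h1]
  · simp [hr]

theorem integrableOn_polar_of_continuousOn {E : Type*} [NormedAddCommGroup E] {g : ℝ × ℝ → E}
    (hg : ContinuousOn g (Icc (0 : ℝ) 1 ×ˢ univ)) :
    IntegrableOn g (Ioo (0 : ℝ) 1 ×ˢ Ioo (-π) π) :=
  ((hg.mono (Set.prod_mono_right (subset_univ _))).integrableOn_compact (isCompact_Icc.prod isCompact_Icc)).mono_set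
    (Set.prod_mono Ioo_subset_Icc_self Ioo_subset_Icc_self)

/-- A measurable function on the disk whose polar representation (with the Jacobian) extends
continuously is integrable. -/
theorem integrable_disk_of_polar {E : Type*} [NormedAddCommGroup E] [NormedSpace ℝ E] {f : ℂ → E}
    (hf : AEStronglyMeasurable f diskMeasure) {g : ℝ × ℝ → E}
    (hg : ContinuousOn g (Icc (0 : ℝ) 1 ×ˢ univ))
    (h : ∀ r ∈ Ioo (0 : ℝ) 1, ∀ θ, r • f (circleMap 0 r θ) = g (r, θ)) :
    Integrable f diskMeasure := by
  refine ⟨hf, ?_⟩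
  rw [hasFiniteIntegral_iff_enorm, lintegral_disk_eq_polar]
  have := (integrableOn_polar_of_continuousOn hg).2
  rw [hasFiniteIntegral_iff_enorm] at this
  refine lt_of_le_of_lt (le_of_eq ?_) this
  refine setLIntegral_congr_fun (measurableSet_Ioo.prod measurableSet_Ioo) ?_
  rintro ⟨r, θ⟩ ⟨hr, -⟩
  change 0 < r ∧ r < 1 at hr
  simp only
  rw [← h r hr θ, enorm_smul, Real.enorm_of_nonneg hr.1.le]

/-- Iterated polar integration for functions with continuous polar representation. -/
theorem integral_disk_eq_intervalIntegral {E : Type*} [NormedAddCommGroup E] [NormedSpace ℝ E]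
    {f : ℂ → E} {g : ℝ × ℝ → E}
    (hg : ContinuousOn g (Icc (0 : ℝ) 1 ×ˢ univ))
    (h : ∀ r ∈ Ioo (0 : ℝ) 1, ∀ θ, r • f (circleMap 0 r θ) = g (r, θ)) :
    ∫ z, f z ∂diskMeasure = ∫ r in (0 : ℝ)..1, ∫ θ in (0 : ℝ)..2 * π, g (r, θ) := by
  rw [integral_disk_eq_polar]
  rw [setIntegral_congr_fun (g := g) (measurableSet_Ioo.prod measurableSet_Ioo)
    (by rintro ⟨r, θ⟩ ⟨hr, -⟩; exact h r hr θ)]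
  rw [Measure.volume_eq_prod, setIntegral_prod _ (by
    rw [← Measure.volume_eq_prod]; exact integrableOn_polar_of_continuousOn hg)]
  rw [intervalIntegral.integral_of_le zero_le_one, integral_Ioc_eq_integral_Ioo]
  refine setIntegral_congr_fun measurableSet_Ioo fun r hr => ?_
  -- Polar coordinates use angles in (-π, π); periodicity moves them to (0, 2π).
  have hp : Function.Periodic (fun θ => g (r, θ)) (2 * π) := by
    intro θ
    simp only [← h r hr, periodic_circleMap 0 r θ]
  have := hp.intervalIntegral_add_eq (-π) 0
  rw [show -π + 2 * π = π by ring, zero_add] at this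
  rw [← this, intervalIntegral.integral_of_le (by linarith [pi_pos]), integral_Ioc_eq_integral_Ioo]

theorem continuous_circleMap_uncurry : Continuous fun p : ℝ × ℝ => circleMap 0 p.1 p.2 := by
  unfold circleMap
  fun_prop

theorem integral_disk_continuous {E : Type*} [NormedAddCommGroup E] [NormedSpace ℝ E]
    {f : ℂ → E} (hf : Continuous f) :
    ∫ z, f z ∂diskMeasure =
      ∫ r in (0 : ℝ)..1, ∫ θ in (0 : ℝ)..2 * π, r • f (circleMap 0 r θ) :=
  integral_disk_eq_intervalIntegral (g := fun p => p.1 • f (circleMap 0 p.1 p.2))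
    (continuous_fst.smul (hf.comp continuous_circleMap_uncurry)).continuousOn (fun _ _ _ => rfl)

theorem isFiniteMeasure_diskMeasure : IsFiniteMeasure diskMeasure :=
  ⟨by rw [diskMeasure, Measure.restrict_apply_univ]; exact measure_ball_lt_top⟩

attribute [instance] isFiniteMeasure_diskMeasure

theorem integrable_disk_of_continuousOn {E : Type*} [NormedAddCommGroup E] {f : ℂ → E}
    (hf : ContinuousOn f (Metric.closedBall 0 1)) : Integrable f diskMeasure :=
  (hf.integrableOn_compact (isCompact_closedBall 0 1)).mono_set Metric.ball_subset_closedBall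

theorem integrable_disk_of_continuous {E : Type*} [NormedAddCommGroup E] {f : ℂ → E}
    (hf : Continuous f) : Integrable f diskMeasure :=
  integrable_disk_of_continuousOn hf.continuousOn

/-! ### The Wirtinger operator and Green's theorem. -/

/-- Twice the Wirtinger derivative `∂/∂z` of a planar vector field: its real part is the divergence
and its imaginary part the curl. -/
noncomputable def wirtinger (X : ℂ → ℂ) (z : ℂ) : ℂ :=
  fderiv ℝ X z 1 - Complex.I * fderiv ℝ X z Complex.I

theorem continuous_wirtinger {X : ℂ → ℂ} (hX : ContDiff ℝ 1 X) : Continuous (wirtinger X) := by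
  have h := hX.continuous_fderiv one_ne_zero
  unfold wirtinger
  exact (h.clm_apply continuous_const).sub (continuous_const.mul (h.clm_apply continuous_const))

theorem fderiv_eq_re_im (X : ℂ → ℂ) (z w : ℂ) :
    fderiv ℝ X z w = w.re * fderiv ℝ X z 1 + w.im * fderiv ℝ X z Complex.I := by
  conv_lhs => rw [show w = w.re • (1 : ℂ) + w.im • Complex.I by
    apply Complex.ext <;> simp]
  rw [map_add, map_smul, map_smul, Complex.real_smul, Complex.real_smul]

theorem hasDerivAt_circleMap_radius (r θ : ℝ) :
    HasDerivAt (fun r : ℝ => circleMap 0 r θ) (Complex.exp (θ * Complex.I)) r := by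
  simp only [circleMap_zero_eq]
  simpa using (Complex.ofRealCLM.hasDerivAt (x := r)).mul_const (Complex.exp (θ * Complex.I))

/-- Green's theorem for a disk centred at the origin, in complex form. -/
theorem green_polar {X : ℂ → ℂ} (hX : ContDiff ℝ 1 X) (R : ℝ) :
    ∫ r : ℝ in 0..R, ∫ θ : ℝ in 0..2 * π, (r : ℂ) * wirtinger X (circleMap 0 r θ) =
      ∫ θ : ℝ in 0..2 * π, R * Complex.exp (-(θ * Complex.I)) * X (circleMap 0 R θ) := by
  have hd : ∀ z, HasFDerivAt X (fderiv ℝ X z) z := fun z =>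
    (hX.differentiable one_ne_zero z).hasFDerivAt
  have hcf : Continuous fun p : ℂ × ℂ => fderiv ℝ X p.1 p.2 :=
    (hX.continuous_fderiv one_ne_zero).comp continuous_fst |>.clm_apply continuous_snd
  -- A is the r-derivative of r e^{-iθ}X and B the θ-derivative of e^{-iθ}X. The integrand is A -
  -- iB: B integrates to zero over a period and A to its boundary value.
  let A : ℝ → ℝ → ℂ := fun r θ => Complex.exp (-(θ * Complex.I)) * X (circleMap 0 r θ) +
    r * Complex.exp (-(θ * Complex.I)) * fderiv ℝ X (circleMap 0 r θ) (Complex.exp (θ * Complex.I))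
  let B : ℝ → ℝ → ℂ := fun r θ => -Complex.I * Complex.exp (-(θ * Complex.I)) *
      X (circleMap 0 r θ) +
    Complex.exp (-(θ * Complex.I)) * fderiv ℝ X (circleMap 0 r θ) (circleMap 0 r θ * Complex.I)
  have hcA : Continuous (Function.uncurry A) := by
    have h1 : Continuous fun p : ℝ × ℝ => X (circleMap 0 p.1 p.2) :=
      hX.continuous.comp continuous_circleMap_uncurry
    have h2 : Continuous fun p : ℝ × ℝ => fderiv ℝ X (circleMap 0 p.1 p.2)
        (Complex.exp (p.2 * Complex.I)) :=
      hcf.comp (continuous_circleMap_uncurry.prodMk (by fun_prop))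
    simp only [Function.uncurry_def, A]
    fun_prop
  have hcB : Continuous (Function.uncurry B) := by
    have h1 : Continuous fun p : ℝ × ℝ => X (circleMap 0 p.1 p.2) :=
      hX.continuous.comp continuous_circleMap_uncurry
    have h2 : Continuous fun p : ℝ × ℝ => fderiv ℝ X (circleMap 0 p.1 p.2)
        (circleMap 0 p.1 p.2 * Complex.I) :=
      hcf.comp (continuous_circleMap_uncurry.prodMk
        (continuous_circleMap_uncurry.mul continuous_const))
    simp only [Function.uncurry_def, B]
    fun_prop
  have key : ∀ r θ : ℝ, (r : ℂ) * wirtinger X (circleMap 0 r θ) = A r θ - Complex.I * B r θ := by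
    intro r θ
    have he : Complex.exp (-(θ * Complex.I)) * Complex.exp (θ * Complex.I) = 1 := by
      rw [← Complex.exp_add]; simp
    have hc : Complex.exp (θ * Complex.I) = Real.cos θ + Real.sin θ * Complex.I := by
      rw [Complex.exp_mul_I]; simp
    simp only [A, B, wirtinger]
    rw [fderiv_eq_re_im X _ (Complex.exp (θ * Complex.I)),
      fderiv_eq_re_im X _ (circleMap 0 r θ * Complex.I)]
    have h1 : (Complex.exp (θ * Complex.I)).re = Real.cos θ := by rw [hc]; simp [-Complex.ofReal_cos, -Complex.ofReal_sin]
    have h2 : (Complex.exp (θ * Complex.I)).im = Real.sin θ := by rw [hc]; simp [-Complex.ofReal_cos, -Complex.ofReal_sin]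
    have h3 : (circleMap 0 r θ * Complex.I).re = -(r * Real.sin θ) := by
      rw [circleMap_zero_eq, hc]; simp [-Complex.ofReal_cos, -Complex.ofReal_sin]
    have h4 : (circleMap 0 r θ * Complex.I).im = r * Real.cos θ := by
      rw [circleMap_zero_eq, hc]; simp [-Complex.ofReal_cos, -Complex.ofReal_sin]
    rw [h1, h2, h3, h4]
    set a := fderiv ℝ X (circleMap 0 r θ) 1
    set b := fderiv ℝ X (circleMap 0 r θ) Complex.I
    set e := Complex.exp (-(θ * Complex.I))
    rw [hc] at he
    simp only [Complex.ofReal_neg, Complex.ofReal_mul]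
    have hI := Complex.I_sq
    linear_combination (-(r : ℂ) * a + Complex.I * r * b) * he +
      -(e * X (circleMap 0 r θ) + r * e * b * (Real.sin θ : ℂ)) * hI
  have hper : ∀ r : ℝ, ∫ θ in (0 : ℝ)..2 * π, B r θ = 0 := by
    intro r
    have hder : ∀ θ ∈ uIcc (0 : ℝ) (2 * π),
        HasDerivAt (fun θ : ℝ => Complex.exp (-(θ * Complex.I)) * X (circleMap 0 r θ)) (B r θ) θ := by
      intro θ _
      have h1 : HasDerivAt (fun θ : ℝ => Complex.exp (-(θ * Complex.I)))
          (-Complex.I * Complex.exp (-(θ * Complex.I))) θ := by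
        have := ((Complex.ofRealCLM.hasDerivAt (x := θ)).mul_const Complex.I).neg.cexp
        simpa [mul_comm] using this
      exact h1.mul ((hd _).comp_hasDerivAt θ (hasDerivAt_circleMap 0 r θ))
    rw [intervalIntegral.integral_eq_sub_of_hasDerivAt hder
      ((hcB.comp (continuous_const.prodMk continuous_id)).intervalIntegrable _ _)]
    have : Complex.exp (-(2 * π * Complex.I)) = 1 := by
      rw [Complex.exp_neg, Complex.exp_two_pi_mul_I, inv_one]
    simp [circleMap, this, Complex.exp_two_pi_mul_I]
  have hrad : ∀ θ : ℝ, ∫ r : ℝ in 0..R, A r θ =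
      R * Complex.exp (-(θ * Complex.I)) * X (circleMap 0 R θ) := by
    intro θ
    have hder : ∀ r ∈ uIcc (0 : ℝ) R, HasDerivAt
        (fun r : ℝ => (r : ℂ) * Complex.exp (-(θ * Complex.I)) * X (circleMap 0 r θ)) (A r θ) r := by
      intro r _
      have h1 : HasDerivAt (fun r : ℝ => (r : ℂ) * Complex.exp (-(θ * Complex.I)))
          (Complex.exp (-(θ * Complex.I))) r := by
        simpa using (Complex.ofRealCLM.hasDerivAt (x := r)).mul_const
          (Complex.exp (-(θ * Complex.I)))
      exact h1.mul ((hd _).comp_hasDerivAt r (hasDerivAt_circleMap_radius r θ))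
    rw [intervalIntegral.integral_eq_sub_of_hasDerivAt hder
      ((hcA.comp (continuous_id.prodMk continuous_const)).intervalIntegrable _ _)]
    simp
  have h1 : ∀ r : ℝ, ∫ θ in (0 : ℝ)..2 * π, (r : ℂ) * wirtinger X (circleMap 0 r θ) =
      ∫ θ in (0 : ℝ)..2 * π, A r θ := by
    intro r
    simp only [key]
    rw [intervalIntegral.integral_sub, intervalIntegral.integral_const_mul, hper]
    · simp
    · exact (hcA.comp (continuous_const.prodMk continuous_id)).intervalIntegrable _ _
    · exact (continuous_const.mul
        (hcB.comp (continuous_const.prodMk continuous_id))).intervalIntegrable _ _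
  simp only [h1]
  rw [intervalIntegral_intervalIntegral_swap]
  · simp only [hrad]
  · exact (hcA.continuousOn.integrableOn_compact
      (isCompact_uIcc.prod isCompact_uIcc)).mono_set
      (Set.prod_mono uIoc_subset_uIcc uIoc_subset_uIcc)

/-- Green's theorem on the unit disk. -/
theorem green_disk {X : ℂ → ℂ} (hX : ContDiff ℝ 1 X) :
    ∫ z, wirtinger X z ∂diskMeasure =
      ∫ θ in (0 : ℝ)..2 * π, Complex.exp (-(θ * Complex.I)) * X (circleMap 0 1 θ) := by
  rw [integral_disk_continuous (continuous_wirtinger hX)]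
  simpa using green_polar hX 1

theorem circleMap_mem_closedBall {r : ℝ} (hr : r ∈ Icc (0 : ℝ) 1) (θ : ℝ) :
    circleMap 0 r θ ∈ Metric.closedBall (0 : ℂ) 1 := by
  simp [abs_of_nonneg hr.1, hr.2]

theorem continuousOn_comp_circleMap {E : Type*} [TopologicalSpace E] {f : ℂ → E}
    (hf : ContinuousOn f (Metric.closedBall 0 1)) :
    ContinuousOn (fun p : ℝ × ℝ => f (circleMap 0 p.1 p.2)) (Icc (0 : ℝ) 1 ×ˢ univ) :=
  hf.comp continuous_circleMap_uncurry.continuousOn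
    (fun p hp => circleMap_mem_closedBall hp.1 p.2)

theorem continuous_comp_circleMap {E : Type*} [TopologicalSpace E] {f : ℂ → E}
    (hf : ContinuousOn f (Metric.closedBall 0 1)) {r : ℝ} (hr : r ∈ Icc (0 : ℝ) 1) :
    Continuous (fun θ : ℝ => f (circleMap 0 r θ)) :=
  hf.comp_continuous (continuous_circleMap 0 r) (fun θ => circleMap_mem_closedBall hr θ)

/-! ### Power series on the closed disk and Parseval identities. -/

/-- `f` is the sum of an absolutely convergent power series on the closed unit disk. -/
def HasDiskSeries (f : ℂ → ℂ) (b : ℕ → ℂ) : Prop :=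
  Summable (fun n => ‖b n‖) ∧ ∀ z ∈ Metric.closedBall (0 : ℂ) 1, HasSum (fun n => b n * z ^ n) (f z)

theorem exists_hasDiskSeries {f : ℂ → ℂ} {R : ℝ} (hR : 1 < R)
    (hf : DifferentiableOn ℂ f (Metric.ball 0 R)) :
    HasDiskSeries f (fun n => (n.factorial : ℂ)⁻¹ * iteratedDeriv n f 0) := by
  have h : ∀ z ∈ Metric.closedBall (0 : ℂ) 1,
      HasSum (fun n : ℕ => (n.factorial : ℂ)⁻¹ * iteratedDeriv n f 0 * z ^ n) (f z) := by
    intro z hz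
    have := Complex.hasSum_taylorSeries_on_ball hf (z := z)
      (Metric.closedBall_subset_ball hR hz)
    simpa [mul_assoc, mul_comm, mul_left_comm] using this
  refine ⟨?_, h⟩
  -- The point 1 lies inside the larger disk of holomorphy, and summability in ℂ is absolute, so
  -- evaluation there gives summability of the norms of the coefficients.
  have h1 := (h 1 (by simp)).summable
  simp only [one_pow, mul_one] at h1
  exact h1.norm

theorem integral_circle_pow_mul_conj_pow (r : ℝ) (n m : ℕ) :
    ∫ θ in (0 : ℝ)..2 * π, circleMap 0 r θ ^ n * (starRingEnd ℂ) (circleMap 0 r θ) ^ m =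
      if n = m then 2 * π * (r : ℂ) ^ (2 * n) else 0 := by
  have h : ∀ θ : ℝ, circleMap 0 r θ ^ n * (starRingEnd ℂ) (circleMap 0 r θ) ^ m =
      (r : ℂ) ^ (n + m) * Complex.exp (((n : ℂ) - m) * Complex.I * θ) := by
    intro θ
    rw [circleMap_zero_eq, map_mul, ← Complex.exp_conj, mul_pow, mul_pow, ← Complex.exp_nat_mul,
      ← Complex.exp_nat_mul, Complex.conj_ofReal, map_mul, Complex.conj_I, Complex.conj_ofReal,
      pow_add, show ((n : ℂ) - m) * Complex.I * θ = n * (θ * Complex.I) + m * (θ * -Complex.I) by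
        ring, Complex.exp_add]
    ring
  simp only [h, intervalIntegral.integral_const_mul]
  split_ifs with hnm
  · subst hnm
    simp [two_mul]
    ring
  · have hc : ((n : ℂ) - m) * Complex.I ≠ 0 :=
      mul_ne_zero (sub_ne_zero.2 (by exact_mod_cast hnm)) Complex.I_ne_zero
    rw [integral_exp_mul_complex hc]
    have : Complex.exp (((n : ℂ) - m) * Complex.I * (2 * π : ℝ)) = 1 := by
      rw [Complex.exp_eq_one_iff]
      exact ⟨(n : ℤ) - m, by push_cast; ring⟩
    rw [this]
    simp

theorem intervalIntegral_star (f : ℝ → ℂ) (a b : ℝ) :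
    ∫ x in a..b, (starRingEnd ℂ) (f x) = (starRingEnd ℂ) (∫ x in a..b, f x) := by
  simp only [intervalIntegral, integral_conj, map_sub]

namespace HasDiskSeries

variable {f : ℂ → ℂ} {b : ℕ → ℂ}

theorem norm_term_le {b : ℕ → ℂ} {z : ℂ} (hz : z ∈ Metric.closedBall (0 : ℂ) 1) (n : ℕ) :
    ‖b n * z ^ n‖ ≤ ‖b n‖ := by
  rw [norm_mul, norm_pow]
  exact mul_le_of_le_one_right (norm_nonneg _)
    (pow_le_one₀ (norm_nonneg _) (mem_closedBall_zero_iff.1 hz))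

theorem continuousOn (h : HasDiskSeries f b) : ContinuousOn f (Metric.closedBall 0 1) := by
  have := continuousOn_tsum (f := fun n (z : ℂ) => b n * z ^ n) (s := Metric.closedBall 0 1)
    (fun n => by fun_prop) h.1 (fun n z hz => norm_term_le hz n)
  exact this.congr fun z hz => (h.2 z hz).tsum_eq.symm

/-- Termwise integration over a circle against a bounded continuous factor. -/
theorem hasSum_circle_mul (h : HasDiskSeries f b) {r : ℝ} (hr : r ∈ Icc (0 : ℝ) 1) {g : ℂ → ℂ}
    (hg : ContinuousOn g (Metric.closedBall 0 1)) :
    HasSum (fun n => ∫ θ in (0 : ℝ)..2 * π, b n * circleMap 0 r θ ^ n * g (circleMap 0 r θ))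
      (∫ θ in (0 : ℝ)..2 * π, f (circleMap 0 r θ) * g (circleMap 0 r θ)) := by
  obtain ⟨C, hC⟩ := (isCompact_closedBall (0 : ℂ) 1).exists_bound_of_continuousOn hg
  have hgc := continuous_comp_circleMap hg hr
  refine intervalIntegral.hasSum_integral_of_dominated_convergence
    (fun n _ => ‖b n‖ * C) ?_ ?_ ?_ ?_ ?_
  · intro n
    exact Continuous.aestronglyMeasurable
      (((continuous_const.mul ((continuous_circleMap 0 r).pow n))).mul hgc)
  · intro n
    refine Eventually.of_forall fun θ _ => ?_
    rw [norm_mul]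
    exact mul_le_mul (norm_term_le (circleMap_mem_closedBall hr θ) n)
      (hC _ (circleMap_mem_closedBall hr θ)) (norm_nonneg _) (norm_nonneg _)
  · exact Eventually.of_forall fun _ _ => h.1.mul_right C
  · exact intervalIntegrable_const
  · refine Eventually.of_forall fun θ _ => ?_
    exact (h.2 _ (circleMap_mem_closedBall hr θ)).mul_right _

theorem integral_circle_mul_conj_pow (h : HasDiskSeries f b) {r : ℝ} (hr : r ∈ Icc (0 : ℝ) 1)
    (n : ℕ) :
    ∫ θ in (0 : ℝ)..2 * π, f (circleMap 0 r θ) * (starRingEnd ℂ) (circleMap 0 r θ) ^ n =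
      2 * π * b n * r ^ (2 * n) := by
  have h1 := h.hasSum_circle_mul hr (g := fun z => (starRingEnd ℂ) z ^ n)
    (Complex.continuous_conj.pow n).continuousOn
  have h2 : ∀ k, ∫ θ in (0 : ℝ)..2 * π, b k * circleMap 0 r θ ^ k *
      (starRingEnd ℂ) (circleMap 0 r θ) ^ n =
        if k = n then 2 * π * b n * (r : ℂ) ^ (2 * n) else 0 := by
    intro k
    simp only [mul_assoc, intervalIntegral.integral_const_mul, integral_circle_pow_mul_conj_pow]
    split_ifs with hk
    · subst hk; ring
    · simp
  simp only [h2] at h1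
  exact h1.unique (hasSum_ite_eq n _)

/-- Parseval's identity on circles. -/
theorem hasSum_circle (h : HasDiskSeries f b) {r : ℝ} (hr : r ∈ Icc (0 : ℝ) 1) :
    HasSum (fun n => 2 * π * ‖b n‖ ^ 2 * r ^ (2 * n))
      (∫ θ in (0 : ℝ)..2 * π, ‖f (circleMap 0 r θ)‖ ^ 2) := by
  -- Only one factor of f · conj f is expanded; the integrals that arise are conjugates of the
  -- Fourier coefficients of f on this circle, already computed.
  have h1 := h.hasSum_circle_mul hr (g := fun z => (starRingEnd ℂ) (f z))
    (Complex.continuous_conj.comp_continuousOn h.continuousOn)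
  have h2 : ∀ k, ∫ θ in (0 : ℝ)..2 * π, b k * circleMap 0 r θ ^ k *
      (starRingEnd ℂ) (f (circleMap 0 r θ)) =
        ((2 * π * ‖b k‖ ^ 2 * r ^ (2 * k) : ℝ) : ℂ) := by
    intro k
    have h3 := congrArg (fun w => b k * (starRingEnd ℂ) w) (h.integral_circle_mul_conj_pow hr k)
    simp only [← intervalIntegral_star, ← intervalIntegral.integral_const_mul] at h3
    simp only [map_mul, map_pow, Complex.conj_conj, Complex.conj_ofReal] at h3
    calc _ = _ := by
          refine intervalIntegral.integral_congr fun θ _ => ?_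
          ring
      _ = _ := h3
      _ = _ := by
          have : b k * (starRingEnd ℂ) (b k) = (‖b k‖ ^ 2 : ℝ) := by
            rw [Complex.mul_conj, Complex.normSq_eq_norm_sq]
          push_cast at this ⊢
          rw [← this, map_ofNat]
          ring
  have h3 : ∫ θ in (0 : ℝ)..2 * π, f (circleMap 0 r θ) * (starRingEnd ℂ) (f (circleMap 0 r θ)) =
      ((∫ θ in (0 : ℝ)..2 * π, ‖f (circleMap 0 r θ)‖ ^ 2 : ℝ) : ℂ) := by
    rw [← intervalIntegral.integral_ofReal]
    refine intervalIntegral.integral_congr fun θ _ => ?_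
    simp only [Complex.mul_conj, Complex.normSq_eq_norm_sq]
  simp only [h2, h3] at h1
  exact_mod_cast h1

theorem summable_sq (h : HasDiskSeries f b) : Summable (fun n => ‖b n‖ ^ 2) := by
  have := (h.hasSum_circle (r := 1) (by simp)).summable
  simp only [one_pow, mul_one] at this
  exact (summable_mul_left_iff (by positivity)).1 this

/-- Parseval's identity in the disk, with a radial weight. -/
theorem hasSum_disk_weight (h : HasDiskSeries f b) (k : ℕ) :
    HasSum (fun n => 2 * π * ‖b n‖ ^ 2 / (2 * n + k + 1))
      (∫ r in (0 : ℝ)..1, ∫ θ in (0 : ℝ)..2 * π, r ^ k * ‖f (circleMap 0 r θ)‖ ^ 2) := by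
  have h1 : HasSum (fun n => ∫ r in (0 : ℝ)..1, r ^ k * (2 * π * ‖b n‖ ^ 2 * r ^ (2 * n)))
      (∫ r in (0 : ℝ)..1, r ^ k * ∫ θ in (0 : ℝ)..2 * π, ‖f (circleMap 0 r θ)‖ ^ 2) := by
    refine intervalIntegral.hasSum_integral_of_dominated_convergence
      (fun n _ => 2 * π * ‖b n‖ ^ 2) ?_ ?_ ?_ ?_ ?_
    · intro n
      exact Continuous.aestronglyMeasurable (by fun_prop)
    · intro n
      refine Eventually.of_forall fun r hr => ?_
      rw [uIoc_of_le zero_le_one] at hr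
      rw [Real.norm_of_nonneg (by have := hr.1; positivity)]
      have h2 : r ^ k ≤ 1 := pow_le_one₀ hr.1.le hr.2
      have h3 : r ^ (2 * n) ≤ 1 := pow_le_one₀ hr.1.le hr.2
      have h4 : (0 : ℝ) ≤ r ^ k := pow_nonneg hr.1.le _
      have h5 : (0 : ℝ) ≤ 2 * π * ‖b n‖ ^ 2 := by positivity
      calc r ^ k * (2 * π * ‖b n‖ ^ 2 * r ^ (2 * n)) ≤ 1 * (2 * π * ‖b n‖ ^ 2 * 1) := by
            gcongr
            exact mul_nonneg h5 (pow_nonneg hr.1.le _)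
        _ = _ := by ring
    · exact Eventually.of_forall fun _ _ => h.summable_sq.mul_left _
    · exact intervalIntegrable_const
    · refine Eventually.of_forall fun r hr => ?_
      rw [uIoc_of_le zero_le_one] at hr
      exact (h.hasSum_circle ⟨hr.1.le, hr.2⟩).mul_left _
  simp only [intervalIntegral.integral_const_mul]
  refine h1.congr_fun ?_ |> fun x => x
  intro n
  have : ∀ r : ℝ, r ^ k * (2 * π * ‖b n‖ ^ 2 * r ^ (2 * n)) =
      2 * π * ‖b n‖ ^ 2 * r ^ (2 * n + k) := fun r => by ring
  simp only [this, intervalIntegral.integral_const_mul, integral_pow]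
  push_cast
  simp
  ring

theorem integral_disk_eq (h : HasDiskSeries f b) :
    ∫ z, ‖f z‖ ^ 2 ∂diskMeasure =
      ∫ r in (0 : ℝ)..1, ∫ θ in (0 : ℝ)..2 * π, r ^ 1 * ‖f (circleMap 0 r θ)‖ ^ 2 :=
  integral_disk_eq_intervalIntegral (g := fun p => p.1 ^ 1 * ‖f (circleMap 0 p.1 p.2)‖ ^ 2)
    ((continuous_fst.pow 1).continuousOn.mul
      ((continuousOn_comp_circleMap h.continuousOn).norm.pow 2))
    (fun r _ θ => by simp)

theorem hasSum_disk (h : HasDiskSeries f b) :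
    HasSum (fun n : ℕ => π * (‖b n‖ ^ 2 / (n + 1))) (∫ z, ‖f z‖ ^ 2 ∂diskMeasure) := by
  rw [h.integral_disk_eq]
  refine (h.hasSum_disk_weight 1).congr_fun fun n => ?_
  have : (n : ℝ) + 1 ≠ 0 := by positivity
  push_cast
  field_simp
  ring

theorem integral_disk_div_norm_eq (h : HasDiskSeries f b) :
    ∫ z, ‖f z‖ ^ 2 / ‖z‖ ∂diskMeasure =
      ∫ r in (0 : ℝ)..1, ∫ θ in (0 : ℝ)..2 * π, r ^ 0 * ‖f (circleMap 0 r θ)‖ ^ 2 :=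
  integral_disk_eq_intervalIntegral (g := fun p => p.1 ^ 0 * ‖f (circleMap 0 p.1 p.2)‖ ^ 2)
    ((continuous_fst.pow 0).continuousOn.mul
      ((continuousOn_comp_circleMap h.continuousOn).norm.pow 2))
    (fun r hr θ => by
      have := hr.1.ne'
      simp only [norm_circleMap_zero, abs_of_pos hr.1, smul_eq_mul]
      field_simp)

/-- A holomorphic density concentrates near the boundary. -/
theorem integral_disk_div_norm_le (h : HasDiskSeries f b) :
    ∫ z, ‖f z‖ ^ 2 / ‖z‖ ∂diskMeasure ≤ 2 * ∫ z, ‖f z‖ ^ 2 ∂diskMeasure := by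
  rw [h.integral_disk_div_norm_eq]
  -- Termwise this is 1/(2n+1) ≤ 1/(n+1). Equality at n = 0 shows that constants are extremal and
  -- that the factor 2 is sharp.
  refine hasSum_le (fun n => ?_) (h.hasSum_disk_weight 0) (h.hasSum_disk.mul_left 2)
  push_cast
  rw [add_zero, mul_div_assoc, ← mul_assoc 2]
  gcongr
  linarith [(n.cast_nonneg : (0 : ℝ) ≤ n)]

end HasDiskSeries

/-! ### Coefficients of the exponential of a polynomial and their majorization. -/

theorem iteratedDeriv_polynomial_eval_zero (p : Polynomial ℂ) (n : ℕ) :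
    iteratedDeriv n (fun z => p.eval z) 0 = n.factorial * p.coeff n := by
  have h : ∀ n : ℕ, iteratedDeriv n (fun z => p.eval z) =
      fun z => (Polynomial.derivative^[n] p).eval z := by
    intro n
    induction n with
    | zero => simp
    | succ n ih =>
      rw [iteratedDeriv_succ, ih]
      ext z
      rw [Polynomial.deriv, Function.iterate_succ_apply']
  rw [h]
  simp only
  rw [← Polynomial.coeff_zero_eq_eval_zero, Polynomial.coeff_iterate_derivative]
  simp [Nat.descFactorial_self]

/-- The power series of the exponential of a polynomial. -/
theorem exists_exp_series (Q : Polynomial ℂ) :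
    ∃ b : ℕ → ℂ, HasDiskSeries (fun z => Complex.exp (Q.eval z)) b ∧
      b 0 = Complex.exp (Q.coeff 0) ∧
      ∀ n : ℕ, ((n : ℂ) + 1) * b (n + 1) =
        ∑ i ∈ Finset.range (n + 1), ((i : ℂ) + 1) * Q.coeff (i + 1) * b (n - i) := by
  set F : ℂ → ℂ := fun z => Complex.exp (Q.eval z) with hF
  have hd : Differentiable ℂ F := by
    intro z
    exact (Q.differentiable z).cexp
  -- The recursion is F' = Q'F read at 0 through Leibniz's rule.
  have hder : deriv F = (fun z => Q.derivative.eval z) * F := by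
    ext z
    have := ((Q.hasDerivAt z).cexp).deriv
    simp only [hF, Pi.mul_apply]
    rw [this, mul_comm]
  refine ⟨_, exists_hasDiskSeries one_lt_two hd.differentiableOn, ?_, ?_⟩
  · simp [hF, Polynomial.coeff_zero_eq_eval_zero]
  intro n
  have h1 : iteratedDeriv (n + 1) F 0 = ∑ i ∈ Finset.range (n + 1),
      n.choose i * (i.factorial * Q.derivative.coeff i) * iteratedDeriv (n - i) F 0 := by
    rw [iteratedDeriv_succ', hder, iteratedDeriv_mul]
    · simp only [iteratedDeriv_polynomial_eval_zero]
    · exact (Q.derivative.differentiable.contDiff).contDiffAt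
    · exact hd.contDiff.contDiffAt
  rw [h1, Finset.mul_sum, Finset.mul_sum]
  refine Finset.sum_congr rfl fun i hi => ?_
  have hi' : i ≤ n := Nat.lt_succ_iff.1 (Finset.mem_range.1 hi)
  rw [Polynomial.coeff_derivative, Nat.factorial_succ]
  have h2 : (n.choose i : ℂ) * i.factorial * (n - i).factorial = n.factorial := by
    exact_mod_cast Nat.choose_mul_factorial_mul_factorial hi'
  have h3 : ((n - i).factorial : ℂ) ≠ 0 := by exact_mod_cast Nat.factorial_ne_zero _
  have h4 : (n.factorial : ℂ) ≠ 0 := by exact_mod_cast Nat.factorial_ne_zero _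
  have h5 : (n : ℂ) + 1 ≠ 0 := by exact_mod_cast Nat.succ_ne_zero n
  push_cast
  field_simp
  rw [← h2]
  ring

/-- Coefficient majorization behind the Lebedev–Milin inequality, with weights. -/
theorem sq_norm_coeff_le {a b : ℕ → ℂ} {γ W : ℕ → ℝ} {l : ℝ} (hl : 0 < l) (hW : ∀ n, 0 < W n)
    (hsum : ∀ n : ℕ, ∑ i ∈ Finset.range (n + 1), W (n - i) ≤ l * (n + 1) * W (n + 1))
    (h0 : ‖b 0‖ ^ 2 ≤ W 0 * γ 0)
    (hb : ∀ n : ℕ, ((n : ℂ) + 1) * b (n + 1) =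
      ∑ i ∈ Finset.range (n + 1), ((i : ℂ) + 1) * a (i + 1) * b (n - i))
    (hγ : ∀ n : ℕ, ((n : ℝ) + 1) * γ (n + 1) =
      ∑ i ∈ Finset.range (n + 1), ((i : ℝ) + 1) * (l * (i + 1) * ‖a (i + 1)‖ ^ 2) * γ (n - i))
    (n : ℕ) : ‖b n‖ ^ 2 ≤ W n * γ n := by
  induction n using Nat.strong_induction_on with
  | _ n ih =>
    rcases n with _ | n
    · exact h0
    have h1 : ((n : ℝ) + 1) * ‖b (n + 1)‖ ≤
        ∑ i ∈ Finset.range (n + 1), ((i : ℝ) + 1) * ‖a (i + 1)‖ * ‖b (n - i)‖ := by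
      have h2 := norm_sum_le (Finset.range (n + 1))
        (fun i => ((i : ℂ) + 1) * a (i + 1) * b (n - i))
      rw [← hb] at h2
      have h3 : ∀ i : ℕ, ‖(i : ℂ) + 1‖ = i + 1 := fun i => by
        exact_mod_cast Complex.norm_natCast (i + 1)
      simpa only [norm_mul, h3] using h2
    -- Cauchy–Schwarz with weights W (n - i). The hypothesis `hsum` is exactly what lets the sum of
    -- the weights be traded for l (n + 1) W (n + 1), so that the induction closes on the recursion
    -- for γ.
    have h2 : (((n : ℝ) + 1) * ‖b (n + 1)‖) ^ 2 ≤ (∑ i ∈ Finset.range (n + 1), W (n - i)) *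
        ∑ i ∈ Finset.range (n + 1), (((i : ℝ) + 1) * ‖a (i + 1)‖ * ‖b (n - i)‖) ^ 2 / W (n - i) := by
      refine (pow_le_pow_left₀ (by positivity) h1 2).trans ?_
      refine Finset.sum_sq_le_sum_mul_sum_of_sq_le_mul _ (fun i _ => (hW _).le)
        (fun i _ => div_nonneg (sq_nonneg _) (hW _).le) (fun i _ => ?_)
      rw [mul_div_cancel₀ _ (hW _).ne']
    have h3 : l * ∑ i ∈ Finset.range (n + 1),
        (((i : ℝ) + 1) * ‖a (i + 1)‖ * ‖b (n - i)‖) ^ 2 / W (n - i) ≤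
          ((n : ℝ) + 1) * γ (n + 1) := by
      rw [hγ, Finset.mul_sum]
      refine Finset.sum_le_sum fun i hi => ?_
      have h4 := ih (n - i) (by omega)
      have h5 : ‖b (n - i)‖ ^ 2 / W (n - i) ≤ γ (n - i) := by
        rwa [div_le_iff₀ (hW _), mul_comm]
      calc l * ((((i : ℝ) + 1) * ‖a (i + 1)‖ * ‖b (n - i)‖) ^ 2 / W (n - i))
          = ((i : ℝ) + 1) * (l * (i + 1) * ‖a (i + 1)‖ ^ 2) * (‖b (n - i)‖ ^ 2 / W (n - i)) := by
            ring
        _ ≤ _ := mul_le_mul_of_nonneg_left h5 (by positivity)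
    have hn : (0 : ℝ) < n + 1 := by positivity
    set S := ∑ i ∈ Finset.range (n + 1),
        (((i : ℝ) + 1) * ‖a (i + 1)‖ * ‖b (n - i)‖) ^ 2 / W (n - i)
    have hS : 0 ≤ S := Finset.sum_nonneg fun i _ => div_nonneg (sq_nonneg _) (hW _).le
    have h4 : ((n : ℝ) + 1) ^ 2 * ‖b (n + 1)‖ ^ 2 ≤
        ((n : ℝ) + 1) ^ 2 * (W (n + 1) * γ (n + 1)) := by
      calc ((n : ℝ) + 1) ^ 2 * ‖b (n + 1)‖ ^ 2 = (((n : ℝ) + 1) * ‖b (n + 1)‖) ^ 2 := by ring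
        _ ≤ (l * (n + 1) * W (n + 1)) * S := h2.trans (mul_le_mul_of_nonneg_right (hsum n) hS)
        _ = ((n + 1) * W (n + 1)) * (l * S) := by ring
        _ ≤ ((n + 1) * W (n + 1)) * (((n : ℝ) + 1) * γ (n + 1)) :=
            mul_le_mul_of_nonneg_left h3 (mul_nonneg hn.le (hW _).le)
        _ = _ := by ring
    exact le_of_mul_le_mul_left h4 (by positivity)

theorem hasDiskSeries_polynomial (p : Polynomial ℂ) :
    HasDiskSeries (fun z => p.eval z) p.coeff := by
  have h := exists_hasDiskSeries (f := fun z => p.eval z) one_lt_two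
    p.differentiable.differentiableOn
  convert h using 2 with n
  rw [iteratedDeriv_polynomial_eval_zero, inv_mul_cancel_left₀]
  exact_mod_cast Nat.factorial_ne_zero _

/-- The Dirichlet energy of a polynomial in terms of its coefficients. -/
theorem hasSum_energy (Q : Polynomial ℂ) :
    HasSum (fun n : ℕ => π * ((n + 1) * ‖Q.coeff (n + 1)‖ ^ 2))
      (∫ z, ‖Q.derivative.eval z‖ ^ 2 ∂diskMeasure) := by
  refine (hasDiskSeries_polynomial Q.derivative).hasSum_disk.congr_fun fun n => ?_
  have h : ‖(n : ℂ) + 1‖ = n + 1 := by exact_mod_cast Complex.norm_natCast (n + 1)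
  have : (n : ℝ) + 1 ≠ 0 := by positivity
  rw [Polynomial.coeff_derivative, norm_mul, h]
  field_simp

/-- A weighted Lebedev–Milin inequality. -/
theorem exists_exp_series_weight (Q : Polynomial ℂ) (hQ : Q.coeff 0 = 0) {W : ℕ → ℝ} {l : ℝ}
    (hl : 0 < l) (hW : ∀ n, 0 < W n) (hW0 : W 0 = 1)
    (hsum : ∀ n : ℕ, ∑ i ∈ Finset.range (n + 1), W (n - i) ≤ l * (n + 1) * W (n + 1)) :
    ∃ b : ℕ → ℂ, HasDiskSeries (fun z => Complex.exp (Q.eval z)) b ∧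
      ∀ s, HasSum (fun n => ‖b n‖ ^ 2 / W n) s →
        s ≤ Real.exp (l / π * ∫ z, ‖Q.derivative.eval z‖ ^ 2 ∂diskMeasure) := by
  obtain ⟨b, hb, hb0, hbrec⟩ := exists_exp_series Q
  refine ⟨b, hb, fun s hs => ?_⟩
  -- The majorant γ consists of the coefficients of e^S, where S has coefficients l k |Q_k|². These
  -- sum to e^{S(1)}, and S(1) = l Σ k|Q_k|² is l/π times the Dirichlet energy of Q.
  set S : Polynomial ℂ := ∑ k ∈ Finset.range (Q.natDegree + 1),
    Polynomial.monomial k ((l * k * ‖Q.coeff k‖ ^ 2 : ℝ) : ℂ) with hS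
  have hcoef : ∀ k, S.coeff k = ((l * k * ‖Q.coeff k‖ ^ 2 : ℝ) : ℂ) := by
    intro k
    simp only [hS, Polynomial.finsetSum_coeff, Polynomial.coeff_monomial, Finset.sum_ite_eq',
      Finset.mem_range]
    split_ifs with h
    · rfl
    · rw [Polynomial.coeff_eq_zero_of_natDegree_lt (by omega)]; simp
  obtain ⟨g, hg, hg0, hgrec⟩ := exists_exp_series S
  have heval : S.eval 1 =
      ((l / π * ∫ z, ‖Q.derivative.eval z‖ ^ 2 ∂diskMeasure : ℝ) : ℂ) := by
    have h1 := (hasDiskSeries_polynomial S).2 1 (by simp)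
    simp only [one_pow, mul_one, hcoef] at h1
    have h2 := (hasSum_energy Q).mul_left (l / π)
    have h3 : HasSum (fun n : ℕ => l * n * ‖Q.coeff n‖ ^ 2)
        (l / π * ∫ z, ‖Q.derivative.eval z‖ ^ 2 ∂diskMeasure) := by
      rw [← hasSum_nat_add_iff' 1]
      simp only [Finset.range_one, Finset.sum_singleton, Nat.cast_zero, mul_zero, zero_mul,
        sub_zero]
      refine h2.congr_fun fun n => ?_
      have := pi_pos.ne'
      push_cast
      field_simp
    exact h1.unique (Complex.hasSum_ofReal.2 h3)
  have hγ : HasSum (fun n => (g n).re)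
      (Real.exp (l / π * ∫ z, ‖Q.derivative.eval z‖ ^ 2 ∂diskMeasure)) := by
    have h1 := hg.2 1 (by simp)
    simp only [one_pow, mul_one, heval] at h1
    rw [← Complex.ofReal_exp] at h1
    have h2 := Complex.hasSum_re h1
    rwa [Complex.ofReal_re] at h2
  refine hasSum_le (fun n => ?_) hs hγ
  rw [div_le_iff₀ (hW n), mul_comm]
  refine sq_norm_coeff_le (a := Q.coeff) (γ := fun n => (g n).re) hl hW hsum ?_ hbrec ?_ n
  · simp [hb0, hg0, hQ, hW0, hcoef]
  · intro n
    have h1 := congrArg Complex.re (hgrec n)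
    rw [Complex.re_sum] at h1
    simp only [hcoef] at h1
    have h2 : (((n : ℂ) + 1) * g (n + 1)).re = ((n : ℝ) + 1) * (g (n + 1)).re := by
      rw [show ((n : ℂ) + 1) = ((n + 1 : ℝ) : ℂ) by push_cast; rfl, Complex.re_ofReal_mul]
    rw [h2] at h1
    rw [h1]
    refine Finset.sum_congr rfl fun i _ => ?_
    rw [show ((i : ℂ) + 1) * ((l * (i + 1 : ℕ) * ‖Q.coeff (i + 1)‖ ^ 2 : ℝ) : ℂ) =
      ((((i : ℝ) + 1) * (l * (i + 1) * ‖Q.coeff (i + 1)‖ ^ 2) : ℝ) : ℂ) by push_cast; rfl,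
      Complex.re_ofReal_mul]

/-! ### The exponential inequalities for harmonic polynomials. -/

/-- Factor `exp (Re P)` as the squared modulus of an exponential vanishing nowhere. -/
theorem exp_re_eq (P : Polynomial ℂ) (z : ℂ) :
    Real.exp ((P.eval z).re) = Real.exp ((P.eval 0).re) *
      ‖Complex.exp ((Polynomial.C (1 / 2) * (P - Polynomial.C (P.eval 0))).eval z)‖ ^ 2 := by
  rw [Complex.norm_exp, ← Real.exp_nat_mul, ← Real.exp_add]
  simp

theorem half_energy (P : Polynomial ℂ) :
    ∫ z, ‖(Polynomial.C (1 / 2) * (P - Polynomial.C (P.eval 0))).derivative.eval z‖ ^ 2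
      ∂diskMeasure = 1 / 4 * ∫ z, ‖P.derivative.eval z‖ ^ 2 ∂diskMeasure := by
  rw [← integral_const_mul]
  congr 1
  ext z
  simp [mul_pow]
  norm_num

/-- The Lebedev–Milin inequality for harmonic polynomials. -/
theorem lebedev_milin_polynomial (P : Polynomial ℂ) :
    ∫ θ in (0 : ℝ)..2 * π, Real.exp ((P.eval (circleMap 0 1 θ)).re) ≤
      2 * π * Real.exp ((P.eval 0).re +
        1 / (4 * π) * ∫ z, ‖P.derivative.eval z‖ ^ 2 ∂diskMeasure) := by
  -- On the circle the squared norm is 2π Σ|b_n|², so the weights are constant and l = 1.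
  obtain ⟨b, hb, h⟩ := exists_exp_series_weight
    (Polynomial.C (1 / 2) * (P - Polynomial.C (P.eval 0)))
    (by simp [Polynomial.coeff_zero_eq_eval_zero]) (W := fun _ => 1) one_pos (fun _ => one_pos) rfl
    (fun n => by simp)
  have h1 := hb.hasSum_circle (r := 1) (by simp)
  have h2 := h _ (by simpa using hb.summable_sq.hasSum)
  have h3 : ∫ θ in (0 : ℝ)..2 * π, ‖Complex.exp ((Polynomial.C (1 / 2) *
      (P - Polynomial.C (P.eval 0))).eval (circleMap 0 1 θ))‖ ^ 2 = 2 * π * ∑' n, ‖b n‖ ^ 2 := by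
    refine h1.unique ?_
    simpa using hb.summable_sq.hasSum.mul_left (2 * π)
  rw [half_energy] at h2
  rw [intervalIntegral.integral_congr (fun θ _ => exp_re_eq P (circleMap 0 1 θ)),
    intervalIntegral.integral_const_mul]
  rw [h3, Real.exp_add]
  have h4 : 1 / π * (1 / 4 * ∫ z, ‖P.derivative.eval z‖ ^ 2 ∂diskMeasure) =
      1 / (4 * π) * ∫ z, ‖P.derivative.eval z‖ ^ 2 ∂diskMeasure := by
    have := pi_pos.ne'
    field_simp
  rw [h4] at h2
  calc _ = 2 * π * (Real.exp ((P.eval 0).re) * ∑' n, ‖b n‖ ^ 2) := by ring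
    _ ≤ _ := by gcongr

/-- The area version: Carleman's inequality combined with Lebedev–Milin. -/
theorem carleman_polynomial (P : Polynomial ℂ) :
    ∫ z, Real.exp ((P.eval z).re) ∂diskMeasure ≤
      π * Real.exp ((P.eval 0).re +
        1 / (8 * π) * ∫ z, ‖P.derivative.eval z‖ ^ 2 ∂diskMeasure) := by
  -- In the disk the squared norm is π Σ|b_n|²/(n+1), hence W n = n + 1. Since 1 + ... + (n+1) =
  -- (n+1)(n+2)/2, the value l = 1/2 is admissible, which halves the exponent.
  obtain ⟨b, hb, h⟩ := exists_exp_series_weight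
    (Polynomial.C (1 / 2) * (P - Polynomial.C (P.eval 0)))
    (by simp [Polynomial.coeff_zero_eq_eval_zero]) (W := fun n => (n : ℝ) + 1) (l := 1 / 2)
    one_half_pos (fun _ => by positivity) (by simp)
    (fun n => by
      have h1 : ∑ i ∈ Finset.range (n + 1), (((n - i : ℕ) : ℝ) + 1) =
          ((n : ℝ) + 1) * (n + 2) / 2 := by
        have h2 := Finset.sum_range_reflect (fun i : ℕ => (i : ℝ) + 1) (n + 1)
        simp only [Nat.add_sub_cancel] at h2
        rw [h2]
        clear h2
        induction n with
        | zero => norm_num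
        | succ n ih =>
          rw [Finset.sum_range_succ, ih]
          push_cast
          ring
      rw [h1]
      push_cast
      linarith)
  have h1 := hb.hasSum_disk
  have hpi := pi_pos.ne'
  have h2 := h _ ((h1.mul_left (1 / π)).congr_fun (fun n => by field_simp))
  rw [half_energy] at h2
  rw [integral_congr_ae (Eventually.of_forall (exp_re_eq P)), integral_const_mul]
  rw [Real.exp_add]
  have h4 : 1 / 2 / π * (1 / 4 * ∫ z, ‖P.derivative.eval z‖ ^ 2 ∂diskMeasure) =
      1 / (8 * π) * ∫ z, ‖P.derivative.eval z‖ ^ 2 ∂diskMeasure := by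
    field_simp
    ring
  rw [h4, one_div, inv_mul_le_iff₀ pi_pos] at h2
  calc _ ≤ Real.exp ((P.eval 0).re) * (π * Real.exp (1 / (8 * π) *
        ∫ z, ‖P.derivative.eval z‖ ^ 2 ∂diskMeasure)) := by gcongr
    _ = _ := by ring

/-! ### Polynomials in z and conj z: density and differential calculus. -/

/-- The function of `z` given by a polynomial in `z` and `conj z`. -/
noncomputable def zeval (p : MvPolynomial (Fin 2) ℂ) (z : ℂ) : ℂ :=
  MvPolynomial.eval ![z, conj z] p

theorem zeval_monomial (u : Fin 2 →₀ ℕ) (c z : ℂ) :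
    zeval (MvPolynomial.monomial u c) z = c * z ^ u 0 * conj z ^ u 1 := by
  simp [zeval, MvPolynomial.eval_monomial, Finsupp.prod_fintype, mul_assoc]

/-- Polynomials in `z` and `conj z` are uniformly dense on the closed disk. -/
theorem exists_zeval_approx {f : ℂ → ℝ} (hf : ContinuousOn f (Metric.closedBall 0 1)) {ε : ℝ}
    (hε : 0 < ε) : ∃ p, ∀ z ∈ Metric.closedBall (0 : ℂ) 1, |f z - (zeval p z).re| < ε := by
  let B := Metric.closedBall (0 : ℂ) 1
  have : CompactSpace B := isCompact_iff_compactSpace.1 (isCompact_closedBall 0 1)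
  let x : C(B, ℝ) := ⟨fun z => (z : ℂ).re, by fun_prop⟩
  let y : C(B, ℝ) := ⟨fun z => (z : ℂ).im, by fun_prop⟩
  let A : Subalgebra ℝ C(B, ℝ) := Algebra.adjoin ℝ {x, y}
  have hsep : A.SeparatesPoints := by
    intro z w hzw
    by_cases h : (z : ℂ).re = (w : ℂ).re
    · have h' : (z : ℂ).im ≠ (w : ℂ).im := fun h' => hzw (Subtype.ext (Complex.ext h h'))
      exact ⟨y, ⟨y, Algebra.subset_adjoin (by simp), rfl⟩, h'⟩
    · exact ⟨x, ⟨x, Algebra.subset_adjoin (by simp), rfl⟩, h⟩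
  have hA : ∀ g ∈ A, ∃ p, ∀ z : B, ((g z : ℝ) : ℂ) = zeval p z := by
    intro g hg
    induction hg using Algebra.adjoin_induction with
    | mem g hg =>
      rcases hg with rfl | rfl
      · refine ⟨MvPolynomial.C (1 / 2) * (MvPolynomial.X 0 + MvPolynomial.X 1), fun z => ?_⟩
        apply Complex.ext <;> simp [zeval, x]
        ring
      · refine ⟨MvPolynomial.C (-Complex.I / 2) * (MvPolynomial.X 0 - MvPolynomial.X 1),
          fun z => ?_⟩
        apply Complex.ext <;> simp [zeval, y]
        ring
    | algebraMap r =>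
      exact ⟨MvPolynomial.C (r : ℂ), fun z => by simp [zeval, Algebra.algebraMap_eq_smul_one]⟩
    | add g g' _ _ h h' =>
      obtain ⟨p, hp⟩ := h
      obtain ⟨p', hp'⟩ := h'
      exact ⟨p + p', fun z => by simp only [zeval, map_add] at *; simp [hp, hp']⟩
    | mul g g' _ _ h h' =>
      obtain ⟨p, hp⟩ := h
      obtain ⟨p', hp'⟩ := h'
      exact ⟨p * p', fun z => by simp only [zeval, map_mul] at *; simp [hp, hp']⟩
  obtain ⟨⟨g, hg⟩, hgf⟩ := ContinuousMap.exists_mem_subalgebra_near_continuous_of_separatesPoints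
    A hsep (fun z : B => f z) (hf.domRestrict) ε hε
  obtain ⟨p, hp⟩ := hA g hg
  refine ⟨p, fun z hz => ?_⟩
  have h1 := hgf ⟨z, hz⟩
  rw [← hp ⟨z, hz⟩, Complex.ofReal_re, abs_sub_comm]
  exact h1

theorem continuous_zeval (p : MvPolynomial (Fin 2) ℂ) : Continuous (zeval p) := by
  have : Continuous fun z : ℂ => ![z, conj z] := by
    refine continuous_pi fun i => ?_
    fin_cases i
    · exact continuous_id
    · exact Complex.continuous_conj
  exact (MvPolynomial.continuous_eval p).comp this

theorem hasFDerivAt_monomial (c : ℂ) (m n : ℕ) (z : ℂ) :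
    HasFDerivAt (fun z : ℂ => c * z ^ m * conj z ^ n)
      ((c * (m * z ^ (m - 1)) * conj z ^ n) • (ContinuousLinearMap.id ℝ ℂ) +
        (c * z ^ m * (n * conj z ^ (n - 1))) • (Complex.conjCLE : ℂ →L[ℝ] ℂ)) z := by
  have h1 : HasFDerivAt (fun z : ℂ => c * z ^ m)
      ((c * (m * z ^ (m - 1))) • (ContinuousLinearMap.id ℝ ℂ)) z := by
    have := ((hasDerivAt_pow m z).const_mul c).complexToReal_fderiv
    refine this.congr_fderiv ?_
    ext; simp
  have h2 : HasFDerivAt (fun z : ℂ => conj z ^ n)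
      ((n * conj z ^ (n - 1)) • (Complex.conjCLE : ℂ →L[ℝ] ℂ)) z := by
    have h3 : HasFDerivAt (fun z : ℂ => conj z) (Complex.conjCLE : ℂ →L[ℝ] ℂ) z :=
      Complex.conjCLE.hasFDerivAt
    have := (hasDerivAt_pow n (conj z)).comp_hasFDerivAt_of_eq z h3 rfl
    exact this
  refine (h1.mul h2).congr_fderiv ?_
  ext; simp; ring

theorem wirtinger_monomial (c : ℂ) (m n : ℕ) (z : ℂ) :
    wirtinger (fun z : ℂ => c * z ^ m * conj z ^ n) z = 2 * c * m * z ^ (m - 1) * conj z ^ n := by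
  rw [wirtinger, (hasFDerivAt_monomial c m n z).fderiv]
  simp
  linear_combination (-(c * (m * z ^ (m - 1)) * conj z ^ n) +
    c * z ^ m * (n * conj z ^ (n - 1))) * Complex.I_sq

theorem grad_re_monomial (c : ℂ) (m n : ℕ) (z : ℂ) :
    grad (fun z : ℂ => (c * z ^ m * conj z ^ n).re) z =
      n * c * z ^ m * conj z ^ (n - 1) + m * conj c * z ^ n * conj z ^ (m - 1) := by
  have h : HasFDerivAt (fun z : ℂ => (c * z ^ m * conj z ^ n).re) _ z :=
    (Complex.reCLM.hasFDerivAt).comp z (hasFDerivAt_monomial c m n z)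
  rw [grad, h.fderiv]
  have h1 : ∀ α β : ℂ, (((α * 1 + β * 1).re : ℝ) : ℂ) +
      ((α * Complex.I + β * -Complex.I).re : ℝ) * Complex.I = conj α + β := by
    intro α β
    apply Complex.ext <;> simp
  have h2 := h1 (c * (m * z ^ (m - 1)) * conj z ^ n) (c * z ^ m * (n * conj z ^ (n - 1)))
  simp only [ContinuousLinearMap.comp_apply, add_apply,
    smul_apply, ContinuousLinearMap.id_apply, smul_eq_mul,
    Complex.reCLM_apply]
  refine Eq.trans ?_ (h2.trans ?_)
  · simp
  · simp
    ring

theorem contDiff_monomial (c : ℂ) (m n : ℕ) :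
    ContDiff ℝ ∞ (fun z : ℂ => c * z ^ m * conj z ^ n) :=
  (contDiff_const.mul (contDiff_id.pow m)).mul ((Complex.conjCLE.contDiff).pow n)

theorem contDiff_re_monomial (c : ℂ) (m n : ℕ) :
    ContDiff ℝ ∞ (fun z : ℂ => (c * z ^ m * conj z ^ n).re) :=
  Complex.reCLM.contDiff.comp (contDiff_monomial c m n)

theorem contDiff_grad {ψ : ℂ → ℝ} (h : ContDiff ℝ ∞ ψ) : ContDiff ℝ ∞ (grad ψ) := by
  have h1 : ∀ v : ℂ, ContDiff ℝ ∞ (fun z => ((fderiv ℝ ψ z v : ℝ) : ℂ)) := fun v =>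
    Complex.ofRealCLM.contDiff.comp ((h.fderiv_right (by simp)).clm_apply contDiff_const)
  exact (h1 1).add ((h1 Complex.I).mul contDiff_const)

theorem grad_add {f g : ℂ → ℝ} {z : ℂ} (hf : DifferentiableAt ℝ f z)
    (hg : DifferentiableAt ℝ g z) : grad (fun z => f z + g z) z = grad f z + grad g z := by
  simp only [grad]
  rw [fderiv_fun_add hf hg]
  simp
  ring

theorem grad_const_mul {f : ℂ → ℝ} {z : ℂ} (hf : DifferentiableAt ℝ f z) (c : ℝ) :
    grad (fun z => c * f z) z = c * grad f z := by
  simp only [grad]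
  rw [fderiv_const_mul hf]
  simp
  ring

theorem grad_sub {f g : ℂ → ℝ} {z : ℂ} (hf : DifferentiableAt ℝ f z)
    (hg : DifferentiableAt ℝ g z) : grad (fun z => f z - g z) z = grad f z - grad g z := by
  simp only [grad]
  rw [fderiv_fun_sub hf hg]
  simp
  ring

theorem wirtinger_add {f g : ℂ → ℂ} {z : ℂ} (hf : DifferentiableAt ℝ f z)
    (hg : DifferentiableAt ℝ g z) :
    wirtinger (fun z => f z + g z) z = wirtinger f z + wirtinger g z := by
  simp only [wirtinger]
  rw [fderiv_fun_add hf hg]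
  simp
  ring

theorem wirtinger_sub {f g : ℂ → ℂ} {z : ℂ} (hf : DifferentiableAt ℝ f z)
    (hg : DifferentiableAt ℝ g z) :
    wirtinger (fun z => f z - g z) z = wirtinger f z - wirtinger g z := by
  simp only [wirtinger]
  rw [fderiv_fun_sub hf hg]
  simp
  ring

theorem wirtinger_const_mul {f : ℂ → ℂ} {z : ℂ} (hf : DifferentiableAt ℝ f z) (c : ℂ) :
    wirtinger (fun z => c * f z) z = c * wirtinger f z := by
  simp only [wirtinger]
  rw [fderiv_const_mul hf]
  simp
  ring

theorem differentiable_of_contDiff_infty {E F : Type*} [NormedAddCommGroup E] [NormedSpace ℝ E]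
    [NormedAddCommGroup F] [NormedSpace ℝ F] {f : E → F} (h : ContDiff ℝ ∞ f) :
    Differentiable ℝ f := h.differentiable (by simp)

/-- On real functions `grad` is twice the derivative in conj z, and `wirtinger` is twice the
derivative in z, so their composite is the Laplacian. -/
theorem laplacian_re_monomial (c : ℂ) (m n : ℕ) (z : ℂ) :
    wirtinger (grad (fun z : ℂ => (c * z ^ m * conj z ^ n).re)) z =
      ((4 * (m * n * (c * z ^ (m - 1) * conj z ^ (n - 1)).re) : ℝ) : ℂ) := by
  rw [show grad (fun z : ℂ => (c * z ^ m * conj z ^ n).re) = fun z =>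
    (n * c) * z ^ m * conj z ^ (n - 1) + (m * conj c) * z ^ n * conj z ^ (m - 1) from
    funext (grad_re_monomial c m n)]
  rw [wirtinger_add (hasFDerivAt_monomial _ _ _ z).differentiableAt
    (hasFDerivAt_monomial _ _ _ z).differentiableAt, wirtinger_monomial, wirtinger_monomial]
  have h := Complex.add_conj (c * z ^ (m - 1) * conj z ^ (n - 1))
  simp only [map_mul, map_pow, Complex.conj_conj] at h
  push_cast at h ⊢
  linear_combination 2 * m * n * h

/-! ### Fourier modes on the circle, the Dirichlet problem and harmonic truncation. -/

/-- `w` is orthogonal, on the unit circle, to trigonometric polynomials of degree at most `N`. -/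
def CircleOrthogonal (w : ℂ → ℝ) (N : ℕ) : Prop :=
  ∀ k ≤ N, ∫ θ in (0 : ℝ)..2 * π, (w (circleMap 0 1 θ) : ℂ) * circleMap 0 1 θ ^ k = 0

theorem CircleOrthogonal.mono {w : ℂ → ℝ} {N M : ℕ} (h : CircleOrthogonal w N) (hM : M ≤ N) :
    CircleOrthogonal w M := fun k hk => h k (hk.trans hM)

theorem conj_mul_circleMap_one (θ : ℝ) : circleMap 0 1 θ * conj (circleMap 0 1 θ) = 1 := by
  rw [Complex.mul_conj, Complex.normSq_eq_norm_sq]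
  simp

theorem pow_mul_conj_pow_of_le {z : ℂ} (hz : z * conj z = 1) {a b : ℕ} (h : b ≤ a) :
    z ^ a * conj z ^ b = z ^ (a - b) := by
  obtain ⟨k, rfl⟩ := Nat.exists_eq_add_of_le h
  rw [Nat.add_sub_cancel_left, pow_add, mul_right_comm, ← mul_pow, hz, one_pow, one_mul]

/-- Truncated subtraction makes at least one of the new exponents zero: on the circle a monomial
reduces to a pure power of z or of conj z, which extends harmonically. -/
theorem pow_mul_conj_pow {z : ℂ} (hz : z * conj z = 1) (a b : ℕ) :
    z ^ a * conj z ^ b = z ^ (a - b) * conj z ^ (b - a) := by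
  rcases le_total b a with h | h
  · rw [pow_mul_conj_pow_of_le hz h, Nat.sub_eq_zero_of_le h, pow_zero, mul_one]
  · have hz' : conj z * conj (conj z) = 1 := by rw [Complex.conj_conj, mul_comm, hz]
    have := pow_mul_conj_pow_of_le hz' h
    rw [Complex.conj_conj] at this
    rw [mul_comm, this, Nat.sub_eq_zero_of_le h, pow_zero, one_mul]

theorem CircleOrthogonal.integral_monomial {w : ℂ → ℝ} {N : ℕ} (h : CircleOrthogonal w N)
    {a b : ℕ} (ha : a ≤ N) (hb : b ≤ N) (c : ℂ) :
    ∫ θ in (0 : ℝ)..2 * π, (w (circleMap 0 1 θ) : ℂ) *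
      (c * circleMap 0 1 θ ^ a * conj (circleMap 0 1 θ) ^ b) = 0 := by
  have h1 : ∀ θ : ℝ, (w (circleMap 0 1 θ) : ℂ) *
      (c * circleMap 0 1 θ ^ a * conj (circleMap 0 1 θ) ^ b) =
        c * ((w (circleMap 0 1 θ) : ℂ) *
          (circleMap 0 1 θ ^ (a - b) * conj (circleMap 0 1 θ) ^ (b - a))) := by
    intro θ
    rw [← pow_mul_conj_pow (conj_mul_circleMap_one θ)]
    ring
  simp only [h1, intervalIntegral.integral_const_mul]
  rcases le_total b a with hab | hab
  · simp only [Nat.sub_eq_zero_of_le hab, pow_zero, mul_one]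
    rw [h _ (by omega), mul_zero]
  · simp only [Nat.sub_eq_zero_of_le hab, pow_zero, one_mul]
    have h2 := congrArg conj (h (b - a) (by omega))
    rw [← intervalIntegral_star] at h2
    simp only [map_mul, map_pow, Complex.conj_ofReal, map_zero] at h2
    rw [h2, mul_zero]

/-- The Dirichlet problem `-Δψ = Re p` for a polynomial `p` in `z`, `conj z`. -/
theorem exists_poisson_solution (p : MvPolynomial (Fin 2) ℂ) :
    ∃ (ψ : ℂ → ℝ) (N : ℕ), ContDiff ℝ ∞ ψ ∧ (∀ θ : ℝ, ψ (circleMap 0 1 θ) = 0) ∧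
      (∀ z, wirtinger (grad ψ) z = -((zeval p z).re : ℂ)) ∧
      ∀ w : ℂ → ℝ, Continuous w → CircleOrthogonal w N →
        ∫ θ in (0 : ℝ)..2 * π, w (circleMap 0 1 θ) * (zeval p (circleMap 0 1 θ)).re = 0 ∧
        ∫ θ in (0 : ℝ)..2 * π, (w (circleMap 0 1 θ) : ℂ) *
          (conj (circleMap 0 1 θ) * grad ψ (circleMap 0 1 θ)) = 0 := by
  induction p using MvPolynomial.induction_on' with
  | monomial u c =>
    set m := u 0
    set n := u 1
    set κ : ℝ := 1 / (4 * (m + 1) * (n + 1)) with hκ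
    set T : ℕ → ℕ → ℂ → ℝ := fun a b z => (c * z ^ a * conj z ^ b).re with hT
    have hTd : ∀ a b, Differentiable ℝ (T a b) := fun a b =>
      differentiable_of_contDiff_infty (contDiff_re_monomial c a b)
    have hgd : ∀ a b, Differentiable ℝ (grad (T a b)) := fun a b =>
      differentiable_of_contDiff_infty (contDiff_grad (contDiff_re_monomial c a b))
    have hgrad : grad (fun z => κ * (T (m - n) (n - m) z - T (m + 1) (n + 1) z)) = fun z =>
        (κ : ℂ) * (grad (T (m - n) (n - m)) z - grad (T (m + 1) (n + 1)) z) := by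
      ext z
      rw [grad_const_mul ((hTd _ _ z).fun_sub (hTd _ _ z)), grad_sub (hTd _ _ z) (hTd _ _ z)]
    -- The second term has Laplacian 4(m+1)(n+1) times the given monomial, whence κ; the first is
    -- the harmonic function with the same boundary values. The degree m + n + 1 dominates every
    -- exponent met on the circle in the density and in conj z · grad ψ.
    refine ⟨fun z => κ * (T (m - n) (n - m) z - T (m + 1) (n + 1) z), m + n + 1, ?_, ?_, ?_, ?_⟩
    · exact contDiff_const.mul ((contDiff_re_monomial _ _ _).sub (contDiff_re_monomial _ _ _))
    · intro θ
      simp only [hT, mul_assoc]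
      rw [pow_mul_conj_pow (conj_mul_circleMap_one θ) (m + 1) (n + 1)]
      simp
    · intro z
      rw [hgrad, wirtinger_const_mul ((hgd _ _ z).fun_sub (hgd _ _ z)),
        wirtinger_sub (hgd _ _ z) (hgd _ _ z), laplacian_re_monomial, laplacian_re_monomial,
        zeval_monomial]
      have h0 : ((m - n : ℕ) : ℝ) * ((n - m : ℕ) : ℝ) = 0 := by
        rcases le_total m n with h | h <;> simp [Nat.sub_eq_zero_of_le h]
      rw [h0]
      simp only [Nat.add_sub_cancel, hκ]
      have h1 : (m : ℂ) + 1 ≠ 0 := by exact_mod_cast Nat.succ_ne_zero m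
      have h2 : (n : ℂ) + 1 ≠ 0 := by exact_mod_cast Nat.succ_ne_zero n
      push_cast
      field_simp
      ring
    · intro w hw hwN
      have hc : Continuous fun θ : ℝ => (w (circleMap 0 1 θ) : ℂ) := by
        have := continuous_circleMap 0 1
        fun_prop
      constructor
      · have h1 := congrArg Complex.re
          (hwN.integral_monomial (a := m) (b := n) (by omega) (by omega) c)
        rw [← Complex.reCLM_apply, ← ContinuousLinearMap.intervalIntegral_comp_comm _ (by
          have := continuous_circleMap 0 1
          exact Continuous.intervalIntegrable (by fun_prop) _ _)] at h1
        simpa only [zeval_monomial, Complex.reCLM_apply, Complex.re_ofReal_mul, Complex.zero_re] using h1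
      · rw [hgrad]
        simp only [hT, grad_re_monomial]
        have hexp : ∀ θ : ℝ, (w (circleMap 0 1 θ) : ℂ) * (conj (circleMap 0 1 θ) *
            ((κ : ℂ) * (((n - m : ℕ) : ℂ) * c * circleMap 0 1 θ ^ (m - n) *
              conj (circleMap 0 1 θ) ^ (n - m - 1) +
              ((m - n : ℕ) : ℂ) * conj c * circleMap 0 1 θ ^ (n - m) *
                conj (circleMap 0 1 θ) ^ (m - n - 1) -
              (((n + 1 : ℕ) : ℂ) * c * circleMap 0 1 θ ^ (m + 1) *
                conj (circleMap 0 1 θ) ^ (n + 1 - 1) +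
              ((m + 1 : ℕ) : ℂ) * conj c * circleMap 0 1 θ ^ (n + 1) *
                conj (circleMap 0 1 θ) ^ (m + 1 - 1))))) =
            (w (circleMap 0 1 θ) : ℂ) * (κ * ((n - m : ℕ) : ℂ) * c * circleMap 0 1 θ ^ (m - n) *
              conj (circleMap 0 1 θ) ^ (n - m - 1 + 1)) +
            (w (circleMap 0 1 θ) : ℂ) * (κ * ((m - n : ℕ) : ℂ) * conj c *
              circleMap 0 1 θ ^ (n - m) * conj (circleMap 0 1 θ) ^ (m - n - 1 + 1)) -
            (w (circleMap 0 1 θ) : ℂ) * (κ * ((n + 1 : ℕ) : ℂ) * c * circleMap 0 1 θ ^ (m + 1) *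
              conj (circleMap 0 1 θ) ^ (n + 1)) -
            (w (circleMap 0 1 θ) : ℂ) * (κ * ((m + 1 : ℕ) : ℂ) * conj c *
              circleMap 0 1 θ ^ (n + 1) * conj (circleMap 0 1 θ) ^ (m + 1)) := by
          intro θ
          simp only [Nat.add_sub_cancel]
          ring
        simp only [hexp]
        have hi : ∀ (d : ℂ) (a b : ℕ), IntervalIntegrable (fun θ : ℝ => (w (circleMap 0 1 θ) : ℂ) *
            (d * circleMap 0 1 θ ^ a * conj (circleMap 0 1 θ) ^ b)) volume 0 (2 * π) := by
          intro d a b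
          have := continuous_circleMap 0 1
          exact Continuous.intervalIntegrable (by fun_prop) _ _
        rw [intervalIntegral.integral_sub (((hi _ _ _).add (hi _ _ _)).sub (hi _ _ _)) (hi _ _ _),
          intervalIntegral.integral_sub ((hi _ _ _).add (hi _ _ _)) (hi _ _ _),
          intervalIntegral.integral_add (hi _ _ _) (hi _ _ _)]
        rw [hwN.integral_monomial (by omega) (by omega), hwN.integral_monomial (by omega) (by omega),
          hwN.integral_monomial (by omega) (by omega), hwN.integral_monomial (by omega) (by omega)]
        simp
  | add p q hp hq =>
    obtain ⟨ψ, N, hψ, hψ0, hψp, hψN⟩ := hp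
    obtain ⟨χ, M, hχ, hχ0, hχq, hχM⟩ := hq
    have hgrad : grad (fun z => ψ z + χ z) = fun z => grad ψ z + grad χ z := by
      ext z
      exact grad_add (differentiable_of_contDiff_infty hψ z) (differentiable_of_contDiff_infty hχ z)
    refine ⟨fun z => ψ z + χ z, max N M, hψ.add hχ, fun θ => by simp only [hψ0, hχ0, add_zero], ?_, ?_⟩
    · intro z
      rw [hgrad, wirtinger_add (differentiable_of_contDiff_infty (contDiff_grad hψ) z)
        (differentiable_of_contDiff_infty (contDiff_grad hχ) z), hψp, hχq]
      simp [zeval]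
      ring
    · intro w hw hwN
      obtain ⟨h1, h2⟩ := hψN w hw (hwN.mono (le_max_left _ _))
      obtain ⟨h3, h4⟩ := hχM w hw (hwN.mono (le_max_right _ _))
      have hc := continuous_circleMap 0 1
      have hcp := continuous_zeval p
      have hcq := continuous_zeval q
      have hcψ := (contDiff_grad hψ).continuous
      have hcχ := (contDiff_grad hχ).continuous
      constructor
      · have := congrArg₂ (· + ·) h1 h3
        simp only [add_zero] at this
        rw [← intervalIntegral.integral_add (Continuous.intervalIntegrable (by fun_prop) _ _)
          (Continuous.intervalIntegrable (by fun_prop) _ _)] at this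
        refine Eq.trans (intervalIntegral.integral_congr fun θ _ => ?_) this
        simp [zeval]
        ring
      · rw [hgrad]
        have := congrArg₂ (· + ·) h2 h4
        simp only [add_zero] at this
        rw [← intervalIntegral.integral_add (Continuous.intervalIntegrable (by fun_prop) _ _)
          (Continuous.intervalIntegrable (by fun_prop) _ _)] at this
        refine Eq.trans (intervalIntegral.integral_congr fun θ _ => ?_) this
        simp only
        ring

/-- Fourier truncation: a harmonic polynomial with the same low Fourier modes on the circle. -/
theorem exists_harmonic_truncation {v : ℂ → ℝ} (hv : Continuous v) (N : ℕ) :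
    ∃ P : Polynomial ℂ, P.natDegree ≤ N ∧
      (P.eval 0).re = 1 / (2 * π) * ∫ θ in (0 : ℝ)..2 * π, v (circleMap 0 1 θ) ∧
      CircleOrthogonal (fun z => v z - (P.eval z).re) N := by
  have hc := continuous_circleMap 0 1
  set a : ℕ → ℂ := fun k => ∫ θ in (0 : ℝ)..2 * π,
    (v (circleMap 0 1 θ) : ℂ) * conj (circleMap 0 1 θ) ^ k with ha
  -- Taking the real part halves each nonconstant coefficient, hence the division by π instead of 2π
  -- for k > 0.
  set c : ℕ → ℂ := fun k => if k = 0 then a 0 / (2 * π) else a k / π with hcdef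
  set P : Polynomial ℂ := ∑ k ∈ Finset.range (N + 1), Polynomial.monomial k (c k) with hP
  have hpi : (π : ℂ) ≠ 0 := by exact_mod_cast pi_pos.ne'
  have hcoef : ∀ k ≤ N, P.coeff k = c k := by
    intro k hk
    simp only [hP, Polynomial.finsetSum_coeff, Polynomial.coeff_monomial, Finset.sum_ite_eq',
      Finset.mem_range]
    rw [if_pos (by omega)]
  have ha0 : a 0 = ((∫ θ in (0 : ℝ)..2 * π, v (circleMap 0 1 θ) : ℝ) : ℂ) := by
    simp only [ha, pow_zero, mul_one, intervalIntegral.integral_ofReal]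
  refine ⟨P, ?_, ?_, ?_⟩
  · refine Polynomial.natDegree_sum_le_of_forall_le _ _ fun k hk => ?_
    exact (Polynomial.natDegree_monomial_le _).trans (by simpa using Finset.mem_range_succ_iff.1 hk)
  · rw [← Polynomial.coeff_zero_eq_eval_zero, hcoef 0 (Nat.zero_le _)]
    simp only [hcdef, if_true, ha0]
    rw [← Complex.ofReal_ofNat, ← Complex.ofReal_mul, ← Complex.ofReal_div, Complex.ofReal_re]
    ring
  · intro k hk
    have hPc : Continuous fun z => P.eval z := P.continuous
    have h1 := (hasDiskSeries_polynomial P).integral_circle_mul_conj_pow (r := 1) (by simp) k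
    have h2 := congrArg conj h1
    rw [← intervalIntegral_star] at h2
    simp only [map_mul, map_pow, Complex.conj_conj, Complex.conj_ofReal, Complex.ofReal_one, one_pow,
      mul_one, map_ofNat] at h2
    have h3 := (hasDiskSeries_polynomial (P * Polynomial.X ^ k)).integral_circle_mul_conj_pow
      (r := 1) (by simp) 0
    simp only [pow_zero, mul_one, Polynomial.eval_mul, Polynomial.eval_pow, Polynomial.eval_X,
      Polynomial.mul_coeff_zero, Polynomial.coeff_X_pow] at h3
    have h4 : conj (a k) = ∫ θ in (0 : ℝ)..2 * π,
        (v (circleMap 0 1 θ) : ℂ) * circleMap 0 1 θ ^ k := by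
      simp only [ha]
      rw [← intervalIntegral_star]
      simp only [map_mul, map_pow, Complex.conj_conj, Complex.conj_ofReal]
    have h5 : ∀ θ : ℝ, ((v (circleMap 0 1 θ) - (P.eval (circleMap 0 1 θ)).re : ℝ) : ℂ) *
        circleMap 0 1 θ ^ k = (v (circleMap 0 1 θ) : ℂ) * circleMap 0 1 θ ^ k -
          1 / 2 * (P.eval (circleMap 0 1 θ) * circleMap 0 1 θ ^ k +
            conj (P.eval (circleMap 0 1 θ)) * circleMap 0 1 θ ^ k) := by
      intro θ
      rw [Complex.ofReal_sub, Complex.re_eq_add_conj]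
      ring
    simp only [h5]
    rw [intervalIntegral.integral_sub (Continuous.intervalIntegrable (by fun_prop) _ _)
      (Continuous.intervalIntegrable (by fun_prop) _ _), intervalIntegral.integral_const_mul,
      intervalIntegral.integral_add (Continuous.intervalIntegrable (by fun_prop) _ _)
      (Continuous.intervalIntegrable (by fun_prop) _ _), h2, h3, ← h4, hcoef k hk,
      hcoef 0 (Nat.zero_le _)]
    simp only [hcdef]
    rcases Nat.eq_zero_or_pos k with rfl | hk0
    · simp only [if_true, ha0, map_div₀, map_mul, Complex.conj_ofReal, map_ofNat]
      simp
      field_simp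
      ring
    · rw [if_neg hk0.ne', if_neg (by omega : ¬ 0 = k)]
      simp only [map_div₀, Complex.conj_ofReal]
      field_simp
      simp

/-! ### Green's representation at the centre and Gibbs' inequality. -/

theorem fderiv_eq_re_grad (v : ℂ → ℝ) (z h : ℂ) : fderiv ℝ v z h = (conj h * grad v z).re := by
  conv_lhs => rw [show h = h.re • (1 : ℂ) + h.im • Complex.I by
    apply Complex.ext <;> simp]
  rw [map_add, map_smul, map_smul]
  simp [grad]

/-- Let A(r) and D(r) be the angular integrals of the Laplacian and of the radial derivative.
Green's theorem gives r D(r) = ∫₀^r sA(s) ds, so -(r log r)D(r) has derivative -D - (r log r)A. It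
vanishes at r = 0 and r = 1, so no disk around the pole has to be removed, and ∫D is the boundary
integral minus 2πv(0). D itself is never differentiated, only the integral of sA. -/
theorem integral_log_mul_laplacian {v : ℂ → ℝ} (hv : ContDiff ℝ ∞ v) :
    ∫ r in (0 : ℝ)..1, ∫ θ in (0 : ℝ)..2 * π,
        (r * Real.log r) * (wirtinger (grad v) (circleMap 0 r θ)).re =
      2 * π * v 0 - ∫ θ in (0 : ℝ)..2 * π, v (circleMap 0 1 θ) := by
  have hX : ContDiff ℝ ∞ (grad v) := contDiff_grad hv
  have hX1 : ContDiff ℝ 1 (grad v) := hX.of_le (by exact_mod_cast le_top)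
  have hWc : Continuous fun p : ℝ × ℝ => (wirtinger (grad v) (circleMap 0 p.1 p.2)).re :=
    Complex.continuous_re.comp ((continuous_wirtinger hX1).comp continuous_circleMap_uncurry)
  have hVc : Continuous fun p : ℝ × ℝ =>
      (Complex.exp (-(p.2 * Complex.I)) * grad v (circleMap 0 p.1 p.2)).re :=
    Complex.continuous_re.comp ((by fun_prop : Continuous fun p : ℝ × ℝ =>
      Complex.exp (-(p.2 * Complex.I))).mul (hX.continuous.comp continuous_circleMap_uncurry))
  set A : ℝ → ℝ := fun r => ∫ θ in (0 : ℝ)..2 * π, (wirtinger (grad v) (circleMap 0 r θ)).re with hA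
  set D : ℝ → ℝ := fun r => ∫ θ in (0 : ℝ)..2 * π,
    (Complex.exp (-(θ * Complex.I)) * grad v (circleMap 0 r θ)).re with hD
  have hAc : Continuous A := intervalIntegral.continuous_parametric_intervalIntegral_of_continuous'
    (f := fun r θ => (wirtinger (grad v) (circleMap 0 r θ)).re) hWc 0 (2 * π)
  have hDc : Continuous D := intervalIntegral.continuous_parametric_intervalIntegral_of_continuous'
    (f := fun (r θ : ℝ) => (Complex.exp (-(θ * Complex.I)) * grad v (circleMap 0 r θ)).re)
    hVc 0 (2 * π)
  have hgreen : ∀ R, ∫ r in (0 : ℝ)..R, r * A r = R * D R := by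
    intro R
    have h := congrArg Complex.reCLM (green_polar hX1 R)
    have hc1 : Continuous fun p : ℝ × ℝ => (p.1 : ℂ) * wirtinger (grad v) (circleMap 0 p.1 p.2) :=
      (by fun_prop : Continuous fun p : ℝ × ℝ => (p.1 : ℂ)).mul
        ((continuous_wirtinger hX1).comp continuous_circleMap_uncurry)
    have hc2 : Continuous fun r : ℝ => ∫ θ in (0 : ℝ)..2 * π,
        (r : ℂ) * wirtinger (grad v) (circleMap 0 r θ) :=
      intervalIntegral.continuous_parametric_intervalIntegral_of_continuous'
        (f := fun (r θ : ℝ) => (r : ℂ) * wirtinger (grad v) (circleMap 0 r θ)) hc1 0 (2 * π)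
    rw [← ContinuousLinearMap.intervalIntegral_comp_comm _ (hc2.intervalIntegrable _ _),
      ← ContinuousLinearMap.intervalIntegral_comp_comm _ (by
        have := continuous_circleMap 0 R
        have := hX.continuous
        exact Continuous.intervalIntegrable (by fun_prop) _ _)] at h
    have h2 : ∀ r : ℝ, Complex.reCLM (∫ θ in (0 : ℝ)..2 * π,
        (r : ℂ) * wirtinger (grad v) (circleMap 0 r θ)) = r * A r := by
      intro r
      have hc3 : Continuous fun θ : ℝ => (r : ℂ) * wirtinger (grad v) (circleMap 0 r θ) :=
        hc1.comp (continuous_const.prodMk continuous_id)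
      rw [← ContinuousLinearMap.intervalIntegral_comp_comm _ (hc3.intervalIntegrable _ _)]
      simp only [Complex.reCLM_apply, Complex.re_ofReal_mul, intervalIntegral.integral_const_mul, hA]
    simp only [h2] at h
    simp only [Complex.reCLM_apply, mul_assoc, Complex.re_ofReal_mul,
      intervalIntegral.integral_const_mul] at h
    exact h
  have hmean : ∫ r in (0 : ℝ)..1, D r =
      (∫ θ in (0 : ℝ)..2 * π, v (circleMap 0 1 θ)) - 2 * π * v 0 := by
    simp only [hD]
    rw [intervalIntegral_intervalIntegral_swap]
    · have h1 : ∀ θ : ℝ, ∫ r in (0 : ℝ)..1,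
          (Complex.exp (-(θ * Complex.I)) * grad v (circleMap 0 r θ)).re =
            v (circleMap 0 1 θ) - v 0 := by
        intro θ
        have hder : ∀ r ∈ uIcc (0 : ℝ) 1, HasDerivAt (fun r : ℝ => v (circleMap 0 r θ))
            (Complex.exp (-(θ * Complex.I)) * grad v (circleMap 0 r θ)).re r := by
          intro r _
          have h2 := ((differentiable_of_contDiff_infty hv (circleMap 0 r θ)).hasFDerivAt).comp_hasDerivAt
            r (hasDerivAt_circleMap_radius r θ)
          rw [fderiv_eq_re_grad, ← Complex.exp_conj] at h2
          rw [map_mul, Complex.conj_I, Complex.conj_ofReal, mul_neg] at h2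
          exact h2
        rw [intervalIntegral.integral_eq_sub_of_hasDerivAt hder
          ((hVc.comp (continuous_id.prodMk continuous_const)).intervalIntegrable _ _)]
        simp
      simp only [h1]
      rw [intervalIntegral.integral_sub]
      · simp
      · have := continuous_circleMap 0 1
        have := hv.continuous
        exact Continuous.intervalIntegrable (by fun_prop) _ _
      · exact intervalIntegrable_const
    · exact (hVc.continuousOn.integrableOn_compact
        (isCompact_uIcc.prod isCompact_uIcc)).mono_set
        (Set.prod_mono uIoc_subset_uIcc uIoc_subset_uIcc)
  have hΦ : ∫ r in (0 : ℝ)..1, (-D r - (r * Real.log r) * A r) = 0 := by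
    have hcont : Continuous fun r : ℝ => -(r * Real.log r) * D r :=
      (Real.continuous_mul_log.neg).mul hDc
    rw [intervalIntegral.integral_eq_sub_of_hasDerivAt_of_le zero_le_one hcont.continuousOn]
    · simp
    · intro r hr
      have hB : HasDerivAt (fun R : ℝ => ∫ r in (0 : ℝ)..R, r * A r) (r * A r) r :=
        intervalIntegral.integral_hasDerivAt_right ((continuous_id.mul hAc).intervalIntegrable _ _)
          ((continuous_id.mul hAc).stronglyMeasurableAtFilter _ _)
          (continuous_id.mul hAc).continuousAt
      have h1 := ((Real.hasDerivAt_log hr.1.ne').mul hB).neg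
      refine (h1.congr_deriv ?_).congr_of_eventuallyEq ?_
      · rw [hgreen]
        have := hr.1.ne'
        field_simp
        ring
      · refine Eventually.of_forall fun R => ?_
        simp only [Pi.neg_apply, Pi.mul_apply]
        rw [hgreen]
        ring
    · exact ((hDc.neg).sub (Real.continuous_mul_log.mul hAc)).intervalIntegrable _ _
  have hDn : Continuous fun r => -D r := hDc.neg
  have hAl : Continuous fun r => r * Real.log r * A r := Real.continuous_mul_log.mul hAc
  rw [intervalIntegral.integral_sub (hDn.intervalIntegrable _ _) (hAl.intervalIntegrable _ _), intervalIntegral.integral_neg,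
    hmean] at hΦ
  simp only [intervalIntegral.integral_const_mul]
  linarith

/-- Integration of a logarithmic kernel against a function continuous up to the boundary. -/
theorem integrable_log_mul {f : ℂ → ℝ} (hf : ContinuousOn f (Metric.closedBall 0 1)) :
    Integrable (fun z => Real.log ‖z‖ * f z) diskMeasure ∧
    ∫ z, Real.log ‖z‖ * f z ∂diskMeasure = ∫ r in (0 : ℝ)..1, ∫ θ in (0 : ℝ)..2 * π,
        (r * Real.log r) * f (circleMap 0 r θ) := by
  have hg : ContinuousOn (fun p : ℝ × ℝ => (p.1 * Real.log p.1) * f (circleMap 0 p.1 p.2))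
      (Icc (0 : ℝ) 1 ×ˢ univ) :=
    ((Real.continuous_mul_log.comp continuous_fst).continuousOn).mul (continuousOn_comp_circleMap hf)
  have h : ∀ r ∈ Ioo (0 : ℝ) 1, ∀ θ : ℝ, r • (Real.log ‖circleMap 0 r θ‖ * f (circleMap 0 r θ)) =
      (r * Real.log r) * f (circleMap 0 r θ) := by
    intro r hr θ
    rw [norm_circleMap_zero, abs_of_pos hr.1, smul_eq_mul]
    ring
  refine ⟨integrable_disk_of_polar ?_ hg h, integral_disk_eq_intervalIntegral hg h⟩
  exact (Real.measurable_log.comp measurable_norm).aestronglyMeasurable.mul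
    (integrable_disk_of_continuousOn hf).1

/-- The polar Jacobian r cancels the singularity. -/
theorem integrable_div_norm {f : ℂ → ℝ} (hf : ContinuousOn f (Metric.closedBall 0 1)) :
    Integrable (fun z => f z / ‖z‖) diskMeasure := by
  refine integrable_disk_of_polar (g := fun p => f (circleMap 0 p.1 p.2)) ?_
    (continuousOn_comp_circleMap hf) ?_
  · simp only [div_eq_mul_inv]
    exact (integrable_disk_of_continuousOn hf).1.mul
      (measurable_norm.inv).aestronglyMeasurable
  · intro r hr θ
    have := hr.1.ne'
    rw [norm_circleMap_zero, abs_of_pos hr.1, smul_eq_mul]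
    field_simp

/-- Green's representation formula at the centre of the disk. -/
theorem center_representation {v f : ℂ → ℝ} (hv : ContDiff ℝ ∞ v)
    (hfv : ∀ z ∈ disk, wirtinger (grad v) z = -(f z : ℂ)) :
    2 * π * v 0 = (∫ θ in (0 : ℝ)..2 * π, v (circleMap 0 1 θ)) -
      ∫ z, Real.log ‖z‖ * f z ∂diskMeasure := by
  have h1 := integral_log_mul_laplacian hv
  have hX1 : ContDiff ℝ 1 (grad v) := (contDiff_grad hv).of_le (by exact_mod_cast le_top)
  have h2 := (integrable_log_mul (f := fun z => (wirtinger (grad v) z).re)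
    (Complex.continuous_re.comp (continuous_wirtinger hX1)).continuousOn).2
  rw [← h2] at h1
  have h3 : ∫ z, Real.log ‖z‖ * (wirtinger (grad v) z).re ∂diskMeasure =
      - ∫ z, Real.log ‖z‖ * f z ∂diskMeasure := by
    rw [← integral_neg]
    refine setIntegral_congr_fun Metric.isOpen_ball.measurableSet fun z hz => ?_
    simp only [hfv z hz]
    simp
  linarith

/-- Gibbs' inequality against the singular weight `1 / ‖z‖`. -/
theorem gibbs_disk {p m : ℂ → ℝ} (hp : ContinuousOn p (Metric.closedBall 0 1))
    (hm : ContinuousOn m (Metric.closedBall 0 1)) (hp0 : ∀ z ∈ Metric.closedBall (0 : ℂ) 1, 0 < p z)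
    (hm0 : ∀ z ∈ Metric.closedBall (0 : ℂ) 1, 0 < m z) (hp1 : ∫ z, p z ∂diskMeasure = 1) {Z : ℝ}
    (hZ : 0 < Z) (hZm : ∫ z, m z / ‖z‖ ∂diskMeasure ≤ Z) :
    - ∫ z, Real.log ‖z‖ * p z ∂diskMeasure ≤
      (∫ z, p z * Real.log (p z / m z) ∂diskMeasure) + Real.log Z := by
  have hpm : ContinuousOn (fun z => p z * Real.log (p z / m z)) (Metric.closedBall 0 1) :=
    hp.mul ((hp.div hm (fun z hz => (hm0 z hz).ne')).log
      (fun z hz => (div_pos (hp0 z hz) (hm0 z hz)).ne'))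
  have hi1 := (integrable_log_mul hp).1
  have hi2 := integrable_disk_of_continuousOn hpm
  have hi3 := integrable_disk_of_continuousOn hp
  have hi4 := integrable_div_norm hm
  have hi5 : Integrable (fun z => -(Real.log ‖z‖ * p z)) diskMeasure := hi1.neg
  have hi6 : Integrable (fun z => -(Real.log ‖z‖ * p z) - p z * Real.log (p z / m z))
    diskMeasure := hi5.sub hi2
  have key : ∫ z, (-(Real.log ‖z‖ * p z) - p z * Real.log (p z / m z) - Real.log Z * p z)
      ∂diskMeasure ≤ ∫ z, (m z / ‖z‖ * Z⁻¹ - p z) ∂diskMeasure := by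
    refine integral_mono_ae (hi6.sub (hi3.const_mul _)) ((hi4.mul_const _).sub hi3) ?_
    filter_upwards [ae_restrict_mem Metric.isOpen_ball.measurableSet,
      ae_restrict_of_ae (compl_mem_ae_iff.2 (measure_singleton (0 : ℂ)))] with z hz hne
    change z ≠ 0 at hne
    have hz' : z ∈ Metric.closedBall (0 : ℂ) 1 := Metric.ball_subset_closedBall hz
    have h1 := hp0 z hz'
    have h2 := hm0 z hz'
    have h3 : 0 < ‖z‖ := norm_pos_iff.2 hne
    -- log x ≤ x - 1 at the ratio of the normalized weight m/(Z|z|) to p; the centre, where |z|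
    -- vanishes, is a null set.
    have h4 := Real.log_le_sub_one_of_pos (x := m z / ‖z‖ * Z⁻¹ / p z) (by positivity)
    rw [Real.log_div (by positivity) h1.ne', Real.log_mul (by positivity) (by positivity),
      Real.log_div h2.ne' h3.ne', Real.log_inv] at h4
    have h5 := mul_le_mul_of_nonneg_left h4 h1.le
    rw [Real.log_div h1.ne' h2.ne']
    have h6 : p z * (m z / ‖z‖ * Z⁻¹ / p z - 1) = m z / ‖z‖ * Z⁻¹ - p z := by
      field_simp
    linarith
  rw [integral_sub hi6 (hi3.const_mul _), integral_sub hi5 hi2,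
    integral_sub (hi4.mul_const _) hi3, integral_const_mul, integral_mul_const, hp1,
    integral_neg] at key
  have : (∫ z, m z / ‖z‖ ∂diskMeasure) * Z⁻¹ ≤ 1 := by
    rw [← div_eq_mul_inv, div_le_one hZ]
    exact hZm
  linarith

/-! ### Disk automorphisms and the entropy bound for potentials. -/

/-- The disk automorphism sending `0` to `a`. -/
noncomputable def mobius (a z : ℂ) : ℂ := (z + a) / (1 + conj a * z)

/-- The derivative of `mobius`. -/
noncomputable def mobiusDeriv (a z : ℂ) : ℂ := (1 - (‖a‖ : ℂ) ^ 2) / (1 + conj a * z) ^ 2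

/-- The radius R may exceed 1, which gives holomorphy in a neighbourhood of the closed disk. -/
theorem mobius_denom_ne_zero {a z : ℂ} {R : ℝ} (ha : ‖a‖ * R < 1) (hz : ‖z‖ ≤ R) :
    1 + conj a * z ≠ 0 := by
  intro h
  have h1 : conj a * z = -1 := by linear_combination h
  have h2 := congrArg norm h1
  rw [norm_mul, Complex.norm_conj, norm_neg, norm_one] at h2
  have := mul_le_mul_of_nonneg_left hz (norm_nonneg a)
  linarith

theorem hasDerivAt_mobius {a z : ℂ} (h : 1 + conj a * z ≠ 0) :
    HasDerivAt (mobius a) (mobiusDeriv a z) z := by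
  have h1 : HasDerivAt (fun z => z + a) 1 z := (hasDerivAt_id z).add_const a
  have h2 : HasDerivAt (fun z => 1 + conj a * z) (conj a) z := by
    simpa using ((hasDerivAt_id z).const_mul (conj a)).const_add 1
  refine (h1.div h2 h).congr_deriv ?_
  rw [mobiusDeriv, ← Complex.mul_conj']
  congr 1
  ring

/-- The source of the invariance of both the disk and the circle. -/
theorem one_sub_normSq_mobius {a z : ℂ} (h : 1 + conj a * z ≠ 0) :
    (1 - ‖mobius a z‖ ^ 2) * ‖1 + conj a * z‖ ^ 2 = (1 - ‖a‖ ^ 2) * (1 - ‖z‖ ^ 2) := by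
  rw [mobius, norm_div, div_pow, sub_mul, div_mul_cancel₀ _ (by simpa using h)]
  have e : ∀ w : ℂ, ‖w‖ ^ 2 = w.re * w.re + w.im * w.im := fun w => by
    rw [← Complex.normSq_eq_norm_sq, Complex.normSq_apply]
  simp only [e]
  simp
  ring

theorem mobius_mem_disk {a z : ℂ} (ha : ‖a‖ < 1) (hz : z ∈ disk) : mobius a z ∈ disk := by
  have hz' : ‖z‖ < 1 := by simpa [disk] using hz
  have h := mobius_denom_ne_zero (a := a) (R := 1) (by simpa using ha) hz'.le
  have h1 := one_sub_normSq_mobius h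
  have h2 : 0 < ‖1 + conj a * z‖ ^ 2 := by positivity
  have h3 : 0 < (1 - ‖a‖ ^ 2) * (1 - ‖z‖ ^ 2) := by
    have : ‖a‖ ^ 2 < 1 := by nlinarith [norm_nonneg a]
    have : ‖z‖ ^ 2 < 1 := by nlinarith [norm_nonneg z]
    apply mul_pos <;> linarith
  have h4 : 0 < 1 - ‖mobius a z‖ ^ 2 := by
    rw [← h1] at h3
    exact (mul_pos_iff_of_pos_right h2).1 h3
  have : ‖mobius a z‖ < 1 := by
    by_contra hc
    push Not at hc
    nlinarith
  simpa [disk] using this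

theorem norm_mobius_of_norm_eq_one {a z : ℂ} (ha : ‖a‖ < 1) (hz : ‖z‖ = 1) : ‖mobius a z‖ = 1 := by
  have h := mobius_denom_ne_zero (a := a) (R := 1) (by simpa using ha) hz.le
  have h1 := one_sub_normSq_mobius h
  have h2 : 0 < ‖1 + conj a * z‖ ^ 2 := by positivity
  rw [hz] at h1
  have h3 : 1 - ‖mobius a z‖ ^ 2 = 0 := by
    rcases mul_eq_zero.1 (h1.trans (by ring : _ = (0 : ℝ))) with h | h
    · exact h
    · exact absurd h h2.ne'
  nlinarith [norm_nonneg (mobius a z)]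

theorem mobius_mem_closedBall {a z : ℂ} (ha : ‖a‖ < 1) (hz : z ∈ Metric.closedBall (0 : ℂ) 1) :
    mobius a z ∈ Metric.closedBall (0 : ℂ) 1 := by
  rcases (mem_closedBall_zero_iff.1 hz).lt_or_eq with h | h
  · exact Metric.ball_subset_closedBall (mobius_mem_disk ha (by simpa [disk] using h))
  · simpa using (norm_mobius_of_norm_eq_one ha h).le

theorem mobius_neg_mobius {a z : ℂ} (ha : ‖a‖ < 1) (hz : z ∈ disk) :
    mobius (-a) (mobius a z) = z := by
  have hz' : ‖z‖ < 1 := by simpa [disk] using hz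
  have h := mobius_denom_ne_zero (a := a) (R := 1) (by simpa using ha) hz'.le
  have hw : ‖mobius a z‖ < 1 := by simpa [disk] using mobius_mem_disk ha hz
  have h' := mobius_denom_ne_zero (a := -a) (R := 1) (by simpa using ha) hw.le
  rw [mobius, div_eq_iff h']
  simp only [mobius, map_neg]
  rw [div_add' _ _ _ h, div_eq_iff h]
  have : z * (1 + -conj a * ((z + a) / (1 + conj a * z))) * (1 + conj a * z) =
      z * ((1 + conj a * z) - conj a * ((z + a) / (1 + conj a * z) * (1 + conj a * z))) := by ring
  rw [this, div_mul_cancel₀ _ h]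
  ring

theorem mobius_image_disk {a : ℂ} (ha : ‖a‖ < 1) : mobius a '' disk = disk := by
  refine Subset.antisymm (image_subset_iff.2 fun z hz => mobius_mem_disk ha hz) fun z hz => ?_
  have ha' : ‖-a‖ < 1 := by simpa using ha
  refine ⟨mobius (-a) z, mobius_mem_disk ha' hz, ?_⟩
  simpa using mobius_neg_mobius ha' hz

theorem mobius_injOn {a : ℂ} (ha : ‖a‖ < 1) : InjOn (mobius a) disk := by
  intro z hz w hw h
  rw [← mobius_neg_mobius ha hz, h, mobius_neg_mobius ha hw]

/-- Change of variables under a disk automorphism. -/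
theorem integral_mobius {a : ℂ} (ha : ‖a‖ < 1) (f : ℂ → ℝ) :
    ∫ z, f (mobius a z) * ‖mobiusDeriv a z‖ ^ 2 ∂diskMeasure = ∫ z, f z ∂diskMeasure := by
  have hd : MeasurableSet disk := Metric.isOpen_ball.measurableSet
  have h := integral_image_eq_integral_abs_det_fderiv_smul volume hd
    (f := mobius a)
    (f' := fun z => (ContinuousLinearMap.toSpanSingleton ℂ (mobiusDeriv a z)).restrictScalars ℝ)
    (fun z hz => by
      have hz' : ‖z‖ < 1 := by simpa [disk] using hz
      exact ((hasDerivAt_mobius (mobius_denom_ne_zero (R := 1) (by simpa using ha)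
        hz'.le)).hasFDerivAt.restrictScalars ℝ).hasFDerivWithinAt) (mobius_injOn ha) f
  rw [mobius_image_disk ha] at h
  rw [diskMeasure, h]
  refine setIntegral_congr_fun hd fun z _ => ?_
  have : ((ContinuousLinearMap.toSpanSingleton ℂ (mobiusDeriv a z)).restrictScalars ℝ).det =
      ‖mobiusDeriv a z‖ ^ 2 := by
    simp [ContinuousLinearMap.det, LinearMap.det_restrictScalars, Algebra.norm_complex_apply,
      Complex.normSq_eq_norm_sq]
  simp only [this, smul_eq_mul]
  rw [abs_of_nonneg (by positivity), mul_comm]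

/-- The gradient of a composition with a holomorphic function. -/
theorem grad_comp {ψ : ℂ → ℝ} {T : ℂ → ℂ} {T' z : ℂ} (hψ : DifferentiableAt ℝ ψ (T z))
    (hT : HasDerivAt T T' z) : grad (fun z => ψ (T z)) z = conj T' * grad ψ (T z) := by
  have h : HasFDerivAt (fun z => ψ (T z)) _ z :=
    hψ.hasFDerivAt.comp z (hT.hasFDerivAt.restrictScalars ℝ)
  rw [grad, h.fderiv]
  simp only [ContinuousLinearMap.comp_apply, ContinuousLinearMap.coe_restrictScalars',
    ContinuousLinearMap.toSpanSingleton_apply, fderiv_eq_re_grad]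
  apply Complex.ext <;> simp; ring

/-- Conformal covariance of the Laplacian. -/
theorem laplacian_comp {ψ : ℂ → ℝ} (hψ : ContDiff ℝ ∞ ψ) {T T' : ℂ → ℂ} {T'' z : ℂ}
    (hT : ∀ᶠ w in 𝓝 z, HasDerivAt T (T' w) w) (hT' : HasDerivAt T' T'' z) :
    wirtinger (grad (fun z => ψ (T z))) z =
      (‖T' z‖ : ℂ) ^ 2 * wirtinger (grad ψ) (T z) := by
  have he : grad (fun z => ψ (T z)) =ᶠ[𝓝 z] fun w => conj (T' w) * grad ψ (T w) := by
    filter_upwards [hT] with w hw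
    exact grad_comp (differentiable_of_contDiff_infty hψ _) hw
  have hG := (differentiable_of_contDiff_infty (contDiff_grad hψ) (T z)).hasFDerivAt
  have h1 : HasFDerivAt (fun w => grad ψ (T w)) _ z :=
    hG.comp z (hT.self_of_nhds.hasFDerivAt.restrictScalars ℝ)
  have h2 : HasFDerivAt (fun w => conj (T' w)) _ z :=
    (Complex.conjCLE : ℂ →L[ℝ] ℂ).hasFDerivAt.comp z (hT'.hasFDerivAt.restrictScalars ℝ)
  rw [wirtinger, he.fderiv_eq, (h2.fun_mul h1).fderiv, wirtinger, ← Complex.mul_conj']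
  simp only [add_apply, smul_apply, ContinuousLinearMap.comp_apply,
    ContinuousLinearMap.coe_restrictScalars', ContinuousLinearMap.toSpanSingleton_apply,
    smul_eq_mul, one_mul]
  rw [fderiv_eq_re_im (grad ψ) (T z) (T' z), fderiv_eq_re_im (grad ψ) (T z) (Complex.I * T' z)]
  have hre : (Complex.I * T' z).re = -(T' z).im := by simp
  have him : (Complex.I * T' z).im = (T' z).re := by simp
  have h3 := Complex.re_add_im (T' z)
  rw [hre, him]
  have hc1 : (Complex.conjCLE : ℂ →L[ℝ] ℂ) T'' = conj T'' := rfl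
  have hc2 : (Complex.conjCLE : ℂ →L[ℝ] ℂ) (Complex.I * T'') = -Complex.I * conj T'' := by
    change conj (Complex.I * T'') = _
    simp
  rw [hc1, hc2]
  set a := fderiv ℝ (grad ψ) (T z) 1
  set b := fderiv ℝ (grad ψ) (T z) Complex.I
  push_cast
  linear_combination conj (T' z) * (a - Complex.I * b) * h3 +
    (conj (T' z) * ((T' z).im : ℂ) * b + grad ψ (T z) * conj T'') * Complex.I_sq

/-- A potential composed with a disk automorphism is known to be smooth only near the closed disk,
while `center_representation` takes functions smooth on the plane. A cutoff equal to 1 on a disk of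
radius greater than 1 changes nothing that matters. -/
theorem exists_contDiff_extension {v : ℂ → ℝ} {R : ℝ} (hR : 1 < R)
    (hv : ContDiffOn ℝ ∞ v (Metric.ball 0 R)) :
    ∃ w : ℂ → ℝ, ContDiff ℝ ∞ w ∧ ∀ᶠ r in 𝓝[>] (1 : ℝ), ∀ z ∈ Metric.ball (0 : ℂ) r, w z = v z := by
  let χ : ContDiffBump (0 : ℂ) := ⟨(1 + R) / 2, (1 + 3 * R) / 4, by linarith, by linarith⟩
  refine ⟨fun z => χ z * v z, ?_, ?_⟩
  · rw [contDiff_iff_contDiffAt]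
    intro z
    by_cases hz : z ∈ Metric.ball (0 : ℂ) R
    · exact χ.contDiff.contDiffAt.mul (hv.contDiffAt (Metric.isOpen_ball.mem_nhds hz))
    · have : z ∈ (tsupport χ)ᶜ := by
        rw [χ.tsupport_eq]
        simp only [mem_compl_iff, mem_closedBall_zero_iff, mem_ball_zero_iff, χ] at hz ⊢
        linarith
      have he : (fun z => χ z * v z) =ᶠ[𝓝 z] fun _ => 0 := by
        filter_upwards [(isClosed_tsupport χ).isOpen_compl.mem_nhds this] with w hw
        rw [image_eq_zero_of_notMem_tsupport hw, zero_mul]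
      exact contDiffAt_const.congr_of_eventuallyEq he
  · filter_upwards [Ioo_mem_nhdsGT (show (1 : ℝ) < (1 + R) / 2 by linarith)] with r hr z hz
    rw [χ.one_of_mem_closedBall, one_mul]
    simp only [mem_ball_zero_iff, mem_closedBall_zero_iff, χ] at hz ⊢
    linarith [hr.2]

theorem wirtinger_grad_congr {v w : ℂ → ℝ} {z : ℂ} (h : v =ᶠ[𝓝 z] w) :
    wirtinger (grad v) z = wirtinger (grad w) z := by
  have h1 : grad v =ᶠ[𝓝 z] grad w := by
    filter_upwards [h.fderiv (𝕜 := ℝ)] with y hy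
    simp only [grad, hy]
  simp only [wirtinger, h1.fderiv_eq]

theorem eq_circleMap_arg {z : ℂ} (hz : ‖z‖ = 1) : z = circleMap 0 1 z.arg := by
  have := Complex.norm_mul_exp_arg_mul_I z
  rw [hz] at this
  exact (circleMap_zero_eq 1 z.arg).trans this |>.symm

theorem continuousOn_re_eval (P : Polynomial ℂ) : Continuous fun z => (P.eval z).re :=
  Complex.continuous_re.comp P.continuous

/-- Pointwise bound for the solution of a Dirichlet problem by the entropy of the right-hand side
relative to the density `exp (Re P)`. -/
theorem potential_le_entropy {ψ q : ℂ → ℝ} (hψ : ContDiff ℝ ∞ ψ)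
    (hψ0 : ∀ θ : ℝ, ψ (circleMap 0 1 θ) = 0) (hψq : ∀ z, wirtinger (grad ψ) z = -(q z : ℂ))
    (hq : Continuous q) (hq0 : ∀ z ∈ Metric.closedBall (0 : ℂ) 1, 0 < q z)
    (hq1 : ∫ z, q z ∂diskMeasure = 1) (P : Polynomial ℂ) {a : ℂ} (ha : a ∈ disk) :
    2 * π * ψ a ≤ (∫ z, q z * Real.log (q z / Real.exp (P.eval z).re) ∂diskMeasure) +
      Real.log (2 * ∫ z, Real.exp (P.eval z).re ∂diskMeasure) := by
  have ha' : ‖a‖ < 1 := by simpa [disk] using ha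
  -- Chosen so that 1 < R and ‖a‖ R < 1: the pole of the automorphism stays outside the disk of
  -- radius R.
  set R : ℝ := 2 / (1 + ‖a‖) with hRdef
  have hna := norm_nonneg a
  have hR : 1 < R := by rw [hRdef, lt_div_iff₀ (by linarith)]; linarith
  have haR : ‖a‖ * R < 1 := by
    rw [hRdef, mul_div_assoc', div_lt_one (by linarith)]; linarith
  have hden : ∀ z ∈ Metric.ball (0 : ℂ) R, 1 + conj a * z ≠ 0 := fun z hz =>
    mobius_denom_ne_zero haR (mem_ball_zero_iff.1 hz).le
  have hTd : DifferentiableOn ℂ (mobius a) (Metric.ball 0 R) := fun z hz =>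
    (hasDerivAt_mobius (hden z hz)).differentiableAt.differentiableWithinAt
  have hT'd : DifferentiableOn ℂ (mobiusDeriv a) (Metric.ball 0 R) := by
    intro z hz
    have h1 : DifferentiableAt ℂ (fun z => (1 + conj a * z) ^ 2) z := by fun_prop
    exact ((differentiableAt_const _).div h1
      (pow_ne_zero 2 (hden z hz))).differentiableWithinAt
  have hsub : Metric.closedBall (0 : ℂ) 1 ⊆ Metric.ball 0 R := Metric.closedBall_subset_ball hR
  have hTc : ContinuousOn (mobius a) (Metric.closedBall 0 1) := (hTd.mono hsub).continuousOn
  have hT'c : ContinuousOn (mobiusDeriv a) (Metric.closedBall 0 1) := (hT'd.mono hsub).continuousOn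
  have hT'0 : ∀ z ∈ Metric.closedBall (0 : ℂ) 1, 0 < ‖mobiusDeriv a z‖ ^ 2 := by
    intro z hz
    have h1 := hden z (hsub hz)
    have h2 : (1 - (‖a‖ : ℂ) ^ 2) ≠ 0 := by
      have : (1 - ‖a‖ ^ 2 : ℝ) ≠ 0 := by nlinarith
      exact_mod_cast this
    have h3 : mobiusDeriv a z ≠ 0 := div_ne_zero h2 (pow_ne_zero 2 h1)
    positivity
  have hv0 : ContDiffOn ℝ ∞ (fun z => ψ (mobius a z)) (Metric.ball 0 R) :=
    hψ.comp_contDiffOn ((hTd.contDiffOn Metric.isOpen_ball).restrict_scalars ℝ)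
  obtain ⟨w, hw, hwr⟩ := exists_contDiff_extension hR hv0
  obtain ⟨r, hr, hr1⟩ := (hwr.and self_mem_nhdsWithin).exists
  change 1 < r at hr1
  have hlap : ∀ z ∈ disk, wirtinger (grad w) z =
      -((q (mobius a z) * ‖mobiusDeriv a z‖ ^ 2 : ℝ) : ℂ) := by
    intro z hz
    have hz' : ‖z‖ < 1 := by simpa [disk] using hz
    have hzr : Metric.ball (0 : ℂ) r ∈ 𝓝 z :=
      Metric.isOpen_ball.mem_nhds (mem_ball_zero_iff.2 (hz'.trans hr1))
    have hzR : Metric.ball (0 : ℂ) R ∈ 𝓝 z :=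
      Metric.isOpen_ball.mem_nhds (mem_ball_zero_iff.2 (hz'.trans hR))
    rw [wirtinger_grad_congr (w := fun z => ψ (mobius a z)) (by filter_upwards [hzr] using hr),
      laplacian_comp hψ (T' := mobiusDeriv a)
        (by filter_upwards [hzR] with y hy using hasDerivAt_mobius (hden y hy))
        ((hT'd.differentiableAt hzR).hasDerivAt), hψq]
    push_cast
    ring
  have hcen := center_representation hw hlap
  have hw0 : w 0 = ψ a := by
    rw [hr 0 (by simp; linarith)]
    simp [mobius]
  have hwb : ∀ θ : ℝ, w (circleMap 0 1 θ) = 0 := by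
    intro θ
    have h1 : ‖circleMap 0 1 θ‖ = 1 := by simp
    rw [hr _ (by simpa using hr1), eq_circleMap_arg (norm_mobius_of_norm_eq_one ha' h1), hψ0]
  simp only [hwb, intervalIntegral.integral_zero, zero_sub, hw0] at hcen
  rw [hcen]
  have hPc := continuousOn_re_eval P
  -- The squared modulus of the holomorphic F is the pullback of the density e^{Re P}, Jacobian
  -- included. Its mass is therefore that of e^{Re P}, and the weight 1/|z| costs at most a factor
  -- 2.
  set F : ℂ → ℂ := fun z => Complex.exp (P.eval (mobius a z) / 2) * mobiusDeriv a z with hF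
  have hFd : DifferentiableOn ℂ F (Metric.ball 0 R) := by
    refine DifferentiableOn.mul ?_ hT'd
    exact ((P.differentiable.comp_differentiableOn hTd).div_const 2).cexp
  have hFm : ∀ z, ‖F z‖ ^ 2 = Real.exp (P.eval (mobius a z)).re * ‖mobiusDeriv a z‖ ^ 2 := by
    intro z
    rw [hF, norm_mul, mul_pow, Complex.norm_exp, ← Real.exp_nat_mul]
    congr 2
    simp
    ring
  have hser := exists_hasDiskSeries hR hFd
  have hmass : ∫ z, ‖F z‖ ^ 2 ∂diskMeasure = ∫ z, Real.exp (P.eval z).re ∂diskMeasure := by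
    simp only [hFm]
    exact integral_mobius ha' (fun z => Real.exp (P.eval z).re)
  have hpos : 0 < ∫ z, Real.exp (P.eval z).re ∂diskMeasure := by
    have hne : diskMeasure ≠ 0 := by
      rw [diskMeasure, Ne, Measure.restrict_eq_zero]
      exact (Metric.measure_ball_pos volume (0 : ℂ) one_pos).ne'
    have : NeZero diskMeasure := ⟨hne⟩
    exact integral_exp_pos (integrable_disk_of_continuous (Real.continuous_exp.comp hPc))
  have hgibbs := gibbs_disk (p := fun z => q (mobius a z) * ‖mobiusDeriv a z‖ ^ 2)
    (m := fun z => ‖F z‖ ^ 2) (Z := 2 * ∫ z, Real.exp (P.eval z).re ∂diskMeasure)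
    ((hq.comp_continuousOn hTc).mul (hT'c.norm.pow 2))
    ((hFd.mono hsub).continuousOn.norm.pow 2)
    (fun z hz => mul_pos (hq0 _ (mobius_mem_closedBall ha' hz)) (hT'0 z hz))
    (fun z hz => by
      simp only [hFm]
      exact mul_pos (Real.exp_pos _) (hT'0 z hz))
    ((integral_mobius ha' q).trans hq1) (by linarith)
    (by rw [← hmass]; exact hser.integral_disk_div_norm_le)
  refine hgibbs.trans (le_of_eq ?_)
  congr 1
  -- Both densities acquire the same Jacobian, which cancels in their ratio: relative entropy is
  -- conformally invariant.
  rw [← integral_mobius ha' (fun z => q z * Real.log (q z / Real.exp (P.eval z).re))]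
  refine setIntegral_congr_fun Metric.isOpen_ball.measurableSet fun z hz => ?_
  simp only [hFm]
  rw [mul_div_mul_right _ _ (hT'0 z (Metric.ball_subset_closedBall hz)).ne']
  ring

/-! ### Green's first identity and the orthogonal splitting of the energy. -/

/-- The real part of conj (grad f) · Y is the scalar product of the two vectors, so this is the
product rule for the divergence, with the curl as imaginary part. -/
theorem wirtinger_ofReal_mul {f : ℂ → ℝ} {Y : ℂ → ℂ} {z : ℂ} (hf : DifferentiableAt ℝ f z)
    (hY : DifferentiableAt ℝ Y z) :
    wirtinger (fun z => (f z : ℂ) * Y z) z = conj (grad f z) * Y z + f z * wirtinger Y z := by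
  have h1 : HasFDerivAt (fun z => (f z : ℂ)) (Complex.ofRealCLM ∘L fderiv ℝ f z) z :=
    Complex.ofRealCLM.hasFDerivAt.comp z hf.hasFDerivAt
  rw [wirtinger, (h1.fun_mul hY.hasFDerivAt).fderiv, wirtinger, grad]
  simp
  ring

/-- Green's first identity. -/
theorem green_mul {f : ℂ → ℝ} {Y : ℂ → ℂ} (hf : ContDiff ℝ ∞ f) (hY : ContDiff ℝ ∞ Y) :
    ∫ z, (conj (grad f z) * Y z + f z * wirtinger Y z) ∂diskMeasure =
      ∫ θ in (0 : ℝ)..2 * π, (f (circleMap 0 1 θ) : ℂ) *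
        (conj (circleMap 0 1 θ) * Y (circleMap 0 1 θ)) := by
  have hX : ContDiff ℝ 1 (fun z => (f z : ℂ) * Y z) :=
    ((Complex.ofRealCLM.contDiff.comp hf).mul hY).of_le (by exact_mod_cast le_top)
  have h := green_disk hX
  have h1 : ∀ z, wirtinger (fun z => (f z : ℂ) * Y z) z =
      conj (grad f z) * Y z + f z * wirtinger Y z := fun z =>
    wirtinger_ofReal_mul (differentiable_of_contDiff_infty hf z)
      (differentiable_of_contDiff_infty hY z)
  simp only [h1] at h
  rw [h]
  refine intervalIntegral.integral_congr fun θ _ => ?_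
  simp only [circleMap_zero_eq, ← Complex.exp_conj, map_mul, Complex.conj_ofReal, Complex.conj_I]
  simp
  ring

theorem grad_re_eval (P : Polynomial ℂ) (z : ℂ) :
    grad (fun z => (P.eval z).re) z = conj (P.derivative.eval z) := by
  have h : HasFDerivAt (fun z => (P.eval z).re) _ z :=
    Complex.reCLM.hasFDerivAt.comp z ((P.hasDerivAt z).hasFDerivAt.restrictScalars ℝ)
  rw [grad, h.fderiv]
  apply Complex.ext <;> simp

theorem contDiff_eval (P : Polynomial ℂ) : ContDiff ℝ ∞ fun z => P.eval z :=
  (P.differentiable.contDiff (n := ∞)).restrict_scalars ℝ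

theorem contDiff_re_eval (P : Polynomial ℂ) : ContDiff ℝ ∞ fun z => (P.eval z).re :=
  Complex.reCLM.contDiff.comp (contDiff_eval P)

theorem contDiff_conj_eval (P : Polynomial ℂ) : ContDiff ℝ ∞ fun z => conj (P.eval z) :=
  Complex.conjCLE.contDiff.comp (contDiff_eval P)

theorem wirtinger_conj_eval (P : Polynomial ℂ) (z : ℂ) :
    wirtinger (fun z => conj (P.eval z)) z = 0 := by
  have h : HasFDerivAt (fun z => conj (P.eval z)) _ z :=
    (Complex.conjCLE : ℂ →L[ℝ] ℂ).hasFDerivAt.comp z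
      ((P.hasDerivAt z).hasFDerivAt.restrictScalars ℝ)
  rw [wirtinger, h.fderiv]
  simp only [ContinuousLinearMap.comp_apply, ContinuousLinearMap.coe_restrictScalars',
    ContinuousLinearMap.toSpanSingleton_apply, smul_eq_mul, one_mul]
  change conj _ - Complex.I * conj _ = 0
  rw [map_mul, Complex.conj_I]
  linear_combination conj (P.derivative.eval z) * Complex.I_sq

theorem CircleOrthogonal.integral_polynomial {w : ℂ → ℝ} {N : ℕ} (h : CircleOrthogonal w N)
    (hw : Continuous w) {Q : Polynomial ℂ} (hQ : Q.natDegree ≤ N) :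
    ∫ θ in (0 : ℝ)..2 * π, (w (circleMap 0 1 θ) : ℂ) * Q.eval (circleMap 0 1 θ) = 0 := by
  have hc := continuous_circleMap 0 1
  simp only [Polynomial.eval_eq_sum_range, Finset.mul_sum]
  rw [intervalIntegral.integral_finsetSum]
  · refine Finset.sum_eq_zero fun k hk => ?_
    have := h k ((Finset.mem_range_succ_iff.1 hk).trans hQ)
    simp only [mul_left_comm _ (Q.coeff k), intervalIntegral.integral_const_mul, this, mul_zero]
  · intro k _
    exact Continuous.intervalIntegrable (by fun_prop) _ _

/-- The field conj P' = ∇ Re P is annihilated by `wirtinger`, so Green's identity leaves a boundary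
pairing of w with conj (zP'). The degree of zP' is at most that of P, and orthogonality kills the
pairing. This is the cross term in `dirichlet_split`. -/
theorem integral_conj_grad_mul_eq_zero {w : ℂ → ℝ} {N : ℕ} (h : CircleOrthogonal w N)
    (hw : ContDiff ℝ ∞ w) {P : Polynomial ℂ} (hP : P.natDegree ≤ N) :
    ∫ z, conj (grad w z) * conj (P.derivative.eval z) ∂diskMeasure = 0 := by
  have h1 := green_mul hw (contDiff_conj_eval P.derivative)
  simp only [wirtinger_conj_eval, mul_zero, add_zero] at h1
  rw [h1]
  have hdeg : (Polynomial.X * P.derivative).natDegree ≤ N := by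
    by_cases h0 : P.derivative = 0
    · simp [h0]
    · have hP0 : P.natDegree ≠ 0 := fun h2 =>
        h0 (Polynomial.derivative_of_natDegree_zero h2)
      have h3 := Polynomial.natDegree_derivative_lt hP0
      rw [Polynomial.natDegree_X_mul h0]
      omega
  have h2 := congrArg conj (h.integral_polynomial hw.continuous hdeg)
  rw [← intervalIntegral_star] at h2
  simpa using h2

/-- Dirichlet energy of a function on the disk, for its classical gradient. -/
noncomputable def dirichlet (u : ℂ → ℝ) : ℝ := ∫ z, ‖grad u z‖ ^ 2 ∂diskMeasure

theorem integrable_sq_grad {u : ℂ → ℝ} (hu : ContDiff ℝ ∞ u) :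
    Integrable (fun z => ‖grad u z‖ ^ 2) diskMeasure :=
  integrable_disk_of_continuous ((contDiff_grad hu).continuous.norm.pow 2)

theorem dirichlet_nonneg (u : ℂ → ℝ) : 0 ≤ dirichlet u :=
  integral_nonneg fun _ => by positivity

/-- Orthogonal splitting of the energy along a harmonic truncation. -/
theorem dirichlet_split {u : ℂ → ℝ} {N : ℕ} (hu : ContDiff ℝ ∞ u) {P : Polynomial ℂ}
    (hP : P.natDegree ≤ N) (h : CircleOrthogonal (fun z => u z - (P.eval z).re) N) :
    dirichlet u = dirichlet (fun z => u z - (P.eval z).re) +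
      ∫ z, ‖P.derivative.eval z‖ ^ 2 ∂diskMeasure := by
  have hw : ContDiff ℝ ∞ (fun z => u z - (P.eval z).re) := hu.sub (contDiff_re_eval P)
  have h1 := integral_conj_grad_mul_eq_zero h hw hP
  have hPc : Continuous fun z => P.derivative.eval z := P.derivative.continuous
  have hgc := (contDiff_grad hw).continuous
  have hi : Integrable (fun z => conj (grad (fun z => u z - (P.eval z).re) z) *
      conj (P.derivative.eval z)) diskMeasure := integrable_disk_of_continuous (by fun_prop)
  have h2 := congrArg Complex.reCLM h1
  rw [← ContinuousLinearMap.integral_comp_comm _ hi] at h2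
  simp only [Complex.reCLM_apply, map_zero] at h2
  have h3 : ∀ z, ‖grad u z‖ ^ 2 = ‖grad (fun z => u z - (P.eval z).re) z‖ ^ 2 +
      ‖P.derivative.eval z‖ ^ 2 + 2 * (conj (grad (fun z => u z - (P.eval z).re) z) *
        conj (P.derivative.eval z)).re := by
    intro z
    have h4 := grad_sub (differentiable_of_contDiff_infty hu z)
      (differentiable_of_contDiff_infty (contDiff_re_eval P) z)
    rw [grad_re_eval] at h4
    rw [show grad u z = grad (fun z => u z - (P.eval z).re) z + conj (P.derivative.eval z) by
      rw [h4]; ring]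
    have e : ∀ w : ℂ, ‖w‖ ^ 2 = w.re * w.re + w.im * w.im := fun w => by
      rw [← Complex.normSq_eq_norm_sq, Complex.normSq_apply]
    simp only [e]
    simp
    ring
  have hre : Continuous fun z => (conj (grad (fun z => u z - (P.eval z).re) z) *
      conj (P.derivative.eval z)).re := Complex.continuous_re.comp (by fun_prop)
  rw [dirichlet, integral_congr_ae (Eventually.of_forall h3), integral_add, integral_add,
    integral_const_mul, h2, dirichlet, mul_zero, add_zero]
  · exact integrable_sq_grad hw
  · exact integrable_disk_of_continuous (hPc.norm.pow 2)
  · exact (integrable_sq_grad hw).add (integrable_disk_of_continuous (hPc.norm.pow 2))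
  · exact integrable_disk_of_continuous (continuous_const.mul hre)

theorem neZero_diskMeasure : NeZero diskMeasure := ⟨by
  rw [diskMeasure, Ne, Measure.restrict_eq_zero]
  exact (Metric.measure_ball_pos volume (0 : ℂ) one_pos).ne'⟩

attribute [instance] neZero_diskMeasure

/-! ### Entropy inequalities and, by duality, exponential inequalities for smooth functions. -/

/-- The sharp entropy inequality in the disk for polynomial densities. -/
theorem entropy_disk {u : ℂ → ℝ} (hu : ContDiff ℝ ∞ u) (p : MvPolynomial (Fin 2) ℂ)
    (hp0 : ∀ z ∈ Metric.closedBall (0 : ℂ) 1, 0 < (zeval p z).re)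
    (hp1 : ∫ z, (zeval p z).re ∂diskMeasure = 1) :
    ∫ z, (zeval p z).re * (u z - Real.log (zeval p z).re) ∂diskMeasure ≤
      1 / (8 * π) * dirichlet u +
        1 / (2 * π) * (∫ θ in (0 : ℝ)..2 * π, u (circleMap 0 1 θ)) + Real.log (2 * π) := by
  obtain ⟨ψ, N, hψ, hψ0, hψq, hψN⟩ := exists_poisson_solution p
  obtain ⟨P, hPN, hP0, hPo⟩ := exists_harmonic_truncation hu.continuous N
  set q : ℂ → ℝ := fun z => (zeval p z).re with hq
  set w : ℂ → ℝ := fun z => u z - (P.eval z).re with hwdef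
  have hqc : Continuous q := Complex.continuous_re.comp (continuous_zeval p)
  have hPc := continuousOn_re_eval P
  have hw : ContDiff ℝ ∞ w := hu.sub (contDiff_re_eval P)
  have hψg := contDiff_grad hψ
  have hpi := pi_pos
  have hbd := (hψN w hw.continuous hPo).2
  have hgw := (contDiff_grad hw).continuous
  have hgψ := hψg.continuous
  have hwc := hw.continuous
  have hψc := hψ.continuous
  have green : ∀ f : ℂ → ℝ, ContDiff ℝ ∞ f →
      ∫ θ in (0 : ℝ)..2 * π, (f (circleMap 0 1 θ) : ℂ) *
        (conj (circleMap 0 1 θ) * grad ψ (circleMap 0 1 θ)) = 0 →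
      ∫ z, f z * q z ∂diskMeasure = ∫ z, (conj (grad f z) * grad ψ z).re ∂diskMeasure := by
    intro f hf h0
    have hfc := hf.continuous
    have hgf := (contDiff_grad hf).continuous
    have h1 := green_mul hf hψg
    rw [h0] at h1
    simp only [hψq] at h1
    have hqc' : Continuous fun z => (q z : ℂ) := Complex.continuous_ofReal.comp hqc
    have h2 := congrArg Complex.reCLM h1
    rw [← ContinuousLinearMap.integral_comp_comm _
      (integrable_disk_of_continuous (by fun_prop))] at h2
    have h3 : ∀ z, Complex.reCLM (conj (grad f z) * grad ψ z + (f z : ℂ) * -(q z : ℂ)) =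
        (conj (grad f z) * grad ψ z).re - f z * q z := by
      intro z
      rw [Complex.reCLM_apply, Complex.add_re, mul_neg, ← Complex.ofReal_mul, Complex.neg_re,
        Complex.ofReal_re]
      ring
    simp only [hq] at h3
    simp only [h3, map_zero] at h2
    rw [integral_sub] at h2
    · linarith
    · exact integrable_disk_of_continuous (Complex.continuous_re.comp (by fun_prop))
    · exact integrable_disk_of_continuous (hfc.mul hqc)
  have hc1 : Continuous fun z => (conj (grad w z) * grad ψ z).re :=
    Complex.continuous_re.comp (by fun_prop)
  have hc2 : Continuous fun z => (conj (grad ψ z) * grad ψ z).re :=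
    Complex.continuous_re.comp (by fun_prop)
  -- Neither application has a boundary term: w is orthogonal to the normal derivative of ψ, and ψ
  -- vanishes on the circle.
  have h1 := green w hw hbd
  have h2 := green ψ hψ (by simp [hψ0])
  -- Young's inequality ab ≤ a²/(8π) + 2πb². The first constant is the one wanted for the energy of
  -- w; the second turns 2π∫|∇ψ|² into 2π∫ψq, matching the pointwise bound on 2πψ.
  have h3 : ∫ z, (conj (grad w z) * grad ψ z).re ∂diskMeasure ≤
      ∫ z, (1 / (8 * π) * ‖grad w z‖ ^ 2 + 2 * π * (conj (grad ψ z) * grad ψ z).re)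
        ∂diskMeasure := by
    refine integral_mono (integrable_disk_of_continuous (by fun_prop))
      (integrable_disk_of_continuous (by fun_prop)) fun z => ?_
    have h4 : (conj (grad w z) * grad ψ z).re ≤ ‖grad w z‖ * ‖grad ψ z‖ := by
      refine (Complex.re_le_norm _).trans (le_of_eq ?_)
      rw [norm_mul, Complex.norm_conj]
    have h5 : (conj (grad ψ z) * grad ψ z).re = ‖grad ψ z‖ ^ 2 := by
      rw [← Complex.normSq_eq_conj_mul_self, Complex.ofReal_re, Complex.normSq_eq_norm_sq]
    simp only [h5]
    refine h4.trans ?_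
    have h6 : 1 / (8 * π) * ‖grad w z‖ ^ 2 + 2 * π * ‖grad ψ z‖ ^ 2 - ‖grad w z‖ * ‖grad ψ z‖ =
        1 / (8 * π) * (‖grad w z‖ - 4 * π * ‖grad ψ z‖) ^ 2 := by
      field_simp
      ring
    have : 0 ≤ 1 / (8 * π) * (‖grad w z‖ - 4 * π * ‖grad ψ z‖) ^ 2 := by positivity
    linarith
  rw [integral_add (integrable_disk_of_continuous (by fun_prop))
    (integrable_disk_of_continuous (by fun_prop)), integral_const_mul, integral_const_mul,
    ← h2] at h3
  set B := (∫ z, q z * Real.log (q z / Real.exp (P.eval z).re) ∂diskMeasure) +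
      Real.log (2 * ∫ z, Real.exp (P.eval z).re ∂diskMeasure) with hB
  -- The pointwise bound on the potential is averaged against the probability density q. The
  -- relative entropy in B will cancel ∫ q Re P - ∫ q log q.
  have h4 : 2 * π * ∫ z, ψ z * q z ∂diskMeasure ≤ B := by
    have h5 : ∫ z, 2 * π * (ψ z * q z) ∂diskMeasure ≤ ∫ z, B * q z ∂diskMeasure := by
      refine setIntegral_mono_on (integrable_disk_of_continuous (by fun_prop))
        (integrable_disk_of_continuous (by fun_prop)) Metric.isOpen_ball.measurableSet
        fun z hz => ?_
      have h6 := potential_le_entropy hψ hψ0 hψq hqc hp0 hp1 P hz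
      have h7 := hp0 z (Metric.ball_subset_closedBall hz)
      calc 2 * π * (ψ z * q z) = (2 * π * ψ z) * q z := by ring
        _ ≤ B * q z := mul_le_mul_of_nonneg_right h6 h7.le
    rw [integral_const_mul, integral_const_mul, hp1, mul_one] at h5
    exact h5
  have hqlog : ContinuousOn (fun z => q z * Real.log (q z)) (Metric.closedBall 0 1) :=
    (Real.continuous_mul_log.comp hqc).continuousOn
  have h5 : ∫ z, q z * Real.log (q z / Real.exp (P.eval z).re) ∂diskMeasure =
      (∫ z, q z * Real.log (q z) ∂diskMeasure) - ∫ z, q z * (P.eval z).re ∂diskMeasure := by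
    rw [← integral_sub (integrable_disk_of_continuousOn hqlog)
      (integrable_disk_of_continuous (by fun_prop))]
    refine setIntegral_congr_fun Metric.isOpen_ball.measurableSet fun z hz => ?_
    rw [Real.log_div (hp0 z (Metric.ball_subset_closedBall hz)).ne' (Real.exp_pos _).ne',
      Real.log_exp]
    ring
  have h6 : Real.log (2 * ∫ z, Real.exp (P.eval z).re ∂diskMeasure) ≤ Real.log (2 * π) +
      ((P.eval 0).re + 1 / (8 * π) * ∫ z, ‖P.derivative.eval z‖ ^ 2 ∂diskMeasure) := by
    rw [← Real.log_exp ((P.eval 0).re + _), ← Real.log_mul (by positivity) (Real.exp_pos _).ne']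
    have hpos : 0 < ∫ z, Real.exp (P.eval z).re ∂diskMeasure :=
      integral_exp_pos (integrable_disk_of_continuous (Real.continuous_exp.comp hPc))
    refine Real.log_le_log (by positivity) ?_
    have := carleman_polynomial P
    linarith
  have h7 := dirichlet_split hu hPN hPo
  have h8 : ∫ z, q z * (u z - Real.log (q z)) ∂diskMeasure =
      (∫ z, w z * q z ∂diskMeasure) + (∫ z, q z * (P.eval z).re ∂diskMeasure) -
        ∫ z, q z * Real.log (q z) ∂diskMeasure := by
    rw [← integral_add (integrable_disk_of_continuous (by fun_prop))
      (integrable_disk_of_continuous (by fun_prop)),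
      ← integral_sub (integrable_disk_of_continuous (by fun_prop))
        (integrable_disk_of_continuousOn hqlog)]
    refine integral_congr_ae (Eventually.of_forall fun z => ?_)
    simp only [hwdef]
    ring
  change ∫ z, q z * (u z - Real.log (q z)) ∂diskMeasure ≤ _
  rw [h8, h7, ← hP0, mul_add]
  rw [h5] at hB
  change _ ≤ 1 / (8 * π) * dirichlet w + _ at h3
  linarith

/-- The sharp entropy inequality on the circle for polynomial densities. -/
theorem entropy_circle {u : ℂ → ℝ} (hu : ContDiff ℝ ∞ u) (p : MvPolynomial (Fin 2) ℂ)
    (hp0 : ∀ z ∈ Metric.closedBall (0 : ℂ) 1, 0 < (zeval p z).re)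
    (hp1 : ∫ θ in (0 : ℝ)..2 * π, (zeval p (circleMap 0 1 θ)).re = 1) :
    ∫ θ in (0 : ℝ)..2 * π, (zeval p (circleMap 0 1 θ)).re *
        (u (circleMap 0 1 θ) - Real.log (zeval p (circleMap 0 1 θ)).re) ≤
      1 / (4 * π) * dirichlet u +
        1 / (2 * π) * (∫ θ in (0 : ℝ)..2 * π, u (circleMap 0 1 θ)) + Real.log (2 * π) := by
  obtain ⟨ψ, N, hψ, hψ0, hψq, hψN⟩ := exists_poisson_solution p
  obtain ⟨P, hPN, hP0, hPo⟩ := exists_harmonic_truncation hu.continuous N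
  set q : ℝ → ℝ := fun θ => (zeval p (circleMap 0 1 θ)).re with hq
  set w : ℂ → ℝ := fun z => u z - (P.eval z).re with hwdef
  have hcm := continuous_circleMap 0 1
  have hqc : Continuous q := Complex.continuous_re.comp ((continuous_zeval p).comp hcm)
  have hPc := continuousOn_re_eval P
  have hw : ContDiff ℝ ∞ w := hu.sub (contDiff_re_eval P)
  have hwc := hw.continuous
  have huc := hu.continuous
  have hpi := pi_pos
  have hq0 : ∀ θ, 0 < q θ := fun θ => hp0 _ (circleMap_mem_closedBall (by simp) θ)
  have hqlog : Continuous fun θ => Real.log (q θ) := hqc.log fun θ => (hq0 θ).ne'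
  -- On the circle w disappears from the pairing with q altogether, so only Gibbs' inequality
  -- between q and e^{Re P}/Z is needed.
  have horth : ∫ θ in (0 : ℝ)..2 * π, w (circleMap 0 1 θ) * q θ = 0 := (hψN w hwc hPo).1
  set Z := ∫ θ in (0 : ℝ)..2 * π, Real.exp (P.eval (circleMap 0 1 θ)).re with hZdef
  have hZ : 0 < Z := intervalIntegral.intervalIntegral_pos_of_pos
    (Continuous.intervalIntegrable (by fun_prop) _ _) (fun θ => Real.exp_pos _) (by positivity)
  have hZle : Real.log Z ≤ Real.log (2 * π) +
      ((P.eval 0).re + 1 / (4 * π) * ∫ z, ‖P.derivative.eval z‖ ^ 2 ∂diskMeasure) := by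
    rw [← Real.log_exp ((P.eval 0).re + _), ← Real.log_mul (by positivity) (Real.exp_pos _).ne']
    exact Real.log_le_log hZ (lebedev_milin_polynomial P)
  have hgibbs : ∫ θ in (0 : ℝ)..2 * π, q θ * (u (circleMap 0 1 θ) - Real.log (q θ)) ≤
      ∫ θ in (0 : ℝ)..2 * π, (w (circleMap 0 1 θ) * q θ + (Real.log Z - 1) * q θ +
        Z⁻¹ * Real.exp (P.eval (circleMap 0 1 θ)).re) := by
    refine intervalIntegral.integral_mono_on (by positivity)
      (Continuous.intervalIntegrable (by fun_prop) _ _)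
      (Continuous.intervalIntegrable (by fun_prop) _ _) fun θ _ => ?_
    have h1 := Real.log_le_sub_one_of_pos
      (x := Real.exp (P.eval (circleMap 0 1 θ)).re * Z⁻¹ / q θ)
      (div_pos (mul_pos (Real.exp_pos _) (inv_pos.2 hZ)) (hq0 θ))
    rw [Real.log_div (mul_pos (Real.exp_pos _) (inv_pos.2 hZ)).ne' (hq0 θ).ne',
      Real.log_mul (Real.exp_pos _).ne' (inv_pos.2 hZ).ne', Real.log_exp, Real.log_inv] at h1
    have h2 := mul_le_mul_of_nonneg_left h1 (hq0 θ).le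
    have h3 : q θ * (Real.exp (P.eval (circleMap 0 1 θ)).re * Z⁻¹ / q θ - 1) =
        Z⁻¹ * Real.exp (P.eval (circleMap 0 1 θ)).re - q θ := by
      have := (hq0 θ).ne'
      field_simp
    rw [h3] at h2
    simp only [hwdef]
    nlinarith
  rw [intervalIntegral.integral_add (Continuous.intervalIntegrable (by fun_prop) _ _)
    (Continuous.intervalIntegrable (by fun_prop) _ _),
    intervalIntegral.integral_add (Continuous.intervalIntegrable (by fun_prop) _ _)
    (Continuous.intervalIntegrable (by fun_prop) _ _), horth, intervalIntegral.integral_const_mul,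
    intervalIntegral.integral_const_mul, hp1, ← hZdef, inv_mul_cancel₀ hZ.ne'] at hgibbs
  have h7 := dirichlet_split hu hPN hPo
  -- The energy of w is simply discarded, unlike in the disk.
  have h8 : 0 ≤ 1 / (4 * π) * dirichlet w := mul_nonneg (by positivity) (dirichlet_nonneg w)
  rw [h7, ← hP0, mul_add]
  linarith

/-- Supplies a nearly optimal density: the supremum of ∫q(u - log q) is attained at q proportional
to e^u. -/
theorem exists_zeval_exp_approx {u : ℂ → ℝ} (hu : Continuous u) {ε : ℝ} (hε : 0 < ε) :
    ∃ p, ∀ z ∈ Metric.closedBall (0 : ℂ) 1,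
      Real.exp (u z) ≤ (zeval p z).re ∧ (zeval p z).re ≤ Real.exp (u z + ε) := by
  obtain ⟨C, hC⟩ := (isCompact_closedBall (0 : ℂ) 1).exists_bound_of_continuousOn hu.continuousOn
  have h1 : 1 < Real.exp ε := Real.one_lt_exp_iff.2 hε
  -- The target is the midpoint of [e^u, e^{u+ε}]; the tolerance lies below half the length of this
  -- interval at every point, as u ≥ -C.
  obtain ⟨p, hp⟩ := exists_zeval_approx (f := fun z => Real.exp (u z) * ((1 + Real.exp ε) / 2))
    (by fun_prop) (ε := Real.exp (-C) * ((Real.exp ε - 1) / 2))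
    (mul_pos (Real.exp_pos _) (by linarith))
  refine ⟨p, fun z hz => ?_⟩
  have h2 := abs_lt.1 (hp z hz)
  have h3 : Real.exp (-C) ≤ Real.exp (u z) := Real.exp_le_exp.2 (abs_le.1 (hC z hz)).1
  have h4 := mul_le_mul_of_nonneg_right h3 (by linarith : 0 ≤ (Real.exp ε - 1) / 2)
  rw [Real.exp_add]
  constructor <;> nlinarith [h2.1, h2.2]

theorem zeval_C_mul_re (c : ℝ) (p : MvPolynomial (Fin 2) ℂ) (z : ℂ) :
    (zeval (MvPolynomial.C (c : ℂ) * p) z).re = c * (zeval p z).re := by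
  simp [zeval]

/-- The sharp Moser–Trudinger inequality on the disk with boundary mean, for smooth functions. -/
theorem integral_exp_disk_le {u : ℂ → ℝ} (hu : ContDiff ℝ ∞ u) :
    ∫ z, Real.exp (u z) ∂diskMeasure ≤ 2 * π * Real.exp (1 / (8 * π) * dirichlet u +
      1 / (2 * π) * ∫ θ in (0 : ℝ)..2 * π, u (circleMap 0 1 θ)) := by
  have huc := hu.continuous
  have hpi := pi_pos
  have hpos : 0 < ∫ z, Real.exp (u z) ∂diskMeasure :=
    integral_exp_pos (integrable_disk_of_continuous (Real.continuous_exp.comp huc))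
  rw [← Real.log_le_log_iff hpos (by positivity), Real.log_mul (by positivity)
    (Real.exp_pos _).ne', Real.log_exp]
  refine le_of_forall_pos_le_add fun ε hε => ?_
  obtain ⟨p, hp⟩ := exists_zeval_exp_approx huc hε
  have hpc : Continuous fun z => (zeval p z).re :=
    Complex.continuous_re.comp (continuous_zeval p)
  set M := ∫ z, (zeval p z).re ∂diskMeasure with hM
  have hM1 : ∫ z, Real.exp (u z) ∂diskMeasure ≤ M :=
    setIntegral_mono_on (integrable_disk_of_continuous (Real.continuous_exp.comp huc))
      (integrable_disk_of_continuous hpc) Metric.isOpen_ball.measurableSet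
      fun z hz => (hp z (Metric.ball_subset_closedBall hz)).1
  have hM0 : 0 < M := hpos.trans_le hM1
  have hp0 : ∀ z ∈ Metric.closedBall (0 : ℂ) 1, 0 < (zeval p z).re :=
    fun z hz => (Real.exp_pos _).trans_le (hp z hz).1
  have h1 := entropy_disk hu (MvPolynomial.C ((M⁻¹ : ℝ) : ℂ) * p)
    (fun z hz => by
      rw [zeval_C_mul_re]
      exact mul_pos (inv_pos.2 hM0) (hp0 z hz))
    (by
      simp only [zeval_C_mul_re]
      rw [integral_const_mul, ← hM, inv_mul_cancel₀ hM0.ne'])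
  simp only [zeval_C_mul_re] at h1
  -- Since p ≤ e^{u+ε}, the density q = p/M satisfies u - log q ≥ log M - ε pointwise.
  have h2 : ∫ z, (Real.log M - ε) * M⁻¹ * (zeval p z).re ∂diskMeasure ≤
      ∫ z, M⁻¹ * (zeval p z).re * (u z - Real.log (M⁻¹ * (zeval p z).re)) ∂diskMeasure := by
    refine setIntegral_mono_on (integrable_disk_of_continuous (by fun_prop)) ?_
      Metric.isOpen_ball.measurableSet fun z hz => ?_
    · refine integrable_disk_of_continuousOn (ContinuousOn.mul (continuous_const.mul hpc).continuousOn
        (huc.continuousOn.sub (ContinuousOn.log (continuous_const.mul hpc).continuousOn fun z hz => ?_)))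
      exact (mul_pos (inv_pos.2 hM0) (hp0 z hz)).ne'
    · have hz' := Metric.ball_subset_closedBall hz
      have h3 := (Real.log_le_log (hp0 z hz') (hp z hz').2)
      rw [Real.log_exp] at h3
      rw [Real.log_mul (inv_pos.2 hM0).ne' (hp0 z hz').ne', Real.log_inv, mul_assoc, mul_comm]
      exact mul_le_mul_of_nonneg_left (by linarith) (mul_pos (inv_pos.2 hM0) (hp0 z hz')).le
  rw [integral_const_mul, ← hM, mul_assoc, inv_mul_cancel₀ hM0.ne', mul_one] at h2
  have h3 := Real.log_le_log hpos hM1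
  linarith

/-- The Lebedev–Milin inequality for smooth functions. -/
theorem integral_exp_circle_le {u : ℂ → ℝ} (hu : ContDiff ℝ ∞ u) :
    ∫ θ in (0 : ℝ)..2 * π, Real.exp (u (circleMap 0 1 θ)) ≤
      2 * π * Real.exp (1 / (4 * π) * dirichlet u +
        1 / (2 * π) * ∫ θ in (0 : ℝ)..2 * π, u (circleMap 0 1 θ)) := by
  have hcm := continuous_circleMap 0 1
  have huc : Continuous fun θ => u (circleMap 0 1 θ) := hu.continuous.comp hcm
  have hpi := pi_pos
  have hpos : 0 < ∫ θ in (0 : ℝ)..2 * π, Real.exp (u (circleMap 0 1 θ)) :=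
    intervalIntegral.intervalIntegral_pos_of_pos
      (Continuous.intervalIntegrable (by fun_prop) _ _) (fun θ => Real.exp_pos _) (by positivity)
  rw [← Real.log_le_log_iff hpos (by positivity), Real.log_mul (by positivity)
    (Real.exp_pos _).ne', Real.log_exp]
  refine le_of_forall_pos_le_add fun ε hε => ?_
  obtain ⟨p, hp⟩ := exists_zeval_exp_approx hu.continuous hε
  have hpc : Continuous fun θ => (zeval p (circleMap 0 1 θ)).re :=
    Complex.continuous_re.comp ((continuous_zeval p).comp hcm)
  have hcb : ∀ θ, circleMap 0 1 θ ∈ Metric.closedBall (0 : ℂ) 1 :=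
    circleMap_mem_closedBall (by simp)
  set M := ∫ θ in (0 : ℝ)..2 * π, (zeval p (circleMap 0 1 θ)).re with hM
  have hM1 : ∫ θ in (0 : ℝ)..2 * π, Real.exp (u (circleMap 0 1 θ)) ≤ M :=
    intervalIntegral.integral_mono_on (by positivity)
      (Continuous.intervalIntegrable (by fun_prop) _ _) (hpc.intervalIntegrable _ _)
      fun θ _ => (hp _ (hcb θ)).1
  have hM0 : 0 < M := hpos.trans_le hM1
  have hp0 : ∀ z ∈ Metric.closedBall (0 : ℂ) 1, 0 < (zeval p z).re :=
    fun z hz => (Real.exp_pos _).trans_le (hp z hz).1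
  have h1 := entropy_circle hu (MvPolynomial.C ((M⁻¹ : ℝ) : ℂ) * p)
    (fun z hz => by
      rw [zeval_C_mul_re]
      exact mul_pos (inv_pos.2 hM0) (hp0 z hz))
    (by
      simp only [zeval_C_mul_re]
      rw [intervalIntegral.integral_const_mul, ← hM, inv_mul_cancel₀ hM0.ne'])
  simp only [zeval_C_mul_re] at h1
  have h2 : ∫ θ in (0 : ℝ)..2 * π, (Real.log M - ε) * M⁻¹ * (zeval p (circleMap 0 1 θ)).re ≤
      ∫ θ in (0 : ℝ)..2 * π, M⁻¹ * (zeval p (circleMap 0 1 θ)).re *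
        (u (circleMap 0 1 θ) - Real.log (M⁻¹ * (zeval p (circleMap 0 1 θ)).re)) := by
    refine intervalIntegral.integral_mono_on (by positivity)
      (Continuous.intervalIntegrable (by fun_prop) _ _) ?_ fun θ _ => ?_
    · refine Continuous.intervalIntegrable (Continuous.mul (by fun_prop)
        (huc.sub (Continuous.log (by fun_prop) fun θ => ?_))) _ _
      exact (mul_pos (inv_pos.2 hM0) (hp0 _ (hcb θ))).ne'
    · have h3 := (Real.log_le_log (hp0 _ (hcb θ)) (hp _ (hcb θ)).2)
      rw [Real.log_exp] at h3
      rw [Real.log_mul (inv_pos.2 hM0).ne' (hp0 _ (hcb θ)).ne', Real.log_inv, mul_assoc, mul_comm]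
      exact mul_le_mul_of_nonneg_left (by linarith) (mul_pos (inv_pos.2 hM0) (hp0 _ (hcb θ))).le
  rw [intervalIntegral.integral_const_mul, ← hM, mul_assoc, inv_mul_cancel₀ hM0.ne', mul_one] at h2
  have h3 := Real.log_le_log hpos hM1
  linarith

/-! ### Mollification and density of smooth functions in H¹. -/

section Mollify

variable {E : Type*} [NormedAddCommGroup E] [NormedSpace ℝ E]

/-- Convolution with a kernel, followed by a dilation of the variable. -/
noncomputable def mollify (ρ : ℂ → ℝ) (t : ℝ) (f : ℂ → E) (z : ℂ) : E :=
  (ρ ⋆[ContinuousLinearMap.lsmul ℝ ℝ, volume] f) (t • z)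

/-- Hölder's inequality for a^{1/2} and a^{1/2}b. With a a kernel of mass 1 it is Jensen's
inequality for the square. -/
theorem sq_lintegral_mul_le {α : Type*} [MeasurableSpace α] {μ : Measure α} {a b : α → ENNReal}
    (ha : AEMeasurable a μ) (hb : AEMeasurable b μ) :
    (∫⁻ x, a x * b x ∂μ) ^ 2 ≤ (∫⁻ x, a x ∂μ) * ∫⁻ x, a x * b x ^ 2 ∂μ := by
  have h := ENNReal.lintegral_mul_le_Lp_mul_Lq μ Real.HolderConjugate.two_two
    (f := fun x => a x ^ (1 / 2 : ℝ)) (g := fun x => a x ^ (1 / 2 : ℝ) * b x)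
    (ha.pow_const _) ((ha.pow_const _).mul hb)
  have h1 : ∀ c : ENNReal, c ^ (1 / 2 : ℝ) * c ^ (1 / 2 : ℝ) = c := by
    intro c
    rw [← ENNReal.rpow_add_of_nonneg _ _ (by norm_num) (by norm_num)]
    norm_num
  have h2 : ∀ c : ENNReal, (c ^ (1 / 2 : ℝ)) ^ (2 : ℝ) = c := by
    intro c
    rw [← ENNReal.rpow_mul]
    norm_num
  have h3 : ∀ x, (a x ^ (1 / 2 : ℝ) * b x) ^ (2 : ℝ) = a x * b x ^ 2 := by
    intro x
    rw [ENNReal.mul_rpow_of_nonneg _ _ (by norm_num), h2]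
    norm_num
  simp only [Pi.mul_apply, ← mul_assoc, h1, h2, h3] at h
  calc (∫⁻ x, a x * b x ∂μ) ^ 2 ≤ _ := pow_le_pow_left' h 2
    _ = _ := by rw [mul_pow, pow_two, h1, pow_two, h1]

/-- The Jacobian t⁻² is at most 4; its square root is the factor 2 in `eLpNorm_mollify_le`. -/
theorem lintegral_dilate {F : ℂ → ENNReal} (hF : Measurable F) {t : ℝ} (ht : 1 / 2 ≤ t) (s : ℂ) :
    ∫⁻ z, F (t • z - s) ≤ 4 * ∫⁻ z, F z := by
  have ht0 : t ≠ 0 := by linarith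
  have h1 : ∫⁻ z, F (t • z - s) = ∫⁻ y, F (y - s) ∂(Measure.map (fun z : ℂ => t • z) volume) := by
    have hm : Measurable fun y => F (y - s) := hF.comp (measurable_id.sub_const s)
    rw [lintegral_map hm (measurable_const_smul t)]
  rw [h1, Measure.map_addHaar_smul volume ht0, lintegral_smul_measure,
    lintegral_sub_right_eq_self F s, smul_eq_mul]
  gcongr
  rw [Complex.finrank_real_complex]
  have : |(t ^ 2)⁻¹| ≤ 4 := by
    rw [abs_of_nonneg (by positivity), inv_le_comm₀ (by positivity) (by norm_num)]
    nlinarith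
  calc ENNReal.ofReal |(t ^ 2)⁻¹| ≤ ENNReal.ofReal 4 := ENNReal.ofReal_le_ofReal this
    _ = 4 := by norm_num

/-- The bound is uniform in the kernel and the dilation, so convergence only has to be checked on a
dense class. -/
theorem eLpNorm_mollify_le {ρ : ℂ → ℝ} (hρ : Continuous ρ) (hρ0 : ∀ x, 0 ≤ ρ x)
    (hρ1 : ∫ x, ρ x = 1) {t : ℝ} (ht : 1 / 2 ≤ t) {f : ℂ → E} (hf : StronglyMeasurable f) :
    eLpNorm (mollify ρ t f) 2 volume ≤ 2 * eLpNorm f 2 volume := by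
  have hρl : ∫⁻ x, ‖ρ x‖ₑ = 1 := by
    have h1 := integrable_of_integral_eq_one hρ1
    have h2 := ofReal_integral_norm_eq_lintegral_enorm h1
    rw [← h2]
    simp [abs_of_nonneg (hρ0 _), hρ1]
  have hm1 : Measurable fun p : ℂ × ℂ => ‖f (t • p.1 - p.2)‖ₑ :=
    hf.enorm.comp (by fun_prop)
  have hρm : Measurable fun x => ‖ρ x‖ₑ := hρ.measurable.enorm
  have hpt : ∀ z, ‖mollify ρ t f z‖ₑ ^ 2 ≤ ∫⁻ s, ‖ρ s‖ₑ * ‖f (t • z - s)‖ₑ ^ 2 := by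
    intro z
    have h1 : ‖mollify ρ t f z‖ₑ ≤ ∫⁻ s, ‖ρ s‖ₑ * ‖f (t • z - s)‖ₑ := by
      refine (enorm_integral_le_lintegral_enorm _).trans (le_of_eq ?_)
      refine lintegral_congr fun s => ?_
      rw [ContinuousLinearMap.lsmul_apply, enorm_smul]
    refine (pow_le_pow_left' h1 2).trans ?_
    refine (sq_lintegral_mul_le hρm.aemeasurable
      (hm1.comp (measurable_const.prodMk measurable_id)).aemeasurable).trans ?_
    rw [hρl, one_mul]
    exact le_rfl
  have hsq : ∫⁻ z, ‖mollify ρ t f z‖ₑ ^ 2 ≤ 4 * ∫⁻ z, ‖f z‖ₑ ^ 2 := by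
    refine (lintegral_mono hpt).trans ?_
    rw [lintegral_lintegral_swap]
    · calc ∫⁻ s, ∫⁻ z, ‖ρ s‖ₑ * ‖f (t • z - s)‖ₑ ^ 2
          ≤ ∫⁻ s, ‖ρ s‖ₑ * (4 * ∫⁻ z, ‖f z‖ₑ ^ 2) := by
            refine lintegral_mono fun s => ?_
            have hm : Measurable fun z => ‖f (t • z - s)‖ₑ ^ 2 :=
              (hm1.comp (measurable_id.prodMk measurable_const)).pow_const 2
            rw [lintegral_const_mul _ hm]
            gcongr
            exact lintegral_dilate (F := fun z => ‖f z‖ₑ ^ 2) (hf.enorm.pow_const 2) ht s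
        _ = _ := by rw [lintegral_mul_const _ hρm, hρl, one_mul]
    · exact (((hρm.comp measurable_snd).mul (hm1.pow_const 2))).aemeasurable
  have e : ∀ g : ℂ → E, eLpNorm g 2 volume = (∫⁻ z, ‖g z‖ₑ ^ 2) ^ (1 / 2 : ℝ) := by
    intro g
    rw [eLpNorm_eq_lintegral_rpow_enorm_toReal (by norm_num) (by norm_num)]
    simp
  rw [e, e]
  calc (∫⁻ z, ‖mollify ρ t f z‖ₑ ^ 2) ^ (1 / 2 : ℝ)
      ≤ (4 * ∫⁻ z, ‖f z‖ₑ ^ 2) ^ (1 / 2 : ℝ) := ENNReal.rpow_le_rpow hsq (by norm_num)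
    _ = _ := by
      rw [ENNReal.mul_rpow_of_nonneg _ _ (by norm_num)]
      congr 1
      rw [show (4 : ENNReal) = 2 ^ (2 : ℝ) by norm_num, ← ENNReal.rpow_mul]
      norm_num

/-- Approximate f in L² by a compactly supported continuous g. Uniform continuity gives uniform
convergence for g on the disk, and `eLpNorm_mollify_le` controls f - g. -/
theorem tendsto_mollify [CompleteSpace E] {ρ : ℕ → ℂ → ℝ} {t r : ℕ → ℝ} (hρ : ∀ n, Continuous (ρ n))
    (hρ0 : ∀ n x, 0 ≤ ρ n x) (hρ1 : ∀ n, ∫ x, ρ n x = 1)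
    (hsupp : ∀ n, Function.support (ρ n) ⊆ Metric.ball 0 (r n))
    (ht : ∀ n, 1 / 2 ≤ t n) (ht1 : Tendsto t atTop (𝓝 1)) (hr : Tendsto r atTop (𝓝 0))
    {f : ℂ → E} (hf : StronglyMeasurable f) (hf2 : MemLp f 2 volume) :
    Tendsto (fun n => eLpNorm (mollify (ρ n) (t n) f - f) 2 diskMeasure) atTop (𝓝 0) := by
  have hcs : ∀ n, HasCompactSupport (ρ n) := fun n =>
    HasCompactSupport.of_support_subset_isCompact (isCompact_closedBall 0 (r n))
      ((hsupp n).trans Metric.ball_subset_closedBall)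
  rw [ENNReal.tendsto_nhds_zero]
  intro δ hδ
  have hδ4 : δ / 6 ≠ 0 := by simpa using hδ.ne'
  obtain ⟨g, hgc, hfg, hgcont, hg2⟩ :=
    hf2.exists_hasCompactSupport_eLpNorm_sub_le (by norm_num) hδ4
  have hhm : StronglyMeasurable (f - g) := hf.sub hgcont.stronglyMeasurable
  have hlf : LocallyIntegrable f volume := hf2.locallyIntegrable (by norm_num)
  have hlg : LocallyIntegrable g volume := hg2.locallyIntegrable (by norm_num)
  obtain ⟨C, hC0, hC⟩ : ∃ C : ℝ, 0 < C ∧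
      (diskMeasure univ) ^ ((2 : ENNReal).toReal⁻¹) * ENNReal.ofReal C ≤ δ / 6 := by
    have hfin : (diskMeasure univ) ^ ((2 : ENNReal).toReal⁻¹) ≠ ⊤ :=
      ENNReal.rpow_ne_top_of_nonneg (by norm_num) (measure_ne_top _ _)
    have hlim : Tendsto (fun C : ℝ => (diskMeasure univ) ^ ((2 : ENNReal).toReal⁻¹) *
        ENNReal.ofReal C) (𝓝[>] 0) (𝓝 0) := by
      have : Tendsto (fun C : ℝ => ENNReal.ofReal C) (𝓝[>] 0) (𝓝 0) := by
        have := (ENNReal.continuous_ofReal.tendsto 0).mono_left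
          (nhdsWithin_le_nhds (s := Ioi (0 : ℝ)))
        simpa using this
      simpa using ENNReal.Tendsto.const_mul this (Or.inr hfin)
    have h2 := (ENNReal.tendsto_nhds_zero.1 hlim (δ / 6) (pos_iff_ne_zero.2 hδ4)).and
      self_mem_nhdsWithin
    obtain ⟨C, h3, h4⟩ := h2.exists
    exact ⟨C, h4, h3⟩
  have huc := hgc.uniformContinuous_of_continuous hgcont
  obtain ⟨η, hη, hηg⟩ := Metric.uniformContinuous_iff.1 huc C hC0
  have hev : ∀ᶠ n in atTop, |t n - 1| + r n < η := by
    have h1 : Tendsto (fun n => |t n - 1| + r n) atTop (𝓝 0) := by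
      simpa using ((ht1.sub_const 1).abs).add hr
    exact h1.eventually (gt_mem_nhds hη)
  filter_upwards [hev] with n hn
  have hdist : ∀ z ∈ disk, ‖mollify (ρ n) (t n) g z - g z‖ ≤ C := by
    intro z hz
    have hz' : ‖z‖ < 1 := by simpa [disk] using hz
    rw [← dist_eq_norm]
    refine dist_convolution_le hC0.le (hsupp n) (hρ0 n) (hρ1 n) hgcont.aestronglyMeasurable
      fun y hy => (hηg ?_).le
    rw [Metric.mem_ball] at hy
    calc dist y z ≤ dist y (t n • z) + dist (t n • z) z := dist_triangle _ _ _
      _ ≤ dist y (t n • z) + |t n - 1| := by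
        gcongr
        rw [dist_eq_norm, show t n • z - z = (t n - 1) • z by rw [sub_smul, one_smul], norm_smul,
          Real.norm_eq_abs]
        exact mul_le_of_le_one_right (abs_nonneg _) hz'.le
      _ < η := by linarith
  have hlin : mollify (ρ n) (t n) f = mollify (ρ n) (t n) (f - g) + mollify (ρ n) (t n) g := by
    ext z
    simp only [mollify, Pi.add_apply]
    rw [← (((hcs n).convolutionExists_left _ (hρ n) (hlf.sub hlg) _).distrib_add
      ((hcs n).convolutionExists_left _ (hρ n) hlg _))]
    simp
  have hae : AEStronglyMeasurable (mollify (ρ n) (t n) (f - g)) diskMeasure := by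
    have : Continuous (mollify (ρ n) (t n) (f - g)) :=
      ((hcs n).continuous_convolution_left _ (hρ n) (hlf.sub hlg)).comp (continuous_const_smul (t n))
    exact this.aestronglyMeasurable
  have hae2 : AEStronglyMeasurable (mollify (ρ n) (t n) g) diskMeasure := by
    have : Continuous (mollify (ρ n) (t n) g) :=
      ((hcs n).continuous_convolution_left _ (hρ n) hlg).comp (continuous_const_smul (t n))
    exact this.aestronglyMeasurable
  have hdec : mollify (ρ n) (t n) f - f =
      mollify (ρ n) (t n) (f - g) + ((mollify (ρ n) (t n) g - g) - (f - g)) := by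
    rw [hlin]; abel
  have hle : diskMeasure ≤ volume := Measure.restrict_le_self
  rw [hdec]
  calc _ ≤ eLpNorm (mollify (ρ n) (t n) (f - g)) 2 diskMeasure +
        eLpNorm ((mollify (ρ n) (t n) g - g) - (f - g)) 2 diskMeasure :=
        eLpNorm_add_le hae ((hae2.sub hgcont.aestronglyMeasurable).sub hhm.aestronglyMeasurable)
          (by norm_num)
    _ ≤ 2 * eLpNorm (f - g) 2 volume + (eLpNorm (mollify (ρ n) (t n) g - g) 2 diskMeasure +
        eLpNorm (f - g) 2 diskMeasure) := by
        gcongr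
        · exact (eLpNorm_mono_measure _ hle).trans
            (eLpNorm_mollify_le (hρ n) (hρ0 n) (hρ1 n) (ht n) hhm)
        · exact eLpNorm_sub_le (hae2.sub hgcont.aestronglyMeasurable) hhm.aestronglyMeasurable
            (by norm_num)
    _ ≤ 2 * (δ / 6) + (δ / 6 + δ / 6) := by
        gcongr
        · refine (eLpNorm_le_of_ae_bound (C := C) ?_).trans hC
          exact ae_restrict_of_forall_mem Metric.isOpen_ball.measurableSet hdist
        · exact (eLpNorm_mono_measure _ hle).trans hfg
    _ = 4 * (δ / 6) := by ring
    _ ≤ 6 * (δ / 6) := by gcongr; norm_num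
    _ = δ := ENNReal.mul_div_cancel (by norm_num) (by norm_num)

end Mollify

/-- The gradient of a mollified function is the mollified weak gradient. -/
theorem grad_convolution {u : ℂ → ℝ} {G : ℂ → ℂ} (h : IsWeakGradient u G) {U : ℂ → ℝ} {V : ℂ → ℂ}
    (hU : ∀ᵐ z ∂diskMeasure, U z = u z) (hU0 : ∀ z ∉ disk, U z = 0)
    (hV : ∀ᵐ z ∂diskMeasure, V z = G z) (hV0 : ∀ z ∉ disk, V z = 0)
    (hUl : LocallyIntegrable U volume) {ρ : ℂ → ℝ} (hρ : ContDiff ℝ ∞ ρ) {r : ℝ}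
    (hsupp : Function.support ρ ⊆ Metric.ball 0 r) {x : ℂ} (hx : Metric.closedBall x r ⊆ disk) :
    grad (ρ ⋆[ContinuousLinearMap.lsmul ℝ ℝ, volume] U) x =
      (ρ ⋆[ContinuousLinearMap.lsmul ℝ ℝ, volume] V) x := by
  have hd : MeasurableSet disk := Metric.isOpen_ball.measurableSet
  have hcs : HasCompactSupport ρ := HasCompactSupport.of_support_subset_isCompact
    (isCompact_closedBall 0 r) (hsupp.trans Metric.ball_subset_closedBall)
  have hρ1 : ContDiff ℝ 1 ρ := hρ.of_le (by exact_mod_cast le_top)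
  have hρd := hρ1.differentiable one_ne_zero
  have hfd : ∀ v : ℂ, fderiv ℝ (ρ ⋆[ContinuousLinearMap.lsmul ℝ ℝ, volume] U) x v =
      ∫ y, U y * fderiv ℝ ρ (x - y) v := by
    intro v
    rw [← convolution_flip,
      (hcs.hasFDerivAt_convolution_right (ContinuousLinearMap.lsmul ℝ ℝ).flip hUl hρ1 x).fderiv,
      convolution_precompR_apply _ hUl (hcs.fderiv ℝ) (hρ1.continuous_fderiv one_ne_zero)]
    simp only [convolution_def, ContinuousLinearMap.flip_apply, ContinuousLinearMap.lsmul_apply,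
      smul_eq_mul, mul_comm]
  have hint : ∀ v : ℂ, Integrable (fun y => U y * fderiv ℝ ρ (x - y) v) volume := by
    intro v
    have h1 : HasCompactSupport fun y => fderiv ℝ ρ y v :=
      (hcs.fderiv ℝ).comp_left (g := fun L : ℂ →L[ℝ] ℝ => L v) rfl
    have h2 := h1.convolutionExists_right (ContinuousLinearMap.lsmul ℝ ℝ) hUl
      ((hρ1.continuous_fderiv one_ne_zero).clm_apply continuous_const) x
    exact h2
  have hgrad : grad (ρ ⋆[ContinuousLinearMap.lsmul ℝ ℝ, volume] U) x =
      ∫ y, U y • grad ρ (x - y) := by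
    rw [grad, hfd, hfd, ← integral_complex_ofReal, ← integral_complex_ofReal,
      ← integral_mul_const, ← integral_add (hint 1).ofReal ((hint Complex.I).ofReal.mul_const _)]
    refine integral_congr_ae (Eventually.of_forall fun y => ?_)
    simp only [grad]
    push_cast
    rw [Complex.real_smul]
    ring
  -- The test function is the reflected and translated kernel, admissible because its support lies
  -- in the closed ball inside the disk. The minus sign of its gradient cancels the one from
  -- integration by parts.
  have hζ : ContDiff ℝ ∞ fun y => ρ (x - y) := hρ.comp (contDiff_const.sub contDiff_id)
  have hζs : Function.support (fun y => ρ (x - y)) ⊆ Metric.closedBall x r := by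
    intro y hy
    have := hsupp (show x - y ∈ Function.support ρ from hy)
    rw [mem_ball_zero_iff, ← dist_eq_norm] at this
    rw [Metric.mem_closedBall, dist_comm]
    exact this.le
  have hζg : ∀ y, grad (fun y => ρ (x - y)) y = - grad ρ (x - y) := by
    intro y
    have h1 : HasFDerivAt (fun y => ρ (x - y)) _ y :=
      (hρd (x - y)).hasFDerivAt.comp y ((hasFDerivAt_id y).const_sub x)
    rw [grad, h1.fderiv]
    simp [grad]
    ring
  have hw := h.integral_eq _ hζ (HasCompactSupport.of_support_subset_isCompact
    (isCompact_closedBall x r) hζs) ((closure_minimal hζs Metric.isClosed_closedBall).trans hx)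
  simp only [hζg, smul_neg, integral_neg, neg_inj] at hw
  have h1 : ∫ y, U y • grad ρ (x - y) = ∫ y, u y • grad ρ (x - y) ∂diskMeasure := by
    rw [← setIntegral_eq_integral_of_forall_compl_eq_zero (s := disk)
      (fun y hy => by rw [hU0 y hy, zero_smul])]
    exact integral_congr_ae (by filter_upwards [hU] with y hy; rw [hy])
  have h2 : ∫ y, ρ (x - y) • V y = ∫ y, ρ (x - y) • G y ∂diskMeasure := by
    rw [← setIntegral_eq_integral_of_forall_compl_eq_zero (s := disk)
      (fun y hy => by rw [hV0 y hy, smul_zero])]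
    exact integral_congr_ae (by filter_upwards [hV] with y hy; rw [hy])
  rw [hgrad, h1, hw, ← h2, convolution_eq_swap]
  simp only [ContinuousLinearMap.lsmul_apply]

/-- Extension by zero of a strongly measurable representative, so that convolutions over the whole
plane are available. -/
theorem memLp_indicator_mk {E : Type*} [NormedAddCommGroup E] {f : ℂ → E}
    (hf : MemLp f 2 diskMeasure) :
    StronglyMeasurable (disk.indicator (hf.1.mk f)) ∧
      MemLp (disk.indicator (hf.1.mk f)) 2 volume ∧
      (∀ᵐ z ∂diskMeasure, disk.indicator (hf.1.mk f) z = f z) ∧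
      ∀ z ∉ disk, disk.indicator (hf.1.mk f) z = 0 := by
  have hd : MeasurableSet disk := Metric.isOpen_ball.measurableSet
  refine ⟨hf.1.stronglyMeasurable_mk.indicator hd, ?_, ?_, fun z hz => indicator_of_notMem hz _⟩
  · rw [memLp_indicator_iff_restrict hd]
    exact hf.ae_eq hf.1.ae_eq_mk
  · filter_upwards [hf.1.ae_eq_mk, ae_restrict_mem hd] with z h1 h2
    rw [indicator_of_mem h2, h1]

/-- Functions smooth up to the boundary are dense in `H¹` of the disk. -/
theorem exists_smooth_approx {u : ℂ → ℝ} {G : ℂ → ℂ} (hu : MemLp u 2 diskMeasure)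
    (h : IsWeakGradient u G) : ∃ φ : ℕ → ℂ → ℝ, (∀ n, ContDiff ℝ ∞ (φ n)) ∧
      Tendsto (fun n => eLpNorm (φ n - u) 2 diskMeasure) atTop (𝓝 0) ∧
      Tendsto (fun n => eLpNorm (grad (φ n) - G) 2 diskMeasure) atTop (𝓝 0) := by
  obtain ⟨hUm, hU2, hUae, hU0⟩ := memLp_indicator_mk hu
  obtain ⟨hVm, hV2, hVae, hV0⟩ := memLp_indicator_mk h.memLp
  set U := disk.indicator (hu.1.mk u)
  set V := disk.indicator (h.memLp.1.mk G)
  have hUl : LocallyIntegrable U volume := hU2.locallyIntegrable (by norm_num)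
  have hVl : LocallyIntegrable V volume := hV2.locallyIntegrable (by norm_num)
  set r : ℕ → ℝ := fun n => 1 / 4 * (1 / ((n : ℝ) + 1)) with hrdef
  have hr0 : ∀ n, 0 < r n := fun n => by positivity
  have hr4 : ∀ n, r n ≤ 1 / 4 := fun n => by
    have : (1 : ℝ) / ((n : ℝ) + 1) ≤ 1 := by
      rw [div_le_one (by positivity)]
      linarith [(n.cast_nonneg : (0 : ℝ) ≤ n)]
    simp only [hrdef]
    linarith
  have hrt : Tendsto r atTop (𝓝 0) := by
    have := (tendsto_one_div_add_atTop_nhds_zero_nat (𝕜 := ℝ)).const_mul (1 / 4)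
    rwa [mul_zero] at this
  -- The dilated point has modulus below 1 - 2r, so the kernel of radius r around it never reaches
  -- the boundary, where the extension by zero may jump.
  set t : ℕ → ℝ := fun n => 1 - 2 * r n with htdef
  have ht : ∀ n, 1 / 2 ≤ t n := fun n => by simp only [htdef]; linarith [hr4 n]
  have htt : Tendsto t atTop (𝓝 1) := by simpa using (hrt.const_mul 2).const_sub 1
  let β : ℕ → ContDiffBump (0 : ℂ) := fun n => ⟨r n / 2, r n, by linarith [hr0 n], by linarith [hr0 n]⟩
  set ρ : ℕ → ℂ → ℝ := fun n => (β n).normed volume with hρdef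
  have hρc : ∀ n, ContDiff ℝ ∞ (ρ n) := fun n => (β n).contDiff_normed
  have hρ0 : ∀ n x, 0 ≤ ρ n x := fun n => (β n).nonneg_normed
  have hρ1 : ∀ n, ∫ x, ρ n x = 1 := fun n => (β n).integral_normed
  have hsupp : ∀ n, Function.support (ρ n) ⊆ Metric.ball 0 (r n) := fun n =>
    ((β n).support_normed_eq).subset
  have hcs : ∀ n, HasCompactSupport (ρ n) := fun n => (β n).hasCompactSupport_normed
  have hC : ∀ n, ContDiff ℝ ∞ (ρ n ⋆[ContinuousLinearMap.lsmul ℝ ℝ, volume] U) := fun n =>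
    (hcs n).contDiff_convolution_left (n := ⊤) _ (hρc n) hUl
  refine ⟨fun n => mollify (ρ n) (t n) U, fun n => (hC n).comp (contDiff_id.const_smul (t n)),
    ?_, ?_⟩
  · refine (tendsto_mollify (fun n => (hρc n).continuous) hρ0 hρ1 hsupp ht htt hrt hUm
      hU2).congr fun n => eLpNorm_congr_ae ?_
    filter_upwards [hUae] with z hz
    simp [hz]
  · have h1 := tendsto_mollify (fun n => (hρc n).continuous) hρ0 hρ1 hsupp ht htt hrt hVm hV2
    have hgr : ∀ n, ∀ z ∈ disk, grad (mollify (ρ n) (t n) U) z =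
        (t n : ℝ) • mollify (ρ n) (t n) V z := by
      intro n z hz
      have hz' : ‖z‖ < 1 := by simpa [disk] using hz
      have hT : HasDerivAt (fun z : ℂ => t n • z) (t n : ℂ) z := by
        simpa only [Complex.real_smul, id, mul_one] using
          (hasDerivAt_id z).const_mul (t n : ℂ)
      have h2 := grad_comp (T := fun z => t n • z)
        (differentiable_of_contDiff_infty (hC n) _) hT
      have hsub : Metric.closedBall (t n • z) (r n) ⊆ disk := by
        intro y hy
        simp only [disk, mem_ball_zero_iff]
        have h3 : ‖y‖ ≤ ‖t n • z‖ + r n := by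
          have h5 := norm_le_norm_add_norm_sub' y (t n • z)
          have h4 := hy
          rw [Metric.mem_closedBall, dist_eq_norm] at h4
          linarith
        rw [norm_smul, Real.norm_of_nonneg (by linarith [ht n])] at h3
        have h6 : t n * ‖z‖ ≤ t n * 1 := mul_le_mul_of_nonneg_left hz'.le (by linarith [ht n])
        have h7 : t n = 1 - 2 * r n := rfl
        linarith [hr0 n]
      change grad (fun z => (ρ n ⋆[ContinuousLinearMap.lsmul ℝ ℝ, volume] U) (t n • z)) z = _
      rw [h2, grad_convolution h hUae hU0 hVae hV0 hUl (hρc n) (hsupp n) hsub,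
        Complex.conj_ofReal, mollify]
      exact (Complex.real_smul).symm
    have hVd : MemLp V 2 diskMeasure := hV2.restrict disk
    have hbound : ∀ n, eLpNorm (grad (mollify (ρ n) (t n) U) - G) 2 diskMeasure ≤
        eLpNorm (mollify (ρ n) (t n) V - V) 2 diskMeasure +
          ENNReal.ofReal |t n - 1| * eLpNorm V 2 diskMeasure := by
      intro n
      have hmc : Continuous (mollify (ρ n) (t n) V) :=
        ((hcs n).continuous_convolution_left _ (hρc n).continuous hVl).comp
          (continuous_const_smul (t n))
      have he : grad (mollify (ρ n) (t n) U) - G =ᵐ[diskMeasure]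
          t n • (mollify (ρ n) (t n) V - V) + (t n - 1) • V := by
        filter_upwards [hVae, ae_restrict_mem Metric.isOpen_ball.measurableSet] with z hz hzd
        simp only [Pi.sub_apply, Pi.add_apply, Pi.smul_apply]
        rw [hgr n z hzd, ← hz]
        simp only [Complex.real_smul, Complex.ofReal_sub, Complex.ofReal_one]
        ring
      rw [eLpNorm_congr_ae he]
      refine (eLpNorm_add_le ((hmc.aestronglyMeasurable.sub hVd.1).const_smul _)
        (hVd.1.const_smul _) (by norm_num)).trans ?_
      rw [eLpNorm_const_smul, eLpNorm_const_smul, ← ofReal_norm, ← ofReal_norm, Real.norm_eq_abs,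
        Real.norm_eq_abs]
      gcongr
      refine mul_le_of_le_one_left' ?_
      rw [ENNReal.ofReal_le_one, abs_of_nonneg (by linarith [ht n])]
      simp only [htdef]
      linarith [hr0 n]
    refine tendsto_of_tendsto_of_tendsto_of_le_of_le tendsto_const_nhds ?_ (fun _ => zero_le)
      hbound
    have h2 : Tendsto (fun n => ENNReal.ofReal |t n - 1|) atTop (𝓝 0) := by
      have := (ENNReal.continuous_ofReal.tendsto 0).comp
        (show Tendsto (fun n => |t n - 1|) atTop (𝓝 0) by simpa using (htt.sub_const 1).abs)
      simpa [Function.comp_def] using this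
    simpa using h1.add (ENNReal.Tendsto.mul_const h2 (Or.inr hVd.2.ne))

/-! ### The circle measure, limits in L² and boundary traces. -/

instance isFiniteMeasure_circleMeasure : IsFiniteMeasure circleMeasure := by
  unfold circleMeasure
  infer_instance

theorem ae_circleMeasure_mem_sphere : ∀ᵐ z ∂circleMeasure, z ∈ Metric.sphere (0 : ℂ) 1 := by
  exact (ae_map_iff (p := fun z => z ∈ Metric.sphere (0 : ℂ) 1)
    (continuous_circleMap 0 1).aemeasurable Metric.isClosed_sphere.measurableSet).2
    (Eventually.of_forall fun θ => circleMap_mem_sphere 0 zero_le_one θ)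

theorem integral_circleMeasure {E : Type*} [NormedAddCommGroup E] [NormedSpace ℝ E]
    {f : ℂ → E} (hf : Continuous f) :
    ∫ z, f z ∂circleMeasure = ∫ θ in (0 : ℝ)..2 * π, f (circleMap 0 1 θ) := by
  rw [circleMeasure, integral_map (continuous_circleMap 0 1).aemeasurable
    hf.stronglyMeasurable.aestronglyMeasurable, intervalIntegral.integral_of_le (by positivity)]

theorem integrable_circle_of_continuous {f : ℂ → ℝ} (hf : Continuous f) :
    Integrable f circleMeasure := by
  obtain ⟨C, hC⟩ := (isCompact_sphere (0 : ℂ) 1).exists_bound_of_continuousOn hf.continuousOn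
  exact Integrable.of_bound hf.aestronglyMeasurable C
    (ae_circleMeasure_mem_sphere.mono fun z hz => hC z hz)

theorem memLp_circle_of_continuous {f : ℂ → ℝ} (hf : Continuous f) : MemLp f 2 circleMeasure := by
  obtain ⟨C, hC⟩ := (isCompact_sphere (0 : ℂ) 1).exists_bound_of_continuousOn hf.continuousOn
  exact MemLp.of_bound hf.aestronglyMeasurable C
    (ae_circleMeasure_mem_sphere.mono fun z hz => hC z hz)

theorem memLp_disk_of_continuous {E : Type*} [NormedAddCommGroup E] {f : ℂ → E}
    [SecondCountableTopology E] (hf : Continuous f) : MemLp f 2 diskMeasure := by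
  obtain ⟨C, hC⟩ := (isCompact_closedBall (0 : ℂ) 1).exists_bound_of_continuousOn hf.continuousOn
  refine MemLp.of_bound hf.aestronglyMeasurable C ?_
  exact ae_restrict_of_forall_mem Metric.isOpen_ball.measurableSet
    fun z hz => hC z (Metric.ball_subset_closedBall hz)

section General

variable {α E : Type*} [MeasurableSpace α] {μ : Measure α} [NormedAddCommGroup E]

theorem integral_norm_sq_eq {f : α → E} (hf : MemLp f 2 μ) :
    ∫ x, ‖f x‖ ^ 2 ∂μ = (eLpNorm f 2 μ).toReal ^ 2 := by
  have h0 : 0 ≤ ∫ x, ‖f x‖ ^ 2 ∂μ := integral_nonneg fun _ => by positivity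
  rw [hf.eLpNorm_eq_integral_rpow_norm (by norm_num) (by norm_num), ENNReal.toReal_ofReal
    (by positivity)]
  simp only [ENNReal.toReal_ofNat, Real.rpow_ofNat]
  rw [← Real.rpow_natCast, ← Real.rpow_mul h0]
  norm_num

theorem tendsto_integral_norm_sq {F : ℕ → α → E} {f : α → E} (hF : ∀ n, MemLp (F n) 2 μ)
    (hf : MemLp f 2 μ) (h : Tendsto (fun n => eLpNorm (F n - f) 2 μ) atTop (𝓝 0)) :
    Tendsto (fun n => ∫ x, ‖F n x‖ ^ 2 ∂μ) atTop (𝓝 (∫ x, ‖f x‖ ^ 2 ∂μ)) := by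
  have : Fact ((1 : ENNReal) ≤ 2) := ⟨by norm_num⟩
  have h1 := ((Lp.tendsto_Lp_iff_tendsto_eLpNorm'' F hF f hf).2 h).norm.pow 2
  simp only [Lp.norm_toLp] at h1
  rw [integral_norm_sq_eq hf]
  exact h1.congr fun n => (integral_norm_sq_eq (hF n)).symm

theorem tendsto_integral_of_eLpNorm_two [IsFiniteMeasure μ] {F : ℕ → α → ℝ} {f : α → ℝ}
    (hF : ∀ n, MemLp (F n) 2 μ) (hf : MemLp f 2 μ)
    (h : Tendsto (fun n => eLpNorm (F n - f) 2 μ) atTop (𝓝 0)) :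
    Tendsto (fun n => ∫ x, F n x ∂μ) atTop (𝓝 (∫ x, f x ∂μ)) := by
  refine tendsto_integral_of_L1' f hf.1
    (Eventually.of_forall fun n => (hF n).integrable (by norm_num)) ?_
  have hc : μ univ ^ (1 / (1 : ENNReal).toReal - 1 / (2 : ENNReal).toReal) ≠ ⊤ :=
    ENNReal.rpow_ne_top_of_nonneg (by norm_num) (measure_ne_top _ _)
  have h1 := ENNReal.Tendsto.mul_const h (Or.inr hc)
  rw [zero_mul] at h1
  exact tendsto_of_tendsto_of_tendsto_of_le_of_le tendsto_const_nhds h1 (fun _ => zero_le)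
    fun n => eLpNorm_le_eLpNorm_mul_rpow_measure_univ (by norm_num) ((hF n).1.sub hf.1)

/-- Fatou's lemma for exponentials of functions converging in `L²`. -/
theorem integrable_exp_of_tendsto {F : ℕ → α → ℝ} {f : α → ℝ}
    (hF : ∀ n, AEStronglyMeasurable (F n) μ) (hf : AEStronglyMeasurable f μ)
    (h : Tendsto (fun n => eLpNorm (F n - f) 2 μ) atTop (𝓝 0))
    (hi : ∀ n, Integrable (fun x => exp (F n x)) μ) {B : ℕ → ℝ} {b : ℝ}
    (hB : ∀ n, ∫ x, exp (F n x) ∂μ ≤ B n) (hb : Tendsto B atTop (𝓝 b)) :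
    Integrable (fun x => exp (f x)) μ ∧ ∫ x, exp (f x) ∂μ ≤ b := by
  obtain ⟨ns, hns, hae⟩ := (tendstoInMeasure_of_tendsto_eLpNorm (by norm_num) hF hf
    h).exists_seq_tendsto_ae
  have hb0 : 0 ≤ b := ge_of_tendsto' hb fun n =>
    (integral_nonneg fun _ => (exp_pos _).le).trans (hB n)
  have hm : AEStronglyMeasurable (fun x => exp (f x)) μ :=
    continuous_exp.comp_aestronglyMeasurable hf
  have hle : ∫⁻ x, ENNReal.ofReal (exp (f x)) ∂μ ≤ ENNReal.ofReal b := by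
    calc ∫⁻ x, ENNReal.ofReal (exp (f x)) ∂μ
        = ∫⁻ x, liminf (fun n => ENNReal.ofReal (exp (F (ns n) x))) atTop ∂μ := by
          refine lintegral_congr_ae (hae.mono fun x hx => ?_)
          exact ((ENNReal.continuous_ofReal.comp continuous_exp).tendsto _ |>.comp hx).liminf_eq.symm
      _ ≤ liminf (fun n => ∫⁻ x, ENNReal.ofReal (exp (F (ns n) x)) ∂μ) atTop :=
          lintegral_liminf_le' fun n =>
            (continuous_exp.comp_aestronglyMeasurable (hF (ns n))).aemeasurable.ennreal_ofReal
      _ ≤ liminf (fun n => ENNReal.ofReal (B (ns n))) atTop := by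
          refine liminf_le_liminf (Eventually.of_forall fun n => ?_)
          rw [← ofReal_integral_eq_lintegral_ofReal (hi _)
            (Eventually.of_forall fun _ => (exp_pos _).le)]
          exact ENNReal.ofReal_le_ofReal (hB _)
      _ = ENNReal.ofReal b :=
          ((ENNReal.continuous_ofReal.tendsto b).comp (hb.comp hns.tendsto_atTop)).liminf_eq
  have hI : Integrable (fun x => exp (f x)) μ := by
    refine ⟨hm, ?_⟩
    rw [hasFiniteIntegral_iff_ofReal (Eventually.of_forall fun _ => (exp_pos _).le)]
    exact hle.trans_lt ENNReal.ofReal_lt_top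
  refine ⟨hI, ?_⟩
  rw [← ENNReal.ofReal_le_ofReal_iff hb0, ofReal_integral_eq_lintegral_ofReal hI
    (Eventually.of_forall fun _ => (exp_pos _).le)]
  exact hle

end General

theorem continuous_grad {φ : ℂ → ℝ} (h : ContDiff ℝ ∞ φ) : Continuous (grad φ) :=
  (contDiff_grad h).continuous

/-- The divergence theorem for the field φ²z gives ∫_S φ² = ∫_D (2φ ∇φ·z + 2φ²); then 2ab ≤ a² + b²
and |z| ≤ 1. -/
theorem integral_sq_circle_le {φ : ℂ → ℝ} (h : ContDiff ℝ ∞ φ) :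
    ∫ z, ‖φ z‖ ^ 2 ∂circleMeasure ≤
      3 * ∫ z, ‖φ z‖ ^ 2 ∂diskMeasure + ∫ z, ‖grad φ z‖ ^ 2 ∂diskMeasure := by
  have hc := h.continuous
  have hg := green_mul (h.mul h) (Y := fun z => z) contDiff_id
  have hgr : ∀ z, grad (fun x => φ x * φ x) z = 2 * φ z * grad φ z := by
    intro z
    have hd := differentiable_of_contDiff_infty h z
    simp only [grad, fderiv_fun_mul hd hd]
    simp
    ring
  have hw : ∀ z, wirtinger (fun z : ℂ => z) z = 2 := by
    intro z
    simp [wirtinger]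
    norm_num
  have hcirc : ((∫ z, ‖φ z‖ ^ 2 ∂circleMeasure : ℝ) : ℂ) =
      ∫ z, (conj (grad (fun x => φ x * φ x) z) * z +
        ((φ z * φ z : ℝ) : ℂ) * wirtinger (fun z : ℂ => z) z) ∂diskMeasure := by
    rw [hg, integral_circleMeasure (by fun_prop), ← intervalIntegral.integral_ofReal]
    refine intervalIntegral.integral_congr fun θ _ => ?_
    have : conj (circleMap 0 1 θ) * circleMap 0 1 θ = 1 := by
      rw [Complex.conj_mul', norm_circleMap_zero]
      simp
    simp only [this, mul_one, Real.norm_eq_abs, sq_abs]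
    rw [sq]
  have h0 : 0 ≤ ∫ z, ‖φ z‖ ^ 2 ∂circleMeasure := integral_nonneg fun _ => by positivity
  have hi1 : Integrable (fun z => ‖φ z‖ ^ 2) diskMeasure :=
    integrable_disk_of_continuous (by fun_prop)
  have hi2 : Integrable (fun z => ‖grad φ z‖ ^ 2) diskMeasure := by
    have := continuous_grad h
    exact integrable_disk_of_continuous (by fun_prop)
  have h1 : ∫ z, ‖φ z‖ ^ 2 ∂circleMeasure =
      ‖((∫ z, ‖φ z‖ ^ 2 ∂circleMeasure : ℝ) : ℂ)‖ := by
    rw [Complex.norm_real, Real.norm_of_nonneg h0]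
  rw [h1, hcirc, ← integral_const_mul, ← integral_add (hi1.const_mul 3) hi2]
  refine norm_integral_le_of_norm_le ((hi1.const_mul 3).add hi2) ?_
  refine ae_restrict_of_forall_mem Metric.isOpen_ball.measurableSet fun z hz => ?_
  have hz' : ‖z‖ ≤ 1 := by simpa [disk] using (Metric.ball_subset_closedBall hz)
  rw [hgr, hw]
  refine (norm_add_le _ _).trans ?_
  simp only [map_mul, norm_mul, RCLike.norm_conj, Complex.norm_real, Complex.norm_ofNat]
  have ha := norm_nonneg (φ z)
  have hb := norm_nonneg (grad φ z)
  have : 2 * ‖φ z‖ * ‖grad φ z‖ * ‖z‖ ≤ 2 * ‖φ z‖ * ‖grad φ z‖ * 1 := by gcongr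
  nlinarith [sq_nonneg (‖φ z‖ - ‖grad φ z‖)]

/-- The trace inequality for functions smooth up to the boundary. -/
theorem eLpNorm_circle_le {φ : ℂ → ℝ} (h : ContDiff ℝ ∞ φ) :
    eLpNorm φ 2 circleMeasure ≤
      2 * (eLpNorm φ 2 diskMeasure + eLpNorm (grad φ) 2 diskMeasure) := by
  have h1 := memLp_circle_of_continuous h.continuous
  have h2 := memLp_disk_of_continuous h.continuous
  have h3 := memLp_disk_of_continuous (continuous_grad h)
  have h4 := integral_sq_circle_le h
  rw [integral_norm_sq_eq h1, integral_norm_sq_eq h2, integral_norm_sq_eq h3] at h4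
  rw [← ENNReal.toReal_le_toReal h1.2.ne
    (ENNReal.mul_ne_top (by norm_num) (ENNReal.add_ne_top.2 ⟨h2.2.ne, h3.2.ne⟩)),
    ENNReal.toReal_mul, ENNReal.toReal_add h2.2.ne h3.2.ne, ENNReal.toReal_ofNat]
  have ha : 0 ≤ (eLpNorm φ 2 diskMeasure).toReal := ENNReal.toReal_nonneg
  have hb : 0 ≤ (eLpNorm (grad φ) 2 diskMeasure).toReal := ENNReal.toReal_nonneg
  refine abs_le_of_sq_le_sq' ?_ (by positivity) |>.2
  nlinarith [mul_nonneg ha hb, sq_nonneg (eLpNorm φ 2 diskMeasure).toReal,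
    sq_nonneg (eLpNorm (grad φ) 2 diskMeasure).toReal]

theorem isWeakGradient_weakGradient {u : ℂ → ℝ} (hu : u ∈ H1) :
    IsWeakGradient u (weakGradient u) :=
  Classical.epsilon_spec hu.2

/-- Every function of `H¹` has a boundary trace. -/
theorem isTrace_trace {u : ℂ → ℝ} (hu : u ∈ H1) : IsTrace u (trace u) := by
  refine Classical.epsilon_spec (p := IsTrace u) ?_
  have hG := isWeakGradient_weakGradient hu
  obtain ⟨φ, hφ, h1, h2⟩ := exists_smooth_approx hu.1 hG
  have : Fact ((1 : ENNReal) ≤ 2) := ⟨by norm_num⟩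
  have hm : ∀ n, MemLp (φ n) 2 circleMeasure := fun n =>
    memLp_circle_of_continuous (hφ n).continuous
  -- The trace inequality applied to differences makes the boundary restrictions Cauchy in L² of the
  -- circle.
  have hcau : CauchySeq fun n => (hm n).toLp (φ n) := by
    have hsum : Tendsto (fun n => 2 * (eLpNorm (φ n - u) 2 diskMeasure +
        eLpNorm (grad (φ n) - weakGradient u) 2 diskMeasure)) atTop (𝓝 0) := by
      simpa using ENNReal.Tendsto.const_mul (h1.add h2) (Or.inr (by norm_num : (2 : ENNReal) ≠ ⊤))
    rw [EMetric.cauchySeq_iff]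
    intro ε hε
    obtain ⟨N, hN⟩ := eventually_atTop.1 (hsum.eventually (gt_mem_nhds (ENNReal.half_pos hε.ne')))
    refine ⟨N, fun m hmN n hnN => ?_⟩
    rw [Lp.edist_toLp_toLp]
    have hd := (hφ m).sub (hφ n)
    have e1 : φ m - φ n = (φ m - u) - (φ n - u) := by abel
    have e2 : grad (fun x => φ m x - φ n x) =
        (grad (φ m) - weakGradient u) - (grad (φ n) - weakGradient u) := by
      ext z
      rw [grad_sub (differentiable_of_contDiff_infty (hφ m) z)
        (differentiable_of_contDiff_infty (hφ n) z)]
      simp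
    have hmu : ∀ k, AEStronglyMeasurable (φ k - u) diskMeasure := fun k =>
      ((hφ k).continuous.aestronglyMeasurable).sub hu.1.1
    have hmg : ∀ k, AEStronglyMeasurable (grad (φ k) - weakGradient u) diskMeasure := fun k =>
      ((continuous_grad (hφ k)).aestronglyMeasurable).sub hG.memLp.1
    calc eLpNorm (φ m - φ n) 2 circleMeasure
        ≤ 2 * (eLpNorm (φ m - φ n) 2 diskMeasure +
            eLpNorm (grad (fun x => φ m x - φ n x)) 2 diskMeasure) := eLpNorm_circle_le hd
      _ ≤ 2 * ((eLpNorm (φ m - u) 2 diskMeasure + eLpNorm (φ n - u) 2 diskMeasure) +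
            (eLpNorm (grad (φ m) - weakGradient u) 2 diskMeasure +
              eLpNorm (grad (φ n) - weakGradient u) 2 diskMeasure)) := by
          rw [e1, e2]
          gcongr
          · exact eLpNorm_sub_le (hmu m) (hmu n) (by norm_num)
          · exact eLpNorm_sub_le (hmg m) (hmg n) (by norm_num)
      _ = 2 * (eLpNorm (φ m - u) 2 diskMeasure +
              eLpNorm (grad (φ m) - weakGradient u) 2 diskMeasure) +
            2 * (eLpNorm (φ n - u) 2 diskMeasure +
              eLpNorm (grad (φ n) - weakGradient u) 2 diskMeasure) := by ring
      _ < ε / 2 + ε / 2 := ENNReal.add_lt_add (hN m hmN) (hN n hnN)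
      _ = ε := ENNReal.add_halves ε
  obtain ⟨g, hg⟩ := cauchySeq_tendsto_of_complete hcau
  refine ⟨g, Lp.memLp g, φ, hφ, h1, h2, ?_⟩
  rw [← Lp.tendsto_Lp_iff_tendsto_eLpNorm'' φ hm g (Lp.memLp g), Lp.toLp_coeFn]
  exact hg

/-! ### The exponential inequalities in H¹. -/

/-- The two sharp exponential inequalities for functions of `H¹` of the disk. -/
theorem exp_inequalities {u : ℂ → ℝ} (hu : u ∈ H1) :
    (Integrable (fun z => exp (u z)) diskMeasure ∧ ∫ z, exp (u z) ∂diskMeasure ≤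
      2 * π * exp (1 / (8 * π) * ∫ z, ‖weakGradient u z‖ ^ 2 ∂diskMeasure +
        1 / (2 * π) * ∫ z, trace u z ∂circleMeasure)) ∧
    (Integrable (fun z => exp (trace u z / 2)) circleMeasure ∧
      ∫ z, exp (trace u z / 2) ∂circleMeasure ≤
      2 * π * exp (1 / (16 * π) * ∫ z, ‖weakGradient u z‖ ^ 2 ∂diskMeasure +
        1 / (4 * π) * ∫ z, trace u z ∂circleMeasure)) := by
  obtain ⟨hg2, φ, hφ, h1, h2, h3⟩ := isTrace_trace hu
  have hG := isWeakGradient_weakGradient hu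
  have hm : ∀ n, MemLp (φ n) 2 circleMeasure := fun n =>
    memLp_circle_of_continuous (hφ n).continuous
  have hE : Tendsto (fun n => dirichlet (φ n)) atTop
      (𝓝 (∫ z, ‖weakGradient u z‖ ^ 2 ∂diskMeasure)) :=
    tendsto_integral_norm_sq (fun n => memLp_disk_of_continuous (continuous_grad (hφ n)))
      hG.memLp h2
  have hS := tendsto_integral_of_eLpNorm_two hm hg2 h3
  have hexp : ∀ c d : ℝ, Tendsto (fun n => 2 * π * exp (c * dirichlet (φ n) +
      d * ∫ z, φ n z ∂circleMeasure)) atTop (𝓝 (2 * π * exp (c *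
        ∫ z, ‖weakGradient u z‖ ^ 2 ∂diskMeasure + d * ∫ z, trace u z ∂circleMeasure))) :=
    fun c d => ((continuous_exp.tendsto _).comp
      ((hE.const_mul c).add (hS.const_mul d))).const_mul _
  constructor
  · refine integrable_exp_of_tendsto (fun n => (hφ n).continuous.aestronglyMeasurable) hu.1.1 h1
      (fun n => integrable_disk_of_continuous (by have := (hφ n).continuous; fun_prop))
      (fun n => ?_) (hexp _ _)
    rw [integral_circleMeasure (hφ n).continuous]
    exact integral_exp_disk_le (hφ n)
  · have hh : Tendsto (fun n => eLpNorm ((fun z => φ n z / 2) - fun z => trace u z / 2) 2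
        circleMeasure) atTop (𝓝 0) := by
      have h4 := ENNReal.Tendsto.const_mul (a := ‖(2⁻¹ : ℝ)‖ₑ) h3 (Or.inr (by simp))
      rw [mul_zero] at h4
      refine h4.congr fun n => ?_
      rw [← eLpNorm_const_smul]
      congr 1
      ext z
      simp
      ring
    refine integrable_exp_of_tendsto
      (fun n => ((hφ n).continuous.div_const 2).aestronglyMeasurable)
      ((continuous_id.div_const 2).comp_aestronglyMeasurable hg2.1) hh
      (fun n => integrable_circle_of_continuous (by have := (hφ n).continuous; fun_prop))
      (fun n => ?_) (hexp _ _)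
    have hc := (hφ n).continuous
    rw [integral_circleMeasure (by fun_prop), integral_circleMeasure hc]
    -- For φ/2 the energy is divided by 4 and the mean by 2, which yields the constants 1/(16π) and
    -- 1/(4π).
    refine (integral_exp_circle_le (u := fun z => φ n z / 2) ((hφ n).div_const 2)).trans
      (le_of_eq ?_)
    have hd : dirichlet (fun z => φ n z / 2) = dirichlet (φ n) / 4 := by
      have : ∀ z, grad (fun z => φ n z / 2) z = 2⁻¹ * grad (φ n) z := by
        intro z
        have := grad_const_mul (differentiable_of_contDiff_infty (hφ n) z) 2⁻¹
        simpa [div_eq_inv_mul] using this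
      simp only [dirichlet, this, norm_mul, mul_pow, integral_const_mul]
      norm_num
      ring
    rw [hd, intervalIntegral.integral_div]
    congr 2
    field_simp
    ring

/-! ### The lower bound for the functional. -/

theorem neg_one_le_mul_log {x : ℝ} (hx : 0 ≤ x) : -1 ≤ x * log x := by
  rcases hx.eq_or_lt with rfl | hx
  · simp
  · have h := Real.one_sub_inv_le_log_of_pos hx
    have := mul_le_mul_of_nonneg_left h hx.le
    rw [mul_sub, mul_inv_cancel₀ hx.ne'] at this
    linarith

/-- If `0 < ∫ k e^w` with `k ≤ M` then the logarithm of this integral is controlled by that of a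
bound for `∫ e^w`. -/
theorem log_integral_mul_exp_le {μ : Measure ℂ} {k w : ℂ → ℝ} {M A : ℝ} (hM : 0 < M)
    (hk : ∀ᵐ z ∂μ, k z ≤ M) (hpos : 0 < ∫ z, k z * exp (w z) ∂μ)
    (hw : Integrable (fun z => exp (w z)) μ) (hA : ∫ z, exp (w z) ∂μ ≤ 2 * π * exp A) :
    log (∫ z, k z * exp (w z) ∂μ) ≤ log (M * (2 * π)) + A := by
  -- A nonintegrable function would have integral 0 by convention, against positivity.
  have hi : Integrable (fun z => k z * exp (w z)) μ := by
    by_contra hn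
    rw [integral_undef hn] at hpos
    exact hpos.false
  have h1 : ∫ z, k z * exp (w z) ∂μ ≤ M * (2 * π) * exp A := by
    calc ∫ z, k z * exp (w z) ∂μ ≤ ∫ z, M * exp (w z) ∂μ := by
          refine integral_mono_ae hi (hw.const_mul M) (hk.mono fun z hz => ?_)
          exact mul_le_mul_of_nonneg_right hz (exp_pos _).le
      _ = M * ∫ z, exp (w z) ∂μ := integral_const_mul _ _
      _ ≤ M * (2 * π * exp A) := mul_le_mul_of_nonneg_left hA hM.le
      _ = _ := by ring
  calc log (∫ z, k z * exp (w z) ∂μ) ≤ log (M * (2 * π) * exp A) := log_le_log hpos h1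
    _ = _ := by rw [log_mul (by positivity) (exp_pos _).ne', log_exp]

/-- With L = log (2πM) ≥ 0, the two logarithmic bounds cancel the energy and the mean and leave -8πL
+ 2ρL ≥ -8πL. The bound x log x ≥ -1, valid also at 0, costs 4 for x = 2π - ρ and 2 for x = ρ, hence
the 6. -/
theorem energy_ge {K h : ℂ → ℝ} {M : ℝ} (hM : 0 < M) (hL : 0 ≤ log (M * (2 * π)))
    (hK : ∀ z ∈ disk, K z ≤ M) (hh : ∀ z ∈ Metric.sphere (0 : ℂ) 1, h z ≤ M) {u : ℂ → ℝ}
    (hu : u ∈ spaceX K h) {ρ : ℝ} (hρ : ρ ∈ Icc 0 (2 * π)) :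
    -(8 * π) * log (M * (2 * π)) - 6 ≤ energy K h ρ u := by
  obtain ⟨hu1, hu2, hu3⟩ := hu
  obtain ⟨⟨hi1, hb1⟩, hi2, hb2⟩ := exp_inequalities hu1
  have l1 := log_integral_mul_exp_le (μ := diskMeasure) hM
    (ae_restrict_of_forall_mem Metric.isOpen_ball.measurableSet hK) hu2 hi1 hb1
  have l2 := log_integral_mul_exp_le (w := fun z => trace u z / 2) hM
    (ae_circleMeasure_mem_sphere.mono hh) hu3 hi2 hb2
  obtain ⟨hρ0, hρ1⟩ := hρ
  have hρ2 : 0 ≤ 2 * π - ρ := by linarith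
  have x1 := neg_one_le_mul_log hρ0
  have x2 := neg_one_le_mul_log hρ2
  have m1 := mul_le_mul_of_nonneg_left l1 hρ0
  have m2 := mul_le_mul_of_nonneg_left l2 hρ2
  have m3 := mul_nonneg hρ0 hL
  rw [energy]
  set E := ∫ z, ‖weakGradient u z‖ ^ 2 ∂diskMeasure
  set S := ∫ z, trace u z ∂circleMeasure
  set L := log (M * (2 * π))
  have key : 2 * (ρ * (L + (1 / (8 * π) * E + 1 / (2 * π) * S))) +
      4 * ((2 * π - ρ) * (L + (1 / (16 * π) * E + 1 / (4 * π) * S))) =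
      1 / 2 * E + 2 * S + (8 * π) * L - 2 * (ρ * L) := by
    field_simp
    ring
  linarith

end DiskCurvature

theorem mainTheorem5 (K h : ℂ → ℝ)
    (hK : ContinuousOn K (Metric.closedBall 0 1))
    (hh : ContinuousOn h (Metric.sphere 0 1)) :
    ∃ C : ℝ, ∀ u ∈ DiskCurvature.spaceX K h, ∀ ρ ∈ Set.Icc 0 (2 * Real.pi),
      C ≤ DiskCurvature.energy K h ρ u := by
  obtain ⟨M₁, hM₁⟩ := (isCompact_closedBall (0 : ℂ) 1).exists_bound_of_continuousOn hK
  obtain ⟨M₂, hM₂⟩ := (isCompact_sphere (0 : ℂ) 1).exists_bound_of_continuousOn hh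
  -- Including 1 in the maximum ensures M > 0 and log (2πM) ≥ 0, whatever the signs of K and h.
  have h1 : 1 ≤ max 1 (max M₁ M₂) := le_max_left _ _
  refine ⟨_, fun u hu ρ hρ => DiskCurvature.energy_ge (M := max 1 (max M₁ M₂)) (by linarith)
    (Real.log_nonneg (by nlinarith [Real.pi_gt_three])) (fun z hz => ?_) (fun z hz => ?_) hu hρ⟩
  · exact (le_abs_self _).trans ((hM₁ z (Metric.ball_subset_closedBall hz)).trans
      ((le_max_left _ _).trans (le_max_right _ _)))
  · exact (le_abs_self _).trans ((hM₂ z hz).trans ((le_max_right _ _).trans (le_max_right _ _)))
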